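/- Let $D\subset\mathbb C^n$ be a domain, let $a=a_{i\bar j}(z)\,dz^i\otimes d\bar z^j$ be a smooth positive definite Hermitian metric on $D$ and $b=b_i(z)\,dz^i$ a smooth (not necessarily holomorphic) $(1,0)$-form on $D$ with $b_z\neq0$ for every $z\in D$. Put $\alpha(z,\eta)=\sqrt{a_{i\bar j}(z)\eta^i\bar\eta^j}$, $\beta(z,\eta)=b_i(z)\eta^i$, and let $F=\alpha+|\beta|$ be the associated complex Randers metric. Let $\Omega_F=\{(z,\eta):z\in D,\ \beta(z,\eta)\ne0\}$, on which $F$ is smooth, and $\Omega_a=\{(z,\eta):z\in D,\ \eta\neq0\}$; statements about the metric $a$ refer to $\alpha$. Conventions. For a metric $\Phi(z,\eta)$, where it is smooth, put $$g_{i\bar j}=\frac{\partial^2\Phi^2}{\partial\eta^i\partial\bar\eta^j},\quad N^i_j=g^{\bar m i}\frac{\partial g_{l\bar m}}{\partial z^j}\eta^l,\quad G^i=\tfrac12N^i_j\eta^j,\quad L^i_{jk}=\frac{\partial N^i_k}{\partial\eta^j},$$ $$\theta^{*k}=g^{\bar mk}g_{h\bar p}\bigl(\overline{L^p_{jm}}-\overline{L^p_{mj}}\bigr)\eta^h\bar\eta^j,\qquad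 \mathcal K_\Phi(z,\eta)=-\frac4{\Phi^4}\,g_{k\bar m}\frac{\partial G^k}{\partial\bar z^h}\bar\eta^h\bar\eta^m .$$ Two metrics $\Phi,\tilde\Phi$ are *projectively related* over a set on which both are smooth if there is a smooth complex-valued function $P$ on that set with $\tilde G^i=G^i+\tfrac12(\tilde\theta^{*i}-\theta^{*i})+P\eta^i$ for all $i$. A *complex Finsler metric* on $D$ is a continuous function $\Phi:D\times\mathbb C^n\to[0,\infty)$, smooth for $\eta\ne0$, vanishing exactly at $\eta=0$, with $\Phi(z,\lambda\eta)=|\lambda|\Phi(z,\eta)$ for $\lambda\in\mathbb C$ and with $(g_{i\bar j})$ positive definite for $\eta\neq 0$; it is *locally Minkowski* if around every point of $D$ there is a holomorphic chart in which $g_{i\bar j}$ depends only on $\eta$. A metric is *locally projectively flat* if it is projectively related, over $\Omega_F$ for $F$ and over $\Omega_a$ for $a$, to some locally Minkowski complex Finsler metric on $D$. **Proposition 4.2.** $F$ is locally projectively flat if and only if $a$ and $F$ are projectively related (over $\Omega_F$) and $a$ is locally projectively flat. Moreover, if $n\ge2$, either of these two assertions implies $\mathcal K_F=0$ on $\Omega_F$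 and $\mathcal K_a=0$ on $\Omega_a$. -/

import Mathlib

open scoped ContDiff ComplexOrder

noncomputable section

namespace ComplexFinsler

/-- The coordinate space `ℂⁿ`, used both for base points `z` and for holomorphic tangent
vectors `η` in the coordinate frame `∂/∂zⁱ`. -/
abbrev Cn (n : ℕ) : Type := Fin n → ℂ

variable {n : ℕ}

/-- The Wirtinger derivative `∂f/∂xⁱ = (∂f/∂(Re xⁱ) - I ∂f/∂(Im xⁱ)) / 2`. -/
def del (i : Fin n) (f : Cn n → ℂ) (x : Cn n) : ℂ :=
  (1 / 2 : ℂ) *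
    (fderiv ℝ f x (Pi.single i 1) - Complex.I * fderiv ℝ f x (Pi.single i Complex.I))

/-- The Wirtinger derivative `∂f/∂x̄ⁱ = (∂f/∂(Re xⁱ) + I ∂f/∂(Im xⁱ)) / 2`. -/
def delbar (i : Fin n) (f : Cn n → ℂ) (x : Cn n) : ℂ :=
  (1 / 2 : ℂ) *
    (fderiv ℝ f x (Pi.single i 1) + Complex.I * fderiv ℝ f x (Pi.single i Complex.I))

/-- The fundamental tensor `g_{i j̄} = ∂²F² / ∂ηⁱ ∂η̄ʲ` as a matrix (row `i`, column `j`). -/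
def fundTensor (F : Cn n → Cn n → ℝ) (z η : Cn n) : Matrix (Fin n) (Fin n) ℂ :=
  fun i j => del i (fun ξ => delbar j (fun ζ => ((F z ζ ^ 2 : ℝ) : ℂ)) ξ) η

/-- The Chern-Finsler connection coefficients
`N^i_j = g^{m̄ i} (∂g_{l m̄}/∂zʲ) ηˡ`, where `g^{m̄ i} g_{l m̄} = δ^i_l`. -/
def connCoeff (F : Cn n → Cn n → ℝ) (z η : Cn n) (i j : Fin n) : ℂ :=
  ∑ m, ∑ l, (fundTensor F z η)⁻¹ m i * del j (fun w => fundTensor F w η l m) z * η l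

/-- The spray coefficients `G^i`, with `2 G^i = N^i_j ηʲ`. -/
def spray (F : Cn n → Cn n → ℝ) (z η : Cn n) (i : Fin n) : ℂ :=
  (1 / 2 : ℂ) * ∑ j, connCoeff F z η i j * η j

/-- The horizontal coefficients `L^i_{jk} = ∂N^i_k / ∂ηʲ`. -/
def horCoeff (F : Cn n → Cn n → ℝ) (z η : Cn n) (i j k : Fin n) : ℂ :=
  del j (fun ξ => connCoeff F z ξ i k) η

/-- The functions
`θ*^k = g^{m̄ k} g_{h p̄} (L^{p̄}_{j̄ m̄} - L^{p̄}_{m̄ j̄}) ηʰ η̄ʲ`, where `L^{p̄}_{j̄ m̄}` is the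
complex conjugate of `L^p_{jm}`. The geodesics of `F` are the solutions of
`γ'' + 2 G(γ, γ') = θ*(γ, γ')`. -/
def thetaStar (F : Cn n → Cn n → ℝ) (z η : Cn n) (k : Fin n) : ℂ :=
  ∑ m, ∑ h, ∑ p, ∑ j,
    (fundTensor F z η)⁻¹ m k * fundTensor F z η h p *
      star (horCoeff F z η p j m - horCoeff F z η p m j) * η h * star (η j)

/-- The holomorphic curvature
`K_F(z, η) = -(4 / F⁴) g_{k m̄} (∂G^k/∂z̄ʰ) η̄ʰ η̄ᵐ` in direction `η`. -/
def holCurv (F : Cn n → Cn n → ℝ) (z η : Cn n) : ℂ :=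
  -(4 / ((F z η ^ 4 : ℝ) : ℂ)) *
    ∑ k, ∑ m, ∑ h,
      fundTensor F z η k m * delbar h (fun w => spray F w η k) z * star (η h) * star (η m)

/-- The holomorphic tangent bundle of `D` without its zero section. -/
def slit (D : Set (Cn n)) : Set (Cn n × Cn n) := {x | x.1 ∈ D ∧ x.2 ≠ 0}

/-- `F` is a complex Finsler metric on the open set `D ⊆ ℂⁿ`. -/
structure IsFinslerMetric (D : Set (Cn n)) (F : Cn n → Cn n → ℝ) : Prop where
  continuousOn : ContinuousOn (fun x : Cn n × Cn n => F x.1 x.2) {x | x.1 ∈ D}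
  smooth : ContDiffOn ℝ ∞ (fun x : Cn n × Cn n => F x.1 x.2) (slit D)
  nonneg : ∀ z ∈ D, ∀ η, 0 ≤ F z η
  eq_zero_iff : ∀ z ∈ D, ∀ η, F z η = 0 ↔ η = 0
  homogeneous : ∀ z ∈ D, ∀ (c : ℂ) (η : Cn n), F z (c • η) = ‖c‖ * F z η
  posDef : ∀ z ∈ D, ∀ η, η ≠ 0 → (fundTensor F z η).PosDef

/-- The expression of `F` in the chart `e`: `(w, ξ) ↦ F(e⁻¹ w, (de⁻¹)_w ξ)`. -/
def inChart (e : OpenPartialHomeomorph (Cn n) (Cn n)) (F : Cn n → Cn n → ℝ) :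
    Cn n → Cn n → ℝ :=
  fun w ξ => F (e.symm w) (fderiv ℂ e.symm w ξ)

/-- `F` is locally Minkowski on `D`: around every point of `D` there is a holomorphic chart in
which the fundamental tensor depends only on the direction. -/
def IsLocallyMinkowski (D : Set (Cn n)) (F : Cn n → Cn n → ℝ) : Prop :=
  ∀ p ∈ D, ∃ e : OpenPartialHomeomorph (Cn n) (Cn n),
    p ∈ e.source ∧ e.source ⊆ D ∧
    DifferentiableOn ℂ e e.source ∧ DifferentiableOn ℂ e.symm e.target ∧
    ∀ w ∈ e.target, ∀ w' ∈ e.target, ∀ ξ : Cn n, ξ ≠ 0 →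
      fundTensor (inChart e F) w ξ = fundTensor (inChart e F) w' ξ

/-- `F` and `F'` are projectively related over `Ω`, a set of pairs `(z, η)` on which both are
smooth: their sprays differ by a projective change `G'^i = G^i + B^i + P ηⁱ` with
`B^i = (θ'*^i - θ*^i) / 2` and `P` a smooth complex-valued function. -/
def ProjRelated (Ω : Set (Cn n × Cn n)) (F F' : Cn n → Cn n → ℝ) : Prop :=
  ∃ P : Cn n × Cn n → ℂ, ContDiffOn ℝ ∞ P Ω ∧
    ∀ z η : Cn n, (z, η) ∈ Ω → ∀ i : Fin n,
      spray F' z η i = spray F z η i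
        + (1 / 2 : ℂ) * (thetaStar F' z η i - thetaStar F z η i) + P (z, η) * η i

/-- A metric `F` on `D`, smooth on `Ω ⊆ slit D`, is locally projectively flat if it is
projectively related to some locally Minkowski complex Finsler metric on `D`. -/
def IsLocProjFlat (D : Set (Cn n)) (Ω : Set (Cn n × Cn n)) (F : Cn n → Cn n → ℝ) : Prop :=
  ∃ M : Cn n → Cn n → ℝ,
    IsFinslerMetric D M ∧ IsLocallyMinkowski D M ∧ ProjRelated Ω F M

/-- `α(z, η) = √(a_{i j̄}(z) ηⁱ η̄ʲ)`, the Hermitian metric `a` as a Finsler metric. -/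
def hermNorm (a : Cn n → Matrix (Fin n) (Fin n) ℂ) (z η : Cn n) : ℝ :=
  √(∑ i, ∑ j, a z i j * η i * star (η j)).re

/-- `β(z, η) = b_i(z) ηⁱ`. -/
def oneForm (b : Cn n → Cn n) (z η : Cn n) : ℂ := ∑ i, b z i * η i

/-- The complex Randers metric `F = α + |β|`. -/
def randers (a : Cn n → Matrix (Fin n) (Fin n) ℂ) (b : Cn n → Cn n) (z η : Cn n) : ℝ :=
  hermNorm a z η + ‖oneForm b z η‖

/-- The pairs `(z, η)` over `D` with `β(z, η) ≠ 0`: the locus where `α + |β|` is smooth. -/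
def randersDomain (D : Set (Cn n)) (b : Cn n → Cn n) : Set (Cn n × Cn n) :=
  {x | x.1 ∈ D ∧ oneForm b x.1 x.2 ≠ 0}

end ComplexFinsler

end

open scoped ContDiff ComplexOrder

noncomputable section

namespace ComplexFinsler

open Filter Topology

variable {n : ℕ}

/-! ### Wirtinger derivatives along a vector -/

section Wirtinger

variable {E : Type*} [NormedAddCommGroup E] [NormedSpace ℝ E] [NormedSpace ℂ E]

/-! The implication from right to left is transitivity of projective relations; the converse and the
curvature statement carry the content. Let `F` be projectively related to a locally Minkowski metric
`M`. In an adapted chart `e`, `M²` is a fixed function of `de_z(η)`, so locally the connection of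
`M` is linear, symmetric and holomorphic in `z`, with coefficients `Γ`. Hence `θ*` of `M` vanishes
and its spray is `½ Γ(η, η)` (`IsLocallyMinkowski.exists_flatModel`).

The relation then splits by weight. Replacing `η` by `iη` reverses the sprays and fixes `θ*`, so
`θ*` of `F` is a multiple of `η`. It is also orthogonal to `η`, hence zero, and `½ Γ(η, η) = G + pη`
for the spray `G` of `F` (`RegularOn.split_of_projective`). Neither fact needs the inverse of `g` to
be exploited: the field `χ = (η, -2G)` annihilates every `∂F²/∂η̄ᵐ`, and `θ* = 0` means `∂F²/∂zᵐ =
χ(∂F²/∂ηᵐ)`. So `(η, -Γ(η, η))` multiplies `F²` and each `∂F²/∂η̄ᵐ` by `-2p`.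

For `n ≥ 2` the key is irrationality of `α`. Along a real line `η + tv` with `v ∈ ker b`, `β` is
constant while `α²` is a positive quadratic polynomial in `t`, whose square root is not rational
(`IsPoly.eq_zero_of_sqrt`). Every identity `E + αO = 0` with `E`, `O` polynomial on such lines
therefore gives `E = O = 0`. This shows that the covariant derivative `∇a(η, η; ·)` is a multiple of
`a(η, ·)`, that `∂̄b` is proportional to `b`, and that `a` is Kähler (`randers_holomorphic_part`,
`randers_torsion_part`). So the Chern connection of `a` is symmetric and its spray differs from `½
Γ(η, η)` by a multiple of `η`: `a` is projectively related to `M`, hence to `F`. For `n ≤ 1` these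
facts are automatic.

For the curvature, the difference between the Chern connection of `a` and `Γ` has the form `c_j
δ^i_k + c_k δ^i_j`. The factor of `F` is the same form `c`, so `F` and `a` have equal sprays, and it
remains to see `∂̄c = 0`. The ratios `b_k/b_m` are holomorphic, and differentiating them shows that
`c_k - (b_k/b_m) c_m` is holomorphic. Thus `∂̄c_k = (b_k/b_m) φ` for a single `φ = ∂̄c_m`, and
commuting `∂` with `∂̄` on `a` yields an algebraic identity which forces `φ = 0` when `n ≥ 2`
(`eq_zero_of_mixed`). The sprays are then holomorphic in `z`, and the curvature is linear in
`∂G/∂z̄`. -/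

/-- The `ℂ`-linear part of the real derivative of `f` at `x`, applied to `V`. -/
def dC (f : E → ℂ) (x V : E) : ℂ :=
  (1 / 2 : ℂ) * (fderiv ℝ f x V - Complex.I * fderiv ℝ f x (Complex.I • V))

/-- The `ℂ`-antilinear part of the real derivative of `f` at `x`, applied to `V`. -/
def dCbar (f : E → ℂ) (x V : E) : ℂ :=
  (1 / 2 : ℂ) * (fderiv ℝ f x V + Complex.I * fderiv ℝ f x (Complex.I • V))

/-- `f` is real differentiable at `x`, and its Wirtinger derivatives along `V` are `p` and `q`. -/
structure HasWirt (f : E → ℂ) (x V : E) (p q : ℂ) : Prop where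
  diff : DifferentiableAt ℝ f x
  dC_eq : dC f x V = p
  dCbar_eq : dCbar f x V = q

theorem hasWirt {f : E → ℂ} {x : E} (h : DifferentiableAt ℝ f x) (V : E) :
    HasWirt f x V (dC f x V) (dCbar f x V) := ⟨h, rfl, rfl⟩

namespace HasWirt

variable {f g : E → ℂ} {x V : E} {p q p' q' : ℂ}

theorem congr (h : HasWirt f x V p q) (hg : g =ᶠ[𝓝 x] f) : HasWirt g x V p q := by
  refine ⟨h.diff.congr_of_eventuallyEq hg, ?_, ?_⟩
  · rw [← h.dC_eq, dC, dC, hg.fderiv_eq]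
  · rw [← h.dCbar_eq, dCbar, dCbar, hg.fderiv_eq]

theorem of_eq (h : HasWirt f x V p q) (hp : p = p') (hq : q = q') : HasWirt f x V p' q' := by
  subst hp hq; exact h

theorem const (c : ℂ) : HasWirt (fun _ : E => c) x V 0 0 := by
  refine ⟨differentiableAt_const _, ?_, ?_⟩ <;> simp [dC, dCbar]

theorem add (hf : HasWirt f x V p q) (hg : HasWirt g x V p' q') :
    HasWirt (fun y => f y + g y) x V (p + p') (q + q') := by
  refine ⟨hf.diff.fun_add hg.diff, ?_, ?_⟩
  · rw [← hf.dC_eq, ← hg.dC_eq]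
    simp only [dC, fderiv_fun_add hf.diff hg.diff, _root_.add_apply]; ring
  · rw [← hf.dCbar_eq, ← hg.dCbar_eq]
    simp only [dCbar, fderiv_fun_add hf.diff hg.diff, _root_.add_apply]; ring

theorem mul (hf : HasWirt f x V p q) (hg : HasWirt g x V p' q') :
    HasWirt (fun y => f y * g y) x V (p * g x + f x * p') (q * g x + f x * q') := by
  refine ⟨hf.diff.fun_mul hg.diff, ?_, ?_⟩
  · rw [← hf.dC_eq, ← hg.dC_eq]
    simp only [dC, fderiv_fun_mul hf.diff hg.diff, _root_.add_apply,
      _root_.smul_apply, smul_eq_mul]; ring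
  · rw [← hf.dCbar_eq, ← hg.dCbar_eq]
    simp only [dCbar, fderiv_fun_mul hf.diff hg.diff, _root_.add_apply,
      _root_.smul_apply, smul_eq_mul]; ring

theorem const_mul (c : ℂ) (hf : HasWirt f x V p q) :
    HasWirt (fun y => c * f y) x V (c * p) (c * q) :=
  ((HasWirt.const c).mul hf).of_eq (by ring) (by ring)

theorem neg (hf : HasWirt f x V p q) : HasWirt (fun y => - f y) x V (-p) (-q) := by
  have := hf.const_mul (-1)
  simpa using this

theorem sub (hf : HasWirt f x V p q) (hg : HasWirt g x V p' q') :
    HasWirt (fun y => f y - g y) x V (p - p') (q - q') := by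
  simpa [sub_eq_add_neg] using hf.add hg.neg

theorem sum {ι : Type*} (s : Finset ι) {f : ι → E → ℂ} {p q : ι → ℂ}
    (h : ∀ i ∈ s, HasWirt (f i) x V (p i) (q i)) :
    HasWirt (fun y => ∑ i ∈ s, f i y) x V (∑ i ∈ s, p i) (∑ i ∈ s, q i) := by
  classical
  induction s using Finset.induction_on with
  | empty => simpa using HasWirt.const (E := E) 0
  | insert a s ha ih =>
    simp only [Finset.sum_insert ha]
    exact (h a (by simp)).add (ih fun i hi => h i (by simp [hi]))

theorem conj (hf : HasWirt f x V p q) : HasWirt (fun y => star (f y)) x V (star q) (star p) := by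
  have key : HasFDerivAt (fun y => star (f y))
      ((Complex.conjCLE : ℂ →L[ℝ] ℂ).comp (fderiv ℝ f x)) x :=
    (Complex.conjCLE : ℂ →L[ℝ] ℂ).hasFDerivAt.comp x hf.diff.hasFDerivAt
  refine ⟨key.differentiableAt, ?_, ?_⟩
  · rw [← hf.dCbar_eq]
    rw [dC, dCbar, key.fderiv]
    simp [sub_eq_add_neg]
  · rw [← hf.dC_eq]
    rw [dC, dCbar, key.fderiv]
    simp [sub_eq_add_neg]

theorem unique_left (h : HasWirt f x V p q) (h' : HasWirt f x V p' q') : p = p' :=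
  h.dC_eq.symm.trans h'.dC_eq

theorem unique_right (h : HasWirt f x V p q) (h' : HasWirt f x V p' q') : q = q' :=
  h.dCbar_eq.symm.trans h'.dCbar_eq

/-- Division, for a quotient given implicitly. -/
theorem div (hf : HasWirt f x V p q) (hg : HasWirt g x V p' q') (h0 : g x ≠ 0) :
    HasWirt (fun y => f y / g y) x V ((p * g x - f x * p') / g x ^ 2)
      ((q * g x - f x * q') / g x ^ 2) := by
  have hd : DifferentiableAt ℝ (fun y => f y / g y) x := by
    simp only [div_eq_mul_inv]
    exact hf.diff.mul (hg.diff.inv h0)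
  -- The product rule for `f = (f / g) * g` is solved for the derivatives of `f / g`.
  have h1 := (hasWirt hd V).mul hg
  have hev : f =ᶠ[𝓝 x] fun y => f y / g y * g y := by
    filter_upwards [hg.diff.continuousAt.eventually_ne h0] with y hy
    field_simp
  have h2 := h1.congr hev
  refine (hasWirt hd V).of_eq ?_ ?_
  · have := hf.unique_left h2
    rw [this]; field_simp; ring
  · have := hf.unique_right h2
    rw [this]; field_simp; ring

/-- The square root rule, for a square root given implicitly. -/
theorem of_sq (hd : DifferentiableAt ℝ f x) (hsq : (fun y => f y ^ 2) =ᶠ[𝓝 x] g)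
    (hg : HasWirt g x V p q) (h0 : f x ≠ 0) :
    HasWirt f x V (p / (2 * f x)) (q / (2 * f x)) := by
  have h1 := (hasWirt hd V).mul (hasWirt hd V)
  have h2 := hg.congr hsq
  have h3 : (fun y => f y ^ 2) = fun y => f y * f y := by ext; ring
  rw [h3] at h2
  refine (hasWirt hd V).of_eq ?_ ?_
  · rw [h2.unique_left h1]; field_simp; ring
  · rw [h2.unique_right h1]; field_simp; ring

end HasWirt

theorem dC_add_right (f : E → ℂ) (x V W : E) : dC f x (V + W) = dC f x V + dC f x W := by
  simp only [dC, smul_add, map_add]; ring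

theorem dCbar_add_right (f : E → ℂ) (x V W : E) :
    dCbar f x (V + W) = dCbar f x V + dCbar f x W := by
  simp only [dCbar, smul_add, map_add]; ring

@[simp] theorem dC_zero_right (f : E → ℂ) (x : E) : dC f x 0 = 0 := by simp [dC]

@[simp] theorem dCbar_zero_right (f : E → ℂ) (x : E) : dCbar f x 0 = 0 := by simp [dCbar]

theorem dC_sum_right {ι : Type*} (s : Finset ι) (f : E → ℂ) (x : E) (V : ι → E) :
    dC f x (∑ i ∈ s, V i) = ∑ i ∈ s, dC f x (V i) := by
  classical
  induction s using Finset.induction_on with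
  | empty => simp
  | insert a s ha ih => simp only [Finset.sum_insert ha, dC_add_right, ih]

theorem dCbar_sum_right {ι : Type*} (s : Finset ι) (f : E → ℂ) (x : E) (V : ι → E) :
    dCbar f x (∑ i ∈ s, V i) = ∑ i ∈ s, dCbar f x (V i) := by
  classical
  induction s using Finset.induction_on with
  | empty => simp
  | insert a s ha ih => simp only [Finset.sum_insert ha, dCbar_add_right, ih]

section Tower

variable [IsScalarTower ℝ ℂ E]

theorem complex_smul_eq (c : ℂ) (V : E) : c • V = c.re • V + c.im • (Complex.I • V) := by
  conv_lhs => rw [← Complex.re_add_im c, add_smul, mul_smul]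
  simp only [← Complex.coe_algebraMap, algebraMap_smul]

theorem dC_smul_right (f : E → ℂ) (x : E) (c : ℂ) (V : E) : dC f x (c • V) = c * dC f x V := by
  have hI : Complex.I • (c • V) = c.re • (Complex.I • V) - c.im • V := by
    rw [smul_comm, complex_smul_eq c (Complex.I • V), smul_smul, Complex.I_mul_I, neg_smul,
      one_smul, smul_neg, sub_eq_add_neg]
  rw [dC, dC, hI, complex_smul_eq c V]
  simp only [map_add, map_sub, map_smul, Complex.real_smul]
  conv_rhs => rw [← Complex.re_add_im c]
  linear_combination ((1 / 2) * (c.im : ℂ) * fderiv ℝ f x (Complex.I • V)) * Complex.I_mul_I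

theorem dCbar_smul_right (f : E → ℂ) (x : E) (c : ℂ) (V : E) :
    dCbar f x (c • V) = star c * dCbar f x V := by
  have hI : Complex.I • (c • V) = c.re • (Complex.I • V) - c.im • V := by
    rw [smul_comm, complex_smul_eq c (Complex.I • V), smul_smul, Complex.I_mul_I, neg_smul,
      one_smul, smul_neg, sub_eq_add_neg]
  have hs : star c = c.re - c.im * Complex.I := by
    apply Complex.ext <;> simp
  rw [dCbar, dCbar, hI, complex_smul_eq c V, hs]
  simp only [map_add, map_sub, map_smul, Complex.real_smul]
  linear_combination ((1 / 2) * (c.im : ℂ) * fderiv ℝ f x (Complex.I • V)) * Complex.I_mul_I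

theorem HasWirt.of_holo {f : E → ℂ} {f' : E →L[ℂ] ℂ} {x : E} (h : HasFDerivAt f f' x) (V : E) :
    HasWirt f x V (f' V) 0 := by
  have hr := h.restrictScalars ℝ
  refine ⟨hr.differentiableAt, ?_, ?_⟩
  · simp only [dC, hr.fderiv, ContinuousLinearMap.coe_restrictScalars', map_smul, smul_eq_mul]
    linear_combination (-(1 / 2) * f' V) * Complex.I_mul_I
  · simp only [dCbar, hr.fderiv, ContinuousLinearMap.coe_restrictScalars', map_smul, smul_eq_mul]
    linear_combination ((1 / 2) * f' V) * Complex.I_mul_I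

/-- A holomorphic inner map does not mix `∂` and `∂̄`. The changes of variable made below (slices,
fibre scalings, charts) are all of this kind. -/
theorem HasWirt.comp_holo {E' : Type*} [NormedAddCommGroup E'] [NormedSpace ℝ E']
    [NormedSpace ℂ E'] [IsScalarTower ℝ ℂ E'] {f : E → ℂ} {φ : E' → E} {φ' : E' →L[ℂ] E} {x : E'}
    {V : E'} {p q : ℂ} (hf : HasWirt f (φ x) (φ' V) p q) (hφ : HasFDerivAt φ φ' x) :
    HasWirt (fun y => f (φ y)) x V p q := by
  have hr := hf.diff.hasFDerivAt.comp x (hφ.restrictScalars ℝ)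
  have hr' : HasFDerivAt (fun y => f (φ y))
    ((fderiv ℝ f (φ x)).comp (φ'.restrictScalars ℝ)) x := hr
  refine ⟨hr'.differentiableAt, ?_, ?_⟩
  · rw [← hf.dC_eq]
    simp [dC, hr'.fderiv]
  · rw [← hf.dCbar_eq]
    simp [dCbar, hr'.fderiv]

end Tower

theorem contDiffOn_dC {f : E → ℂ} {U : Set E} (hU : IsOpen U) (hf : ContDiffOn ℝ ∞ f U) (V : E) :
    ContDiffOn ℝ ∞ (fun x => dC f x V) U := by
  have h : ContDiffOn ℝ ∞ (fderiv ℝ f) U := hf.fderiv_of_isOpen hU (by simp)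
  unfold dC
  exact contDiffOn_const.mul ((h.clm_apply contDiffOn_const).sub
    (contDiffOn_const.mul (h.clm_apply contDiffOn_const)))

theorem contDiffOn_dCbar {f : E → ℂ} {U : Set E} (hU : IsOpen U) (hf : ContDiffOn ℝ ∞ f U)
    (V : E) : ContDiffOn ℝ ∞ (fun x => dCbar f x V) U := by
  have h : ContDiffOn ℝ ∞ (fderiv ℝ f) U := hf.fderiv_of_isOpen hU (by simp)
  unfold dCbar
  exact contDiffOn_const.mul ((h.clm_apply contDiffOn_const).add
    (contDiffOn_const.mul (h.clm_apply contDiffOn_const)))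

theorem dC_dCbar_comm {f : E → ℂ} {x : E} (hf : ContDiffAt ℝ 2 f x) (V W : E) :
    dC (fun y => dCbar f y W) x V = dCbar (fun y => dC f y V) x W := by
  have hs := hf.isSymmSndFDerivAt (by simp)
  have hd : DifferentiableAt ℝ (fderiv ℝ f) x :=
    (hf.fderiv_right (m := 1) (by norm_num)).differentiableAt (by norm_num)
  have key : ∀ u : E, HasFDerivAt (fun y => fderiv ℝ f y u)
      ((fderiv ℝ (fderiv ℝ f) x).flip u) x := fun u => by
    simpa using hd.hasFDerivAt.clm_apply (hasFDerivAt_const u x)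
  have e1 : HasFDerivAt (fun y => dCbar f y W) ((1 / 2 : ℂ) •
      ((fderiv ℝ (fderiv ℝ f) x).flip W + Complex.I • (fderiv ℝ (fderiv ℝ f) x).flip
        (Complex.I • W))) x :=
    (((key W).add ((key (Complex.I • W)).const_mul Complex.I)).const_mul (1 / 2 : ℂ))
  have e2 : HasFDerivAt (fun y => dC f y V) ((1 / 2 : ℂ) •
      ((fderiv ℝ (fderiv ℝ f) x).flip V - Complex.I • (fderiv ℝ (fderiv ℝ f) x).flip
        (Complex.I • V))) x :=
    (((key V).sub ((key (Complex.I • V)).const_mul Complex.I)).const_mul (1 / 2 : ℂ))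
  simp only [dC, dCbar] at e1 e2 ⊢
  rw [e1.fderiv, e2.fderiv]
  simp only [_root_.smul_apply, _root_.add_apply,
    _root_.sub_apply, ContinuousLinearMap.flip_apply, smul_eq_mul]
  rw [hs.eq V W, hs.eq V (Complex.I • W), hs.eq (Complex.I • V) W,
    hs.eq (Complex.I • V) (Complex.I • W)]
  ring

theorem dC_dC_comm {f : E → ℂ} {x : E} (hf : ContDiffAt ℝ 2 f x) (V W : E) :
    dC (fun y => dC f y W) x V = dC (fun y => dC f y V) x W := by
  have hs := hf.isSymmSndFDerivAt (by simp)
  have hd : DifferentiableAt ℝ (fderiv ℝ f) x :=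
    (hf.fderiv_right (m := 1) (by norm_num)).differentiableAt (by norm_num)
  have key : ∀ u : E, HasFDerivAt (fun y => fderiv ℝ f y u)
      ((fderiv ℝ (fderiv ℝ f) x).flip u) x := fun u => by
    simpa using hd.hasFDerivAt.clm_apply (hasFDerivAt_const u x)
  have e1 : ∀ W, HasFDerivAt (fun y => dC f y W) ((1 / 2 : ℂ) •
      ((fderiv ℝ (fderiv ℝ f) x).flip W - Complex.I • (fderiv ℝ (fderiv ℝ f) x).flip
        (Complex.I • W))) x := fun W =>
    (((key W).sub ((key (Complex.I • W)).const_mul Complex.I)).const_mul (1 / 2 : ℂ))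
  simp only [dC] at e1 ⊢
  rw [(e1 V).fderiv, (e1 W).fderiv]
  simp only [_root_.smul_apply, _root_.sub_apply, ContinuousLinearMap.flip_apply, smul_eq_mul]
  rw [hs.eq V W, hs.eq V (Complex.I • W), hs.eq (Complex.I • V) W,
    hs.eq (Complex.I • V) (Complex.I • W)]
  ring

end Wirtinger

/-! ### Wirtinger derivatives in coordinates -/

/-- The coordinate vector `∂/∂zⁱ`. -/
abbrev basisVec (i : Fin n) : Cn n := Pi.single i 1

theorem del_eq_dC (i : Fin n) (f : Cn n → ℂ) (x : Cn n) : del i f x = dC f x (basisVec i) := by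
  rw [del, dC, ← Pi.single_smul, smul_eq_mul, mul_one]

theorem delbar_eq_dCbar (i : Fin n) (f : Cn n → ℂ) (x : Cn n) :
    delbar i f x = dCbar f x (basisVec i) := by
  rw [delbar, dCbar, ← Pi.single_smul, smul_eq_mul, mul_one]

theorem sum_smul_basisVec (v : Cn n) : ∑ i, v i • basisVec i = v := by
  ext k
  simp [Finset.sum_apply, Pi.single_apply]

theorem sum_smul_basisVec_fst (v : Cn n) :
    ∑ i, v i • ((basisVec i, 0) : Cn n × Cn n) = (v, 0) := by
  refine Prod.ext ?_ ?_
  · rw [Prod.fst_sum]; exact sum_smul_basisVec v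
  · simp [Prod.snd_sum]

theorem sum_smul_basisVec_snd (v : Cn n) :
    ∑ i, v i • ((0, basisVec i) : Cn n × Cn n) = (0, v) := by
  refine Prod.ext ?_ ?_
  · simp [Prod.fst_sum]
  · rw [Prod.snd_sum]; exact sum_smul_basisVec v

theorem dC_eq_sum (f : Cn n → ℂ) (x v : Cn n) : dC f x v = ∑ i, v i * dC f x (basisVec i) := by
  conv_lhs => rw [← sum_smul_basisVec v]
  simp only [dC_sum_right, dC_smul_right]

theorem dC_fst_eq_sum (f : Cn n × Cn n → ℂ) (x : Cn n × Cn n) (v : Cn n) :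
    dC f x (v, 0) = ∑ i, v i * dC f x (basisVec i, 0) := by
  conv_lhs => rw [← sum_smul_basisVec_fst v]
  simp only [dC_sum_right, dC_smul_right]

theorem dC_snd_eq_sum (f : Cn n × Cn n → ℂ) (x : Cn n × Cn n) (v : Cn n) :
    dC f x (0, v) = ∑ i, v i * dC f x (0, basisVec i) := by
  conv_lhs => rw [← sum_smul_basisVec_snd v]
  simp only [dC_sum_right, dC_smul_right]

theorem dCbar_snd_eq_sum (f : Cn n × Cn n → ℂ) (x : Cn n × Cn n) (v : Cn n) :
    dCbar f x (0, v) = ∑ i, star (v i) * dCbar f x (0, basisVec i) := by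
  conv_lhs => rw [← sum_smul_basisVec_snd v]
  simp only [dCbar_sum_right, dCbar_smul_right]

theorem HasWirt.left {f : Cn n × Cn n → ℂ} {z η V : Cn n} {p q : ℂ}
    (h : HasWirt f (z, η) (V, 0) p q) : HasWirt (fun w => f (w, η)) z V p q :=
  HasWirt.comp_holo (φ := fun w => (w, η)) (φ' := ContinuousLinearMap.inl ℂ (Cn n) (Cn n))
    (by simpa using h) (hasFDerivAt_prodMk_left z η)

theorem HasWirt.right {f : Cn n × Cn n → ℂ} {z η V : Cn n} {p q : ℂ}
    (h : HasWirt f (z, η) (0, V) p q) : HasWirt (fun ξ => f (z, ξ)) η V p q :=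
  HasWirt.comp_holo (φ := fun ξ => (z, ξ)) (φ' := ContinuousLinearMap.inr ℂ (Cn n) (Cn n))
    (by simpa using h) (hasFDerivAt_prodMk_right z η)

theorem hasWirt_snd_apply (i : Fin n) (x V : Cn n × Cn n) :
    HasWirt (fun y : Cn n × Cn n => y.2 i) x V (V.2 i) 0 := by
  have h : HasFDerivAt (𝕜 := ℂ) (fun y : Cn n × Cn n => y.2 i)
      ((ContinuousLinearMap.proj (R := ℂ) (φ := fun _ : Fin n => ℂ) i).comp
        (ContinuousLinearMap.snd ℂ (Cn n) (Cn n))) x :=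
    ((ContinuousLinearMap.proj (R := ℂ) (φ := fun _ : Fin n => ℂ) i).comp
        (ContinuousLinearMap.snd ℂ (Cn n) (Cn n))).hasFDerivAt
  simpa using HasWirt.of_holo h V

theorem HasWirt.fst {f : Cn n → ℂ} {x V : Cn n × Cn n} {p q : ℂ} (h : HasWirt f x.1 V.1 p q) :
    HasWirt (fun y : Cn n × Cn n => f y.1) x V p q :=
  HasWirt.comp_holo (φ := Prod.fst) (φ' := ContinuousLinearMap.fst ℂ (Cn n) (Cn n))
    (by simpa using h) hasFDerivAt_fst

theorem ContDiffOn.matrix_det {X : Type*} [NormedAddCommGroup X] [NormedSpace ℝ X] {U : Set X}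
    {m : Type*} [Fintype m] [DecidableEq m]
    {A : X → Matrix m m ℂ} (h : ∀ i j, ContDiffOn ℝ ∞ (fun x => A x i j) U) :
    ContDiffOn ℝ ∞ (fun x => (A x).det) U := by
  simp only [Matrix.det_apply']
  exact ContDiffOn.sum fun σ _ => contDiffOn_const.mul (contDiffOn_prod fun i _ => h _ _)

theorem ContDiffOn.matrix_inv {X : Type*} [NormedAddCommGroup X] [NormedSpace ℝ X] {U : Set X}
    {m : Type*} [Fintype m] [DecidableEq m]
    {A : X → Matrix m m ℂ} (h : ∀ i j, ContDiffOn ℝ ∞ (fun x => A x i j) U)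
    (hdet : ∀ x ∈ U, (A x).det ≠ 0) (i j : m) :
    ContDiffOn ℝ ∞ (fun x => (A x)⁻¹ i j) U := by
  simp only [Matrix.inv_def, Ring.inverse_eq_inv', Matrix.smul_apply, smul_eq_mul,
    Matrix.adjugate_apply]
  refine ((ContDiffOn.matrix_det h).inv hdet).mul (ContDiffOn.matrix_det fun k l => ?_)
  simp only [Matrix.updateRow_apply]
  split_ifs
  · exact contDiffOn_const
  · exact h _ _

/-! ### Regular Finsler functions -/

/-- The energy `F²` as a complex valued function on the tangent bundle. -/
def energy (F : Cn n → Cn n → ℝ) (x : Cn n × Cn n) : ℂ := ((F x.1 x.2 ^ 2 : ℝ) : ℂ)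

/-- `F²` is smooth on the open conic set `Ω`, and `F` is homogeneous there. -/
structure ConicOn (Ω : Set (Cn n × Cn n)) (F : Cn n → Cn n → ℝ) : Prop where
  isOpen : IsOpen Ω
  smul_mem : ∀ x ∈ Ω, ∀ c : ℂ, c ≠ 0 → (x.1, c • x.2) ∈ Ω
  smooth : ContDiffOn ℝ ∞ (energy F) Ω
  homog : ∀ x ∈ Ω, ∀ c : ℂ, c ≠ 0 → F x.1 (c • x.2) = ‖c‖ * F x.1 x.2

/-- A conic function with nondegenerate fundamental tensor. -/
structure RegularOn (Ω : Set (Cn n × Cn n)) (F : Cn n → Cn n → ℝ) : Prop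
    extends ConicOn Ω F where
  det_ne_zero : ∀ x ∈ Ω, (fundTensor F x.1 x.2).det ≠ 0

/-- `f` is homogeneous with weight `k` in the fibre variable. -/
def FibreHom (Ω : Set (Cn n × Cn n)) (k : ℂ → ℂ) (f : Cn n × Cn n → ℂ) : Prop :=
  ∀ x ∈ Ω, ∀ c : ℂ, c ≠ 0 → f (x.1, c • x.2) = k c * f x

/-- The derivative `∂F²/∂η̄ᵐ`. -/
def energyBar (F : Cn n → Cn n → ℝ) (m : Fin n) (x : Cn n × Cn n) : ℂ :=
  dCbar (energy F) x (0, basisVec m)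

/-- The derivative `∂F²/∂ηᵐ`. -/
def energyHol (F : Cn n → Cn n → ℝ) (m : Fin n) (x : Cn n × Cn n) : ℂ :=
  dC (energy F) x (0, basisVec m)

/-- The horizontal lift `(η, -2 G(z, η))` of `η`. -/
def horLift (F : Cn n → Cn n → ℝ) (x : Cn n × Cn n) : Cn n × Cn n :=
  (x.2, -((2 : ℂ) • spray F x.1 x.2))

/-! ### Homogeneity in the fibre and Euler identities. -/

section Hom

variable {Ω : Set (Cn n × Cn n)} {f : Cn n × Cn n → ℂ} {k : ℂ → ℂ} {x : Cn n × Cn n}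

theorem hasFDerivAt_fibre_smul (c : ℂ) (x : Cn n × Cn n) :
    HasFDerivAt (𝕜 := ℂ) (fun y : Cn n × Cn n => (y.1, c • y.2))
      ((ContinuousLinearMap.fst ℂ (Cn n) (Cn n)).prod
        (c • ContinuousLinearMap.snd ℂ (Cn n) (Cn n))) x :=
  ((ContinuousLinearMap.fst ℂ (Cn n) (Cn n)).prod
        (c • ContinuousLinearMap.snd ℂ (Cn n) (Cn n))).hasFDerivAt

/-- Chain rule for the fibre scaling `(z, η) ↦ (z, cη)`. The weights of the fibre derivatives follow
by pulling `c` out of `c • V.2`, conjugated in the case of `∂̄`. -/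
theorem FibreHom.hasWirt_smul (hk : FibreHom Ω k f) (hΩ : IsOpen Ω)
    (hf : DifferentiableOn ℝ f Ω) (hx : x ∈ Ω) {c : ℂ} (hc : c ≠ 0)
    (hcx : (x.1, c • x.2) ∈ Ω) (V : Cn n × Cn n) :
    dC f (x.1, c • x.2) (V.1, c • V.2) = k c * dC f x V ∧
      dCbar f (x.1, c • x.2) (V.1, c • V.2) = k c * dCbar f x V := by
  have h1 : HasWirt (fun y : Cn n × Cn n => f (y.1, c • y.2)) x V _ _ :=
    HasWirt.comp_holo (hasWirt (hf.differentiableAt (hΩ.mem_nhds hcx)) _)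
      (hasFDerivAt_fibre_smul c x)
  have h2 := ((hasWirt (hf.differentiableAt (hΩ.mem_nhds hx)) V).const_mul (k c)).congr
    (g := fun y : Cn n × Cn n => f (y.1, c • y.2))
    (by filter_upwards [hΩ.mem_nhds hx] with y hy using hk y hy c hc)
  exact ⟨h1.unique_left h2, h1.unique_right h2⟩

theorem FibreHom.dC_fst (hk : FibreHom Ω k f) (hΩ : IsOpen Ω)
    (hs : ∀ x ∈ Ω, ∀ c : ℂ, c ≠ 0 → (x.1, c • x.2) ∈ Ω)
    (hf : DifferentiableOn ℝ f Ω) (W : Cn n) : FibreHom Ω k (fun x => dC f x (W, 0)) := by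
  intro x hx c hc
  simpa using (hk.hasWirt_smul hΩ hf hx hc (hs x hx c hc) (W, 0)).1

theorem FibreHom.dC_snd (hk : FibreHom Ω k f) (hΩ : IsOpen Ω)
    (hs : ∀ x ∈ Ω, ∀ c : ℂ, c ≠ 0 → (x.1, c • x.2) ∈ Ω)
    (hf : DifferentiableOn ℝ f Ω) (W : Cn n) :
    FibreHom Ω (fun c => c⁻¹ * k c) (fun x => dC f x (0, W)) := by
  intro x hx c hc
  have h := (hk.hasWirt_smul hΩ hf hx hc (hs x hx c hc) (0, W)).1
  have e : ((0, c • W) : Cn n × Cn n) = c • (0, W) := by simp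
  simp only [e, dC_smul_right] at h
  rw [mul_assoc, ← h]; field_simp

theorem FibreHom.dCbar_snd (hk : FibreHom Ω k f) (hΩ : IsOpen Ω)
    (hs : ∀ x ∈ Ω, ∀ c : ℂ, c ≠ 0 → (x.1, c • x.2) ∈ Ω)
    (hf : DifferentiableOn ℝ f Ω) (W : Cn n) :
    FibreHom Ω (fun c => (star c)⁻¹ * k c) (fun x => dCbar f x (0, W)) := by
  intro x hx c hc
  have h := (hk.hasWirt_smul hΩ hf hx hc (hs x hx c hc) (0, W)).2
  have e : ((0, c • W) : Cn n × Cn n) = c • (0, W) := by simp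
  have hc' : star c ≠ 0 := by simpa using hc
  simp only [e, dCbar_smul_right] at h
  rw [mul_assoc, ← h]; field_simp

theorem FibreHom.congr_weight (hk : FibreHom Ω k f) {k' : ℂ → ℂ}
    (h : ∀ c : ℂ, c ≠ 0 → k c = k' c) : FibreHom Ω k' f := by
  intro x hx c hc
  rw [hk x hx c hc, h c hc]

/-- Euler's identity. -/
theorem FibreHom.euler (hk : FibreHom Ω k f) (hΩ : IsOpen Ω) (hf : DifferentiableOn ℝ f Ω)
    (hx : x ∈ Ω) {p q : ℂ} (hk1 : HasWirt k 1 1 p q) :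
    dC f x (0, x.2) = p * f x ∧ dCbar f x (0, x.2) = q * f x := by
  -- Both sides of `f (z, cη) = k c * f (z, η)` are differentiated in `c` at `1`.
  have hφ : HasFDerivAt (𝕜 := ℂ) (fun c : ℂ => ((x.1, c • x.2) : Cn n × Cn n))
      ((0 : ℂ →L[ℂ] Cn n).prod ((ContinuousLinearMap.id ℂ ℂ).smulRight x.2)) 1 :=
    (hasFDerivAt_const x.1 (1 : ℂ)).prodMk
      ((ContinuousLinearMap.id ℂ ℂ).smulRight x.2).hasFDerivAt
  have hx1 : (x.1, (1 : ℂ) • x.2) = x := by simp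
  have h1 : HasWirt (fun c : ℂ => f (x.1, c • x.2)) 1 1 _ _ :=
    HasWirt.comp_holo (hasWirt (by
      simp only [hx1]; exact hf.differentiableAt (hΩ.mem_nhds hx)) _) hφ
  have h2 : HasWirt (fun c : ℂ => f (x.1, c • x.2)) 1 1 (p * f x + k 1 * 0) (q * f x + k 1 * 0) :=
    (hk1.mul (HasWirt.const (f x))).congr (by
      filter_upwards [isOpen_ne.mem_nhds (one_ne_zero (α := ℂ))] with c hc using hk x hx c hc)
  have e1 := h1.unique_left h2
  have e2 := h1.unique_right h2
  simp only [hx1] at e1 e2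
  simpa using And.intro e1 e2

theorem hasWirt_id : HasWirt (fun c : ℂ => c) 1 1 1 0 := by
  exact HasWirt.of_holo (hasFDerivAt_id (𝕜 := ℂ) (1 : ℂ)) 1

theorem hasWirt_star : HasWirt (fun c : ℂ => star c) 1 1 0 1 := by
  simpa using hasWirt_id.conj

theorem hasWirt_mul_star : HasWirt (fun c : ℂ => c * star c) 1 1 1 1 := by
  simpa using hasWirt_id.mul hasWirt_star

end Hom

/-! ### Euler identities for `F²` and its fundamental tensor. -/

namespace ConicOn

variable {Ω : Set (Cn n × Cn n)} {F : Cn n → Cn n → ℝ} {x : Cn n × Cn n}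

theorem eventually_right (h : ConicOn Ω F) (hx : x ∈ Ω) : ∀ᶠ ξ in 𝓝 x.2, (x.1, ξ) ∈ Ω :=
  (Continuous.prodMk_right x.1).continuousAt.eventually (h.isOpen.mem_nhds hx)

theorem eventually_left (h : ConicOn Ω F) (hx : x ∈ Ω) : ∀ᶠ w in 𝓝 x.1, (w, x.2) ∈ Ω :=
  (Continuous.prodMk_left x.2).continuousAt.eventually (h.isOpen.mem_nhds hx)

theorem smooth_bar (h : ConicOn Ω F) (m : Fin n) : ContDiffOn ℝ ∞ (energyBar F m) Ω :=
  contDiffOn_dCbar h.isOpen h.smooth _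

theorem smooth_hol (h : ConicOn Ω F) (m : Fin n) : ContDiffOn ℝ ∞ (energyHol F m) Ω :=
  contDiffOn_dC h.isOpen h.smooth _

theorem diffAt {f : Cn n × Cn n → ℂ} (h : ConicOn Ω F) (hf : ContDiffOn ℝ ∞ f Ω)
    (hx : x ∈ Ω) : DifferentiableAt ℝ f x :=
  (hf.differentiableOn (by simp)).differentiableAt (h.isOpen.mem_nhds hx)

theorem contDiffAt_energy (h : ConicOn Ω F) (hx : x ∈ Ω) : ContDiffAt ℝ 2 (energy F) x :=
  (h.smooth.contDiffAt (h.isOpen.mem_nhds hx)).of_le (by norm_cast)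

theorem delbar_energy (h : ConicOn Ω F) (hx : x ∈ Ω) (m : Fin n) :
    delbar m (fun ζ => ((F x.1 ζ ^ 2 : ℝ) : ℂ)) x.2 = energyBar F m x := by
  rw [delbar_eq_dCbar]
  exact (HasWirt.right (f := energy F) (hasWirt (h.diffAt h.smooth hx) _)).dCbar_eq

theorem fundTensor_eq (h : ConicOn Ω F) (hx : x ∈ Ω) (i m : Fin n) :
    fundTensor F x.1 x.2 i m = dC (energyBar F m) x (0, basisVec i) := by
  rw [fundTensor, del_eq_dC]
  refine ((HasWirt.right (f := energyBar F m)
    (hasWirt (h.diffAt (h.smooth_bar m) hx) _)).congr ?_).dC_eq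
  filter_upwards [h.eventually_right hx] with ξ hξ using h.delbar_energy hξ m

theorem fundTensor_eq' (h : ConicOn Ω F) (hx : x ∈ Ω) (i m : Fin n) :
    fundTensor F x.1 x.2 i m = dCbar (energyHol F i) x (0, basisVec m) := by
  rw [h.fundTensor_eq hx]
  exact dC_dCbar_comm (h.contDiffAt_energy hx) _ _

theorem smooth_fundTensor (h : ConicOn Ω F) (i m : Fin n) :
    ContDiffOn ℝ ∞ (fun x : Cn n × Cn n => fundTensor F x.1 x.2 i m) Ω :=
  (contDiffOn_dC h.isOpen (h.smooth_bar m) _).congr fun _ hy => h.fundTensor_eq hy i m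

theorem energy_hom (h : ConicOn Ω F) : FibreHom Ω (fun c => c * star c) (energy F) := by
  intro x hx c hc
  simp only [energy, h.homog x hx c hc]
  rw [mul_pow, Complex.ofReal_mul, ← Complex.normSq_eq_norm_sq]
  congr 1
  exact (Complex.mul_conj c).symm

theorem bar_hom (h : ConicOn Ω F) (m : Fin n) : FibreHom Ω (fun c => c) (energyBar F m) := by
  refine (h.energy_hom.dCbar_snd h.isOpen h.smul_mem (h.smooth.differentiableOn (by simp))
    (basisVec m)).congr_weight fun c hc => ?_
  have hc' : star c ≠ 0 := by simpa using hc
  field_simp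

theorem hol_hom (h : ConicOn Ω F) (m : Fin n) :
    FibreHom Ω (fun c => star c) (energyHol F m) := by
  refine (h.energy_hom.dC_snd h.isOpen h.smul_mem (h.smooth.differentiableOn (by simp))
    (basisVec m)).congr_weight fun c hc => ?_
  field_simp

theorem fundTensor_hom (h : ConicOn Ω F) (i m : Fin n) :
    FibreHom Ω (fun _ => 1) (fun x => fundTensor F x.1 x.2 i m) := by
  intro x hx c hc
  have := ((h.bar_hom m).dC_snd h.isOpen h.smul_mem ((h.smooth_bar m).differentiableOn (by simp))
    (basisVec i)) x hx c hc
  simp only at this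
  have e := h.fundTensor_eq (h.smul_mem x hx c hc) i m
  have e' := h.fundTensor_eq hx i m
  simp only at e ⊢
  rw [e, e', this, inv_mul_cancel₀ hc]

theorem euler_bar (h : ConicOn Ω F) (hx : x ∈ Ω) :
    ∑ m, star (x.2 m) * energyBar F m x = energy F x := by
  have := (h.energy_hom.euler h.isOpen (h.smooth.differentiableOn (by simp)) hx
    hasWirt_mul_star).2
  rw [dCbar_snd_eq_sum, one_mul] at this
  exact this

theorem euler_hol (h : ConicOn Ω F) (hx : x ∈ Ω) :
    ∑ m, x.2 m * energyHol F m x = energy F x := by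
  have := (h.energy_hom.euler h.isOpen (h.smooth.differentiableOn (by simp)) hx
    hasWirt_mul_star).1
  rw [dC_snd_eq_sum, one_mul] at this
  exact this

theorem sum_fundTensor (h : ConicOn Ω F) (hx : x ∈ Ω) (m : Fin n) :
    ∑ l, fundTensor F x.1 x.2 l m * x.2 l = energyBar F m x := by
  have := ((h.bar_hom m).euler h.isOpen ((h.smooth_bar m).differentiableOn (by simp)) hx
    hasWirt_id).1
  rw [dC_snd_eq_sum, one_mul] at this
  rw [← this]
  exact Finset.sum_congr rfl fun l _ => by rw [h.fundTensor_eq hx, mul_comm]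

theorem sum_fundTensor_star (h : ConicOn Ω F) (hx : x ∈ Ω) (i : Fin n) :
    ∑ m, fundTensor F x.1 x.2 i m * star (x.2 m) = energyHol F i x := by
  have := ((h.hol_hom i).euler h.isOpen ((h.smooth_hol i).differentiableOn (by simp)) hx
    hasWirt_star).2
  rw [dCbar_snd_eq_sum, one_mul] at this
  rw [← this]
  exact Finset.sum_congr rfl fun l _ => by rw [h.fundTensor_eq' hx, mul_comm]

/-- The weight of `∂F²/∂ηⁱ` is `c̄`, which is antiholomorphic. This is why the projective factor
disappears from the torsion equation. -/
theorem dC_hol_self (h : ConicOn Ω F) (hx : x ∈ Ω) (i : Fin n) :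
    dC (energyHol F i) x (0, x.2) = 0 := by
  simpa using ((h.hol_hom i).euler h.isOpen ((h.smooth_hol i).differentiableOn (by simp)) hx
    hasWirt_star).1

theorem del_fundTensor (h : ConicOn Ω F) (hx : x ∈ Ω) (j l m : Fin n) :
    del j (fun w => fundTensor F w x.2 l m) x.1
      = dC (fun y : Cn n × Cn n => fundTensor F y.1 y.2 l m) x (basisVec j, 0) := by
  rw [del_eq_dC]
  exact (HasWirt.left (f := fun y : Cn n × Cn n => fundTensor F y.1 y.2 l m)
    (hasWirt (h.diffAt (h.smooth_fundTensor l m) hx) _)).dC_eq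

/-- Euler's identity `g_{l m̄} ηˡ = ∂F²/∂η̄ᵐ`, differentiated in `z` at fixed `η`. It expresses `g
N` by second derivatives of `F²`. -/
theorem sum_del_fundTensor (h : ConicOn Ω F) (hx : x ∈ Ω) (j m : Fin n) :
    ∑ l, del j (fun w => fundTensor F w x.2 l m) x.1 * x.2 l
      = dC (energyBar F m) x (basisVec j, 0) := by
  have h1 : HasWirt (fun y : Cn n × Cn n => ∑ l, fundTensor F y.1 y.2 l m * y.2 l) x
      (basisVec j, 0) _ _ := HasWirt.sum _ fun l _ =>
    (hasWirt (h.diffAt (h.smooth_fundTensor l m) hx) (basisVec j, 0)).mul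
      (hasWirt_snd_apply l x (basisVec j, 0))
  have h2 := h1.congr (g := energyBar F m) (by
    filter_upwards [h.isOpen.mem_nhds hx] with y hy using (h.sum_fundTensor hy m).symm)
  rw [h2.dC_eq]
  refine Finset.sum_congr rfl fun l _ => ?_
  rw [h.del_fundTensor hx]
  simp

theorem star_bar (F : Cn n → Cn n → ℝ) {x : Cn n × Cn n}
    (hd : DifferentiableAt ℝ (energy F) x) (m : Fin n) :
    star (energyBar F m x) = energyHol F m x := by
  have h1 := (hasWirt hd (0, basisVec m)).conj
  have h2 : (fun y => star (energy F y)) = energy F := by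
    ext y; simp [energy]
  rw [h2] at h1
  exact h1.dC_eq.symm

end ConicOn

/-! ### The Chern-Finsler connection, the horizontal lift and the torsion. -/

namespace RegularOn

variable {Ω : Set (Cn n × Cn n)} {F : Cn n → Cn n → ℝ} {x : Cn n × Cn n}

theorem smooth_inv (h : RegularOn Ω F) (i m : Fin n) :
    ContDiffOn ℝ ∞ (fun x : Cn n × Cn n => (fundTensor F x.1 x.2)⁻¹ i m) Ω :=
  ContDiffOn.matrix_inv h.smooth_fundTensor h.det_ne_zero i m

theorem inv_mul (h : RegularOn Ω F) (hx : x ∈ Ω) (q m : Fin n) :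
    ∑ k, (fundTensor F x.1 x.2)⁻¹ q k * fundTensor F x.1 x.2 k m = if q = m then 1 else 0 := by
  have := congrFun (congrFun (Matrix.nonsing_inv_mul (fundTensor F x.1 x.2)
    (isUnit_iff_ne_zero.2 (h.det_ne_zero x hx))) q) m
  rwa [Matrix.mul_apply, Matrix.one_apply] at this

/-- Lowering an index with `g` is injective. -/
theorem lower_injective (h : RegularOn Ω F) (hx : x ∈ Ω) {u v : Cn n}
    (huv : ∀ m, ∑ k, fundTensor F x.1 x.2 k m * u k = ∑ k, fundTensor F x.1 x.2 k m * v k) :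
    u = v := by
  have hdet : IsUnit (fundTensor F x.1 x.2).transpose.det := by
    rw [Matrix.det_transpose]; exact isUnit_iff_ne_zero.2 (h.det_ne_zero x hx)
  refine Matrix.mulVec_injective_of_isUnit ((Matrix.isUnit_iff_isUnit_det _).2 hdet) ?_
  ext m
  simpa [Matrix.mulVec, dotProduct] using huv m

theorem lower_raise (h : RegularOn Ω F) (hx : x ∈ Ω) (u : Cn n) (m : Fin n) :
    ∑ k, fundTensor F x.1 x.2 k m * ∑ q, (fundTensor F x.1 x.2)⁻¹ q k * u q = u m := by
  simp only [Finset.mul_sum]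
  rw [Finset.sum_comm]
  have : ∀ q, ∑ k, fundTensor F x.1 x.2 k m * ((fundTensor F x.1 x.2)⁻¹ q k * u q)
      = (if q = m then 1 else 0) * u q := fun q => by
    rw [← h.inv_mul hx q m, Finset.sum_mul]
    exact Finset.sum_congr rfl fun k _ => by ring
  simp [this]

theorem connCoeff_eq (h : RegularOn Ω F) (hx : x ∈ Ω) (i j : Fin n) :
    connCoeff F x.1 x.2 i j
      = ∑ m, (fundTensor F x.1 x.2)⁻¹ m i * dC (energyBar F m) x (basisVec j, 0) := by
  rw [connCoeff]
  refine Finset.sum_congr rfl fun m _ => ?_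
  rw [← h.sum_del_fundTensor hx, Finset.mul_sum]
  exact Finset.sum_congr rfl fun l _ => by ring

theorem smooth_connCoeff (h : RegularOn Ω F) (i j : Fin n) :
    ContDiffOn ℝ ∞ (fun x : Cn n × Cn n => connCoeff F x.1 x.2 i j) Ω := by
  refine ContDiffOn.congr (f := fun x : Cn n × Cn n =>
    ∑ m, (fundTensor F x.1 x.2)⁻¹ m i * dC (energyBar F m) x (basisVec j, 0)) ?_
    fun _ hy => h.connCoeff_eq hy i j
  exact ContDiffOn.sum fun m _ => (h.smooth_inv m i).mul
    (contDiffOn_dC h.isOpen (h.smooth_bar m) _)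

theorem smooth_spray (h : RegularOn Ω F) (i : Fin n) :
    ContDiffOn ℝ ∞ (fun x : Cn n × Cn n => spray F x.1 x.2 i) Ω := by
  unfold spray
  refine contDiffOn_const.mul (ContDiffOn.sum fun j _ => (h.smooth_connCoeff i j).mul ?_)
  have : ContDiff ℝ ∞ fun x : Cn n × Cn n => x.2 j := by fun_prop
  exact this.contDiffOn

theorem connCoeff_hom (h : RegularOn Ω F) (i j : Fin n) :
    FibreHom Ω (fun c => c) (fun x => connCoeff F x.1 x.2 i j) := by
  intro x hx c hc
  have hcx := h.smul_mem x hx c hc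
  have hg : fundTensor F x.1 (c • x.2) = fundTensor F x.1 x.2 := by
    ext i m; simpa using h.fundTensor_hom i m x hx c hc
  have hd := fun m => ((h.bar_hom m).dC_fst h.isOpen h.smul_mem
    ((h.smooth_bar m).differentiableOn (by simp)) (basisVec j)) x hx c hc
  simp only at hd
  simp only [h.connCoeff_eq hx, h.connCoeff_eq hcx, hg, hd]
  rw [Finset.mul_sum]
  exact Finset.sum_congr rfl fun m _ => by ring

theorem horCoeff_eq (h : RegularOn Ω F) (hx : x ∈ Ω) (i j k : Fin n) :
    horCoeff F x.1 x.2 i j k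
      = dC (fun y : Cn n × Cn n => connCoeff F y.1 y.2 i k) x (0, basisVec j) := by
  rw [horCoeff, del_eq_dC]
  exact (HasWirt.right (f := fun y : Cn n × Cn n => connCoeff F y.1 y.2 i k)
    (hasWirt (h.diffAt (h.smooth_connCoeff i k) hx) _)).dC_eq

theorem horCoeff_hom (h : RegularOn Ω F) (i j k : Fin n) :
    FibreHom Ω (fun _ => 1) (fun x => horCoeff F x.1 x.2 i j k) := by
  intro x hx c hc
  have := ((h.connCoeff_hom i k).dC_snd h.isOpen h.smul_mem
    ((h.smooth_connCoeff i k).differentiableOn (by simp)) (basisVec j)) x hx c hc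
  simp only at this
  have e := h.horCoeff_eq (h.smul_mem x hx c hc) i j k
  have e' := h.horCoeff_eq hx i j k
  simp only at e ⊢
  rw [e, e', this, inv_mul_cancel₀ hc]

theorem sum_horCoeff (h : RegularOn Ω F) (hx : x ∈ Ω) (i k : Fin n) :
    ∑ j, horCoeff F x.1 x.2 i j k * x.2 j = connCoeff F x.1 x.2 i k := by
  have := ((h.connCoeff_hom i k).euler h.isOpen
    ((h.smooth_connCoeff i k).differentiableOn (by simp)) hx hasWirt_id).1
  rw [dC_snd_eq_sum, one_mul] at this
  rw [← this]
  exact Finset.sum_congr rfl fun l _ => by rw [h.horCoeff_eq hx, mul_comm]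

theorem spray_hom (h : RegularOn Ω F) (i : Fin n) :
    FibreHom Ω (fun c => c ^ 2) (fun x => spray F x.1 x.2 i) := by
  intro x hx c hc
  simp only [spray, Finset.mul_sum, Pi.smul_apply, smul_eq_mul]
  refine Finset.sum_congr rfl fun j _ => ?_
  have := h.connCoeff_hom i j x hx c hc
  simp only at this
  rw [this]; ring

theorem thetaStar_hom (h : RegularOn Ω F) (i : Fin n) :
    FibreHom Ω (fun c => c * star c) (fun x => thetaStar F x.1 x.2 i) := by
  intro x hx c hc
  have hg : fundTensor F x.1 (c • x.2) = fundTensor F x.1 x.2 := by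
    ext i m; simpa using h.fundTensor_hom i m x hx c hc
  have hL : ∀ i j k, horCoeff F x.1 (c • x.2) i j k = horCoeff F x.1 x.2 i j k := fun i j k => by
    simpa using h.horCoeff_hom i j k x hx c hc
  simp only [thetaStar, hg, hL, Finset.mul_sum, Pi.smul_apply, smul_eq_mul, star_mul']
  congr! 4
  ring

theorem lower_connCoeff (h : RegularOn Ω F) (hx : x ∈ Ω) (m j : Fin n) :
    ∑ k, fundTensor F x.1 x.2 k m * connCoeff F x.1 x.2 k j
      = dC (energyBar F m) x (basisVec j, 0) := by
  simp only [h.connCoeff_eq hx]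
  exact h.lower_raise hx (fun q => dC (energyBar F q) x (basisVec j, 0)) m

/-- Differentiate `F² = η̄ᵐ ∂F²/∂η̄ᵐ` in `z` and use that `g N` is the mixed derivative of `F²`. In
other words, `F²` is constant along horizontal vectors. -/
theorem dC_energy_fst (h : RegularOn Ω F) (hx : x ∈ Ω) (j : Fin n) :
    ∑ k, connCoeff F x.1 x.2 k j * energyHol F k x = dC (energy F) x (basisVec j, 0) := by
  have h1 : HasWirt (fun y : Cn n × Cn n => ∑ m, star (y.2 m) * energyBar F m y) x
      (basisVec j, 0) _ _ := HasWirt.sum _ fun m _ =>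
    (hasWirt_snd_apply m x (basisVec j, 0)).conj.mul
      (hasWirt (h.diffAt (h.smooth_bar m) hx) (basisVec j, 0))
  have h2 := h1.congr (g := energy F) (by
    filter_upwards [h.isOpen.mem_nhds hx] with y hy using (h.euler_bar hy).symm)
  rw [h2.dC_eq]
  simp only [← h.sum_fundTensor_star hx, ← h.lower_connCoeff hx, Finset.mul_sum, star_zero,
    zero_mul, zero_add]
  rw [Finset.sum_comm]
  exact Finset.sum_congr rfl fun _ _ => Finset.sum_congr rfl fun _ _ => by ring

/-- The horizontal lift kills `∂F²/∂η̄ᵐ`. -/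
theorem dC_bar_horLift (h : RegularOn Ω F) (hx : x ∈ Ω) (m : Fin n) :
    dC (energyBar F m) x (horLift F x) = 0 := by
  have e : horLift F x = (x.2, 0) + (0, -((2 : ℂ) • spray F x.1 x.2)) := by simp [horLift]
  rw [e, dC_add_right, dC_fst_eq_sum, dC_snd_eq_sum]
  simp only [← h.lower_connCoeff hx, ← h.fundTensor_eq hx, spray, Finset.mul_sum, Pi.neg_apply,
    Pi.smul_apply, smul_eq_mul]
  rw [Finset.sum_comm, ← Finset.sum_add_distrib]
  refine Finset.sum_eq_zero fun k _ => ?_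
  rw [← Finset.sum_neg_distrib, Finset.sum_mul, ← Finset.sum_add_distrib]
  exact Finset.sum_eq_zero fun j _ => by ring

/-- The identity `N^k_j ∂F²/∂ηᵏ = ∂F²/∂zʲ` is differentiated along `ηᵐ` and contracted with `ηʲ`. By
symmetry of the holomorphic fibre Hessian, the terms in `N` assemble into the vertical part `-2G` of
the lift. -/
theorem dC_energy_mixed (h : RegularOn Ω F) (hx : x ∈ Ω) (m : Fin n) :
    ∑ j, (∑ k, horCoeff F x.1 x.2 k m j * energyHol F k x) * x.2 j
      = dC (energyHol F m) x (horLift F x) := by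
  have key : ∀ j, ∑ k, horCoeff F x.1 x.2 k m j * energyHol F k x
      = dC (energyHol F m) x (basisVec j, 0)
        - ∑ k, connCoeff F x.1 x.2 k j * dC (energyHol F m) x (0, basisVec k) := by
    intro j
    have h1 : HasWirt (fun y : Cn n × Cn n =>
        ∑ k, connCoeff F y.1 y.2 k j * energyHol F k y) x (0, basisVec m) _ _ :=
      HasWirt.sum _ fun k _ =>
        (hasWirt (h.diffAt (h.smooth_connCoeff k j) hx) (0, basisVec m)).mul
        (hasWirt (h.diffAt (h.smooth_hol k) hx) (0, basisVec m))
    have h2 := h1.congr (g := fun y => dC (energy F) y (basisVec j, 0)) (by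
      filter_upwards [h.isOpen.mem_nhds hx] with y hy using (h.dC_energy_fst hy j).symm)
    have h3 := h2.dC_eq
    rw [dC_dC_comm (h.contDiffAt_energy hx)] at h3
    have h4 : ∀ k, dC (energyHol F k) x (0, basisVec m) = dC (energyHol F m) x (0, basisVec k) :=
      fun k => dC_dC_comm (h.contDiffAt_energy hx) _ _
    simp only [← h.horCoeff_eq hx, h4, Finset.sum_add_distrib] at h3
    rw [eq_sub_iff_add_eq, ← h3]; rfl
  have e : horLift F x = (x.2, 0) + (0, -((2 : ℂ) • spray F x.1 x.2)) := by simp [horLift]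
  rw [e, dC_add_right, dC_fst_eq_sum, dC_snd_eq_sum]
  simp only [key, sub_mul, Finset.sum_sub_distrib]
  rw [sub_eq_add_neg]
  congr 1
  · exact Finset.sum_congr rfl fun _ _ => mul_comm _ _
  · simp only [spray, Finset.mul_sum, Finset.sum_mul, Pi.neg_apply, Pi.smul_apply, smul_eq_mul,
      ← Finset.sum_neg_distrib]
    rw [Finset.sum_comm]
    exact Finset.sum_congr rfl fun k _ => Finset.sum_congr rfl fun j _ => by ring

theorem lower_thetaStar (h : RegularOn Ω F) (hx : x ∈ Ω) (m : Fin n) :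
    ∑ k, fundTensor F x.1 x.2 k m * thetaStar F x.1 x.2 k
      = ∑ h, ∑ p, ∑ j, fundTensor F x.1 x.2 h p *
      star (horCoeff F x.1 x.2 p j m - horCoeff F x.1 x.2 p m j) * x.2 h * star (x.2 j) := by
  rw [← h.lower_raise hx (fun m => ∑ h, ∑ p, ∑ j, fundTensor F x.1 x.2 h p *
      star (horCoeff F x.1 x.2 p j m - horCoeff F x.1 x.2 p m j) * x.2 h * star (x.2 j)) m]
  simp only [thetaStar, Finset.mul_sum]
  refine Finset.sum_congr rfl fun _ _ => Finset.sum_congr rfl fun _ _ =>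
    Finset.sum_congr rfl fun _ _ => Finset.sum_congr rfl fun _ _ =>
    Finset.sum_congr rfl fun _ _ => by ring

/-- Since `L^k_{jm} ηʲ = N^k_m`, one half of the torsion yields `∂F²/∂zᵐ`; the other half is
`dC_energy_mixed`. Vanishing of `θ*` becomes a condition on derivatives of `F²` along the horizontal
lift. -/
theorem lower_thetaStar_eq (h : RegularOn Ω F) (hx : x ∈ Ω) (m : Fin n) :
    ∑ k, fundTensor F x.1 x.2 k m * thetaStar F x.1 x.2 k
      = star (dC (energy F) x (basisVec m, 0) - dC (energyHol F m) x (horLift F x)) := by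
  rw [h.lower_thetaStar hx, ← h.dC_energy_mixed hx, ← h.dC_energy_fst hx]
  have e1 : ∀ p, star (energyHol F p x) = ∑ q, fundTensor F x.1 x.2 q p * x.2 q := fun p => by
    rw [← ConicOn.star_bar F (h.diffAt h.smooth hx), star_star, h.sum_fundTensor hx]
  have e2 : ∑ k, connCoeff F x.1 x.2 k m * energyHol F k x
      = ∑ j, (∑ k, horCoeff F x.1 x.2 k j m * energyHol F k x) * x.2 j := by
    simp only [← h.sum_horCoeff hx, Finset.sum_mul]
    rw [Finset.sum_comm]
    exact Finset.sum_congr rfl fun _ _ => Finset.sum_congr rfl fun _ _ => by ring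
  rw [e2, ← Finset.sum_sub_distrib]
  simp only [← sub_mul, ← Finset.sum_sub_distrib, star_sum, star_mul', e1, Finset.mul_sum,
    Finset.sum_mul]
  rw [Finset.sum_comm]
  conv_rhs => rw [Finset.sum_comm]
  refine Finset.sum_congr rfl fun p _ => ?_
  conv_rhs => rw [Finset.sum_comm]
  exact Finset.sum_congr rfl fun _ _ => Finset.sum_congr rfl fun _ _ => by ring

/-- Contraction with `η̄ᵐ` pairs the torsion, antisymmetric in `j` and `m`, with the symmetric `η̄ʲ
η̄ᵐ`. -/
theorem thetaStar_orthogonal (h : RegularOn Ω F) (hx : x ∈ Ω) :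
    ∑ k, energyHol F k x * thetaStar F x.1 x.2 k = 0 := by
  have e : ∑ k, energyHol F k x * thetaStar F x.1 x.2 k
      = ∑ m, (∑ k, fundTensor F x.1 x.2 k m * thetaStar F x.1 x.2 k) * star (x.2 m) := by
    simp only [← h.sum_fundTensor_star hx, Finset.sum_mul]
    rw [Finset.sum_comm]
    exact Finset.sum_congr rfl fun _ _ => Finset.sum_congr rfl fun _ _ => by ring
  rw [e]
  simp only [h.lower_thetaStar hx, Finset.sum_mul]
  rw [Finset.sum_comm]
  refine Finset.sum_eq_zero fun q _ => ?_
  rw [Finset.sum_comm]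
  refine Finset.sum_eq_zero fun p _ => ?_
  simp only [star_sub, mul_sub, sub_mul, Finset.sum_sub_distrib]
  rw [sub_eq_zero, Finset.sum_comm]
  exact Finset.sum_congr rfl fun _ _ => Finset.sum_congr rfl fun _ _ => by ring

end RegularOn

/-! ### Holomorphic functions of several variables -/

/-- The one-variable Cauchy estimate on the complex line through `y` in direction `w`, where the
ball cuts out a disc of radius `ρ / ‖w‖`. -/
theorem norm_fderiv_le_of_bounded {f : Cn n → ℂ} {y : Cn n} {ρ C : ℝ} (hρ : 0 < ρ)
    (hf : ∀ w ∈ Metric.closedBall y ρ, DifferentiableAt ℂ f w)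
    (hC : ∀ w ∈ Metric.closedBall y ρ, ‖f w‖ ≤ C) : ‖fderiv ℂ f y‖ ≤ C / ρ := by
  have hC0 : 0 ≤ C := (norm_nonneg _).trans (hC y (Metric.mem_closedBall_self hρ.le))
  refine ContinuousLinearMap.opNorm_le_bound _ (by positivity) fun w => ?_
  rcases eq_or_ne w 0 with rfl | hw
  · simp
  have hw' : 0 < ‖w‖ := norm_pos_iff.2 hw
  have hmem : ∀ t ∈ Metric.closedBall (0 : ℂ) (ρ / ‖w‖), y + t • w ∈ Metric.closedBall y ρ := by
    intro t ht
    rw [mem_closedBall_zero_iff, le_div_iff₀ hw'] at ht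
    simpa [Metric.mem_closedBall, dist_eq_norm, norm_smul] using ht
  have hline : ∀ t : ℂ, HasDerivAt (fun t : ℂ => y + t • w) w t := fun t => by
    simpa using ((hasDerivAt_id t).smul_const w).const_add y
  have hd : ∀ t ∈ Metric.closedBall (0 : ℂ) (ρ / ‖w‖),
      DifferentiableAt ℂ (fun t : ℂ => f (y + t • w)) t := fun t ht =>
    (hf _ (hmem t ht)).comp t (hline t).differentiableAt
  have h1 : ‖deriv (fun t : ℂ => f (y + t • w)) 0‖ ≤ C / (ρ / ‖w‖) := by
    refine Complex.norm_deriv_le_of_forall_mem_sphere_norm_le (by positivity) ?_ ?_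
    · refine DifferentiableOn.diffContOnCl fun t ht => ?_
      rw [closure_ball _ (by positivity)] at ht
      exact (hd t ht).differentiableWithinAt
    · intro t ht
      exact hC _ (hmem t (Metric.sphere_subset_closedBall ht))
  have h2 : HasDerivAt (fun t : ℂ => f (y + t • w)) (fderiv ℂ f y w) 0 := by
    have hfy : HasFDerivAt f (fderiv ℂ f y) (y + (0 : ℂ) • w) := by
      simpa using (hf y (Metric.mem_closedBall_self hρ.le)).hasFDerivAt
    exact hfy.comp_hasDerivAt 0 (hline 0)
  rw [h2.deriv] at h1
  calc _ ≤ _ := h1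
    _ = C / ρ * ‖w‖ := by field_simp

/-- Directional derivatives of holomorphic functions of several variables are holomorphic. -/
theorem differentiableOn_fderiv_apply {f : Cn n → ℂ} {U : Set (Cn n)} (hU : IsOpen U)
    (hf : DifferentiableOn ℂ f U) (v : Cn n) :
    DifferentiableOn ℂ (fun x => fderiv ℂ f x v) U := by
  intro x₀ hx₀
  refine DifferentiableAt.differentiableWithinAt ?_
  obtain ⟨ε, hε, hεU⟩ := Metric.isOpen_iff.1 hU x₀ hx₀
  -- Three nested balls: base points vary in radius `ρ`, the Cauchy circles of radius `R` in
  -- direction `v` stay in radius `2ρ`, and the Cauchy estimates there use values of `f` in radius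
  -- `3ρ`.
  obtain ⟨ρ, hρ, hρε⟩ : ∃ ρ : ℝ, 0 < ρ ∧ 3 * ρ < ε := ⟨ε / 4, by positivity, by linarith⟩
  have hB : Metric.closedBall x₀ (3 * ρ) ⊆ U :=
    (Metric.closedBall_subset_ball hρε).trans hεU
  obtain ⟨R, hR, hRv⟩ : ∃ R : ℝ, 0 < R ∧ R * ‖v‖ < ρ := by
    refine ⟨ρ / (‖v‖ + 1), by positivity, ?_⟩
    rw [div_mul_eq_mul_div, div_lt_iff₀ (by positivity)]
    nlinarith [norm_nonneg v]
  have hfat : ∀ w ∈ Metric.closedBall x₀ (3 * ρ), DifferentiableAt ℂ f w := fun w hw =>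
    hf.differentiableAt (hU.mem_nhds (hB hw))
  obtain ⟨C, hC⟩ := (isCompact_closedBall x₀ (3 * ρ)).exists_bound_of_continuousOn
    (hf.continuousOn.mono hB)
  have hder : ∀ y ∈ Metric.ball x₀ (2 * ρ), ‖fderiv ℂ f y‖ ≤ C / ρ := by
    intro y hy
    have hsub : Metric.closedBall y ρ ⊆ Metric.closedBall x₀ (3 * ρ) :=
      Metric.closedBall_subset_closedBall' (by
        have := Metric.mem_ball.1 hy; linarith)
    exact norm_fderiv_le_of_bounded hρ (fun w hw => hfat w (hsub hw)) fun w hw => hC w (hsub hw)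
  have hC0 : 0 ≤ C := (norm_nonneg _).trans (hC x₀ (Metric.mem_closedBall_self (by positivity)))
  have hmem : ∀ x ∈ Metric.ball x₀ ρ, ∀ t ∈ Metric.closedBall (0 : ℂ) R,
      x + t • v ∈ Metric.ball x₀ (2 * ρ) := by
    intro x hx t ht
    rw [mem_closedBall_zero_iff] at ht
    rw [Metric.mem_ball, dist_eq_norm] at hx ⊢
    calc ‖x + t • v - x₀‖ = ‖(x - x₀) + t • v‖ := by congr 1; abel
      _ ≤ ‖x - x₀‖ + ‖t • v‖ := norm_add_le _ _
      _ ≤ ‖x - x₀‖ + R * ‖v‖ := by rw [norm_smul]; gcongr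
      _ < 2 * ρ := by linarith
  have h23 : Metric.ball x₀ (2 * ρ) ⊆ Metric.closedBall x₀ (3 * ρ) :=
    Metric.ball_subset_closedBall.trans (Metric.closedBall_subset_closedBall (by linarith))
  set κ : ℝ → ℂ := fun θ => deriv (circleMap 0 R) θ * ((circleMap 0 R θ - 0) ^ 2)⁻¹ with hκ
  have hcirc : ∀ θ, circleMap 0 R θ ∈ Metric.closedBall (0 : ℂ) R := fun θ =>
    Metric.sphere_subset_closedBall (circleMap_mem_sphere 0 hR.le θ)
  have hκc : Continuous κ := by
    refine Continuous.mul (by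
      have : deriv (circleMap 0 R) = fun θ => circleMap 0 R θ * Complex.I := by
        ext θ; simp [deriv_circleMap]
      rw [this]; fun_prop) (Continuous.inv₀ (by fun_prop) ?_)
    intro θ
    simpa using hR.ne'
  have hcauchy : ∀ x ∈ Metric.ball x₀ ρ, fderiv ℂ f x v
      = (2 * Real.pi * Complex.I : ℂ)⁻¹ *
        ∫ θ in (0 : ℝ)..2 * Real.pi, κ θ * f (x + circleMap 0 R θ • v) := by
    intro x hx
    have hline : ∀ t : ℂ, HasDerivAt (fun t : ℂ => x + t • v) v t := fun t => by
      simpa using ((hasDerivAt_id t).smul_const v).const_add x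
    have hcont : Continuous fun t : ℂ => x + t • v := by fun_prop
    have hV : IsOpen ((fun t : ℂ => x + t • v) ⁻¹' U) := hU.preimage hcont
    have h1 := Complex.two_pi_I_inv_smul_circleIntegral_sub_sq_inv_smul_of_differentiable
      (f := fun t : ℂ => f (x + t • v)) hV (c := 0) (w₀ := 0) (R := R)
      (fun t ht => hB (h23 (hmem x hx t ht)))
      (fun t ht => ((hf.differentiableAt (hU.mem_nhds ht)).comp t
        (hline t).differentiableAt).differentiableWithinAt) (Metric.mem_ball_self hR)
    have h2 : HasDerivAt (fun t : ℂ => f (x + t • v)) (fderiv ℂ f x v) 0 := by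
      have hfy : HasFDerivAt f (fderiv ℂ f x) (x + (0 : ℂ) • v) := by
        have := hmem x hx 0 (Metric.mem_closedBall_self hR.le)
        simpa using (hfat x (by simpa using h23 this)).hasFDerivAt
      exact hfy.comp_hasDerivAt 0 (hline 0)
    rw [h2.deriv] at h1
    rw [← h1, circleIntegral, smul_eq_mul]
    simp only [hκ, smul_eq_mul, mul_assoc]
  -- The derivative bound makes the Cauchy integrand Lipschitz in `x` with a constant integrable in
  -- `θ`, which allows differentiation under the integral sign.
  have hlip : ∀ θ : ℝ, LipschitzOnWith (Real.nnabs (‖κ θ‖ * (C / ρ)))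
      (fun x => κ θ * f (x + circleMap 0 R θ • v)) (Metric.ball x₀ ρ) := by
    intro θ
    refine LipschitzOnWith.of_dist_le_mul fun x hx y hy => ?_
    have := (convex_ball x₀ (2 * ρ)).norm_image_sub_le_of_norm_fderiv_le (𝕜 := ℂ)
      (fun w hw => hfat w (h23 hw)) hder (hmem y hy _ (hcirc θ)) (hmem x hx _ (hcirc θ))
    rw [dist_eq_norm, ← mul_sub, norm_mul, Real.coe_nnabs, abs_of_nonneg (by positivity),
      mul_assoc, dist_eq_norm]
    refine mul_le_mul_of_nonneg_left ?_ (norm_nonneg _)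
    simpa using this
  have hcts : ∀ x ∈ Metric.ball x₀ ρ,
      Continuous fun θ : ℝ => κ θ * f (x + circleMap 0 R θ • v) := by
    intro x hx
    refine hκc.mul ?_
    rw [continuous_iff_continuousAt]
    intro θ
    refine ContinuousAt.comp (f := fun θ : ℝ => x + circleMap 0 R θ • v)
      (hfat _ (h23 (hmem x hx _ (hcirc θ)))).continuousAt ?_
    exact Continuous.continuousAt (by fun_prop)
  have hx₀ρ : x₀ ∈ Metric.ball x₀ ρ := Metric.mem_ball_self hρ
  have hmain := intervalIntegral.hasFDerivAt_integral_of_dominated_loc_of_lip (𝕜 := ℂ)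
    (μ := MeasureTheory.volume) (a := 0) (b := 2 * Real.pi)
    (F := fun x θ => κ θ * f (x + circleMap 0 R θ • v))
    (F' := fun θ => κ θ • fderiv ℂ f (x₀ + circleMap 0 R θ • v))
    (x₀ := x₀) (bound := fun θ => ‖κ θ‖ * (C / ρ)) (Metric.ball_mem_nhds x₀ hρ)
    (by filter_upwards [Metric.ball_mem_nhds x₀ hρ] with x hx
        exact (hcts x hx).aestronglyMeasurable)
    ((hcts x₀ hx₀ρ).intervalIntegrable _ _)
    (by
      refine MeasureTheory.AEStronglyMeasurable.smul hκc.aestronglyMeasurable ?_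
      refine Measurable.aestronglyMeasurable ?_
      exact (measurable_fderiv ℂ f).comp (Continuous.measurable (by fun_prop)))
    (Eventually.of_forall fun θ _ => hlip θ)
    (Continuous.intervalIntegrable (by fun_prop) _ _)
    (Eventually.of_forall fun θ _ => by
      have h1 : HasFDerivAt f (fderiv ℂ f (x₀ + circleMap 0 R θ • v))
        (x₀ + circleMap 0 R θ • v) := (hfat _ (h23 (hmem x₀ hx₀ρ _ (hcirc θ)))).hasFDerivAt
      have h2 := h1.comp x₀ ((hasFDerivAt_id (𝕜 := ℂ) x₀).add_const (circleMap 0 R θ • v))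
      rw [ContinuousLinearMap.comp_id] at h2
      exact h2.const_mul (κ θ))
  have h3 := hmain.2.differentiableAt.const_mul (2 * Real.pi * Complex.I : ℂ)⁻¹
  refine h3.congr_of_eventuallyEq ?_
  filter_upwards [Metric.ball_mem_nhds x₀ hρ] with x hx using hcauchy x hx

theorem differentiableOn_fderiv {f : Cn n → ℂ} {U : Set (Cn n)} (hU : IsOpen U)
    (hf : DifferentiableOn ℂ f U) : DifferentiableOn ℂ (fderiv ℂ f) U := by
  have e : fderiv ℂ f = fun x => ∑ k, fderiv ℂ f x (basisVec k) •
      ContinuousLinearMap.proj (R := ℂ) (φ := fun _ : Fin n => ℂ) k := by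
    ext x v
    conv_lhs => rw [← sum_smul_basisVec v]
    simp [mul_comm]
  rw [e]
  exact DifferentiableOn.fun_sum fun k _ =>
    (differentiableOn_fderiv_apply hU hf (basisVec k)).smul_const _

theorem fderiv_fderiv_comm {f : Cn n → ℂ} {U : Set (Cn n)} (hU : IsOpen U)
    (hf : DifferentiableOn ℂ f U) {z : Cn n} (hz : z ∈ U) (u v : Cn n) :
    fderiv ℂ (fun w => fderiv ℂ f w u) z v = fderiv ℂ (fun w => fderiv ℂ f w v) z u := by
  have hd := (differentiableOn_fderiv hU hf).differentiableAt (hU.mem_nhds hz)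
  have hs := second_derivative_symmetric_of_eventually (𝕜 := ℂ) (f := f) (f' := fderiv ℂ f)
    (by filter_upwards [hU.mem_nhds hz] with y hy
        exact (hf.differentiableAt (hU.mem_nhds hy)).hasFDerivAt) hd.hasFDerivAt
  have key : ∀ u : Cn n, HasFDerivAt (fun w => fderiv ℂ f w u)
      ((fderiv ℂ (fderiv ℂ f) z).flip u) z := fun u => by
    simpa using hd.hasFDerivAt.clm_apply (hasFDerivAt_const u z)
  rw [(key u).fderiv, (key v).fderiv]
  exact hs v u

theorem isOpen_slit {D : Set (Cn n)} (hD : IsOpen D) : IsOpen (slit D) :=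
  (hD.preimage continuous_fst).inter (isOpen_ne.preimage continuous_snd)

theorem contDiffOn_energy {F : Cn n → Cn n → ℝ} {Ω : Set (Cn n × Cn n)}
    (h : ContDiffOn ℝ ∞ (fun x : Cn n × Cn n => F x.1 x.2) Ω) : ContDiffOn ℝ ∞ (energy F) Ω :=
  Complex.ofRealCLM.contDiff.comp_contDiffOn (h.pow 2)

theorem IsFinslerMetric.regularOn {D : Set (Cn n)} (hD : IsOpen D) {M : Cn n → Cn n → ℝ}
    (hM : IsFinslerMetric D M) : RegularOn (slit D) M where
  isOpen := isOpen_slit hD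
  smul_mem := fun _ hx _ hc => ⟨hx.1, smul_ne_zero hc hx.2⟩
  smooth := contDiffOn_energy hM.smooth
  homog := fun x hx c _ => hM.homogeneous x.1 hx.1 c x.2
  det_ne_zero := fun x hx => (hM.posDef x.1 hx.1 x.2 hx.2).det_pos.ne'

theorem fderiv_apply_comp {φ : Cn n → Cn n} {z : Cn n} (h : DifferentiableAt ℂ φ z) (v : Cn n)
    (l : Fin n) : fderiv ℂ (fun x => φ x l) z v = fderiv ℂ φ z v l := by
  have := (hasFDerivAt_pi'.1 h.hasFDerivAt) l
  rw [this.fderiv]; rfl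

/-- The energy of a conic function with frozen base point is determined by its fundamental
tensor. -/
theorem ConicOn.energy_eq_sum {Ω : Set (Cn n × Cn n)} {F : Cn n → Cn n → ℝ} (h : ConicOn Ω F)
    {x : Cn n × Cn n} (hx : x ∈ Ω) :
    energy F x = ∑ m, star (x.2 m) * ∑ l, fundTensor F x.1 x.2 l m * x.2 l := by
  rw [← h.euler_bar hx]
  exact Finset.sum_congr rfl fun m _ => by rw [h.sum_fundTensor hx]

/-! ### The connection of a locally Minkowski metric. -/

section Minkowski

variable {D : Set (Cn n)} {M : Cn n → Cn n → ℝ} {e : OpenPartialHomeomorph (Cn n) (Cn n)}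

theorem fderiv_symm_comp (he : DifferentiableOn ℂ e e.source)
    (he' : DifferentiableOn ℂ e.symm e.target) {z : Cn n} (hz : z ∈ e.source) (v : Cn n) :
    fderiv ℂ e.symm (e z) (fderiv ℂ e z v) = v := by
  have h1 := (he.differentiableAt (e.open_source.mem_nhds hz)).hasFDerivAt
  have h2 := (he'.differentiableAt (e.open_target.mem_nhds (e.map_source hz))).hasFDerivAt
  have h3 := h2.comp z h1
  have h4 : HasFDerivAt (e.symm ∘ e) (ContinuousLinearMap.id ℂ (Cn n)) z := by
    refine (hasFDerivAt_id z).congr_of_eventuallyEq ?_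
    filter_upwards [e.open_source.mem_nhds hz] with y hy using e.left_inv hy
  exact congrArg (fun L : Cn n →L[ℂ] Cn n => L v) (h3.unique h4)

theorem fderiv_comp_symm (he : DifferentiableOn ℂ e e.source)
    (he' : DifferentiableOn ℂ e.symm e.target) {z : Cn n} (hz : z ∈ e.source) (v : Cn n) :
    fderiv ℂ e z (fderiv ℂ e.symm (e z) v) = v := by
  have h := fderiv_symm_comp (e := e.symm) he' he (e.map_source hz) v
  simpa [e.left_inv hz] using h

/-- In the chart of a locally Minkowski metric, `F²` does not depend on the base point. -/
theorem energy_eq_of_chart (hM : IsFinslerMetric D M)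
    (hD : IsOpen D) (hes : e.source ⊆ D)
    (he : DifferentiableOn ℂ e e.source) (he' : DifferentiableOn ℂ e.symm e.target)
    (hc : ∀ w ∈ e.target, ∀ w' ∈ e.target, ∀ ξ : Cn n, ξ ≠ 0 →
      fundTensor (inChart e M) w ξ = fundTensor (inChart e M) w' ξ)
    {p z : Cn n} (hp : p ∈ e.source) (hz : z ∈ e.source) {η : Cn n} (hη : η ≠ 0) :
    energy M (z, η) = energy M (p, fderiv ℂ e.symm (e p) (fderiv ℂ e z η)) := by
  have hR := hM.regularOn hD
  have hK : ∀ q ∈ e.source, ∀ v, v ≠ 0 → fderiv ℂ e.symm (e q) v ≠ 0 := by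
    intro q hq v hv h0
    apply hv
    rw [← fderiv_comp_symm he he' hq v, h0, map_zero]
  have hJ : fderiv ℂ e z η ≠ 0 := fun h0 => hη (by
    rw [← fderiv_symm_comp he he' hz η, h0, map_zero])
  -- With its base point frozen, the metric in the chart is regarded as a function on the bundle
  -- that is constant in the base, so that Euler's identity recovers `F²` from the fundamental
  -- tensor.
  have hconic : ∀ q ∈ e.source,
      ConicOn {x : Cn n × Cn n | x.2 ≠ 0} (fun _ => inChart e M (e q)) := by
    intro q hq
    refine ⟨isOpen_ne.preimage continuous_snd, fun x hx c hc => smul_ne_zero hc hx, ?_, ?_⟩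
    · have h1 : energy (fun _ => inChart e M (e q)) = fun x : Cn n × Cn n =>
          energy M (q, fderiv ℂ e.symm (e q) x.2) := by
        ext x; simp [energy, inChart, e.left_inv hq]
      rw [h1]
      refine hR.smooth.comp (t := slit D) (ContDiff.contDiffOn ?_) fun x hx =>
        ⟨hes hq, hK q hq _ hx⟩
      exact contDiff_const.prodMk
        (((fderiv ℂ e.symm (e q)).restrictScalars ℝ).contDiff.comp contDiff_snd)
    · intro x _ c _
      simp only [inChart, map_smul]
      exact hM.homogeneous _ (by rw [e.left_inv hq]; exact hes hq) c _
  have h1 := (hconic z hz).energy_eq_sum (x := (0, fderiv ℂ e z η)) hJ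
  have h2 := (hconic p hp).energy_eq_sum (x := (0, fderiv ℂ e z η)) hJ
  have h3 : fundTensor (fun _ => inChart e M (e z)) 0 (fderiv ℂ e z η)
      = fundTensor (fun _ => inChart e M (e p)) 0 (fderiv ℂ e z η) :=
    hc _ (e.map_source hz) _ (e.map_source hp) _ hJ
  rw [h3, ← h2] at h1
  simp only [energy, inChart, e.left_inv hz, e.left_inv hp, fderiv_symm_comp he he' hz] at h1
  simpa [energy] using h1

/-- The connection coefficients of a locally Minkowski metric in a chart adapted to it. -/
def flatConn (e : OpenPartialHomeomorph (Cn n) (Cn n)) (z : Cn n) (i k j : Fin n) : ℂ :=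
  ∑ l, fderiv ℂ (fun y => e.symm y i) (e z) (basisVec l) *
    fderiv ℂ (fun w => fderiv ℂ (fun x => e x l) w (basisVec k)) z (basisVec j)

theorem differentiableOn_apply {φ : Cn n → Cn n} {U : Set (Cn n)}
    (h : DifferentiableOn ℂ φ U) (l : Fin n) : DifferentiableOn ℂ (fun x => φ x l) U :=
  differentiableOn_pi.1 h l

theorem differentiableOn_flatConn (he : DifferentiableOn ℂ e e.source)
    (he' : DifferentiableOn ℂ e.symm e.target) (i k j : Fin n) :
    DifferentiableOn ℂ (fun z => flatConn e z i k j) e.source := by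
  refine DifferentiableOn.fun_sum fun l _ => DifferentiableOn.mul ?_ ?_
  · exact (differentiableOn_fderiv_apply e.open_target (differentiableOn_apply he' i) _).comp he
      e.mapsTo
  · exact differentiableOn_fderiv_apply e.open_source
      (differentiableOn_fderiv_apply e.open_source (differentiableOn_apply he l) _) _

theorem flatConn_symm (he : DifferentiableOn ℂ e e.source) {z : Cn n} (hz : z ∈ e.source)
    (i k j : Fin n) : flatConn e z i k j = flatConn e z i j k :=
  Finset.sum_congr rfl fun l _ => by
    rw [fderiv_fderiv_comm e.open_source (differentiableOn_apply he l) hz]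

/-- Near `z`, `M²(w, ξ) = Λ(de_w ξ)` with `Λ` fixed. In `∂M²/∂η̄ᵐ` the conjugate Jacobian is
antiholomorphic in `w`, so `∂/∂zʲ` acts only on `de_w η`. The result is the Hessian of `Λ` along `X
= (∂ⱼ de) η`, which is `g` applied to `de⁻¹ X`; hence `N_j = de⁻¹ X`. -/
theorem connCoeff_of_chart (hM : IsFinslerMetric D M)
    (hD : IsOpen D) (hes : e.source ⊆ D)
    (he : DifferentiableOn ℂ e e.source) (he' : DifferentiableOn ℂ e.symm e.target)
    (hc : ∀ w ∈ e.target, ∀ w' ∈ e.target, ∀ ξ : Cn n, ξ ≠ 0 →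
      fundTensor (inChart e M) w ξ = fundTensor (inChart e M) w' ξ)
    {z : Cn n} (hz : z ∈ e.source) {η : Cn n} (hη : η ≠ 0) (i j : Fin n) :
    connCoeff M z η i j = ∑ k, flatConn e z i k j * η k := by
  have hR := hM.regularOn hD
  set K := fderiv ℂ e.symm (e z) with hKdef
  set Λ : Cn n → ℂ := fun ξ => energy M (z, K ξ) with hΛ
  have hK : ∀ v, v ≠ 0 → K v ≠ 0 := by
    intro v hv h0
    exact hv (by rw [← fderiv_comp_symm he he' hz v, ← hKdef, h0, map_zero])
  have hJ : ∀ w ∈ e.source, ∀ v, v ≠ 0 → fderiv ℂ e w v ≠ 0 := fun w hw v hv h0 => hv (by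
    rw [← fderiv_symm_comp he he' hw v, h0, map_zero])
  have hΛs : ContDiffOn ℝ ∞ Λ {0}ᶜ := by
    refine hR.smooth.comp (t := slit D) (ContDiff.contDiffOn ?_) fun x hx =>
        ⟨hes hz, hK _ hx⟩
    exact contDiff_const.prodMk (K.restrictScalars ℝ).contDiff
  have hdΛ : ∀ ξ, ξ ≠ 0 → DifferentiableAt ℝ Λ ξ := fun ξ hξ =>
    (hΛs.differentiableOn (by simp)).differentiableAt (isOpen_compl_singleton.mem_nhds hξ)
  have hdΛ' : ∀ q ξ, ξ ≠ 0 → DifferentiableAt ℝ (fun y => dCbar Λ y (basisVec q)) ξ :=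
    fun q ξ hξ => ((contDiffOn_dCbar isOpen_compl_singleton hΛs _).differentiableOn
      (by simp)).differentiableAt (isOpen_compl_singleton.mem_nhds hξ)
  have hfib : ∀ w : Cn n, ∀ ξ, HasFDerivAt (𝕜 := ℂ) (fun ξ => fderiv ℂ e w ξ)
    (fderiv ℂ e w) ξ := fun w ξ => (fderiv ℂ e w).hasFDerivAt
  have hbar : ∀ w ∈ e.source, ∀ ξ, ξ ≠ 0 → ∀ m, energyBar M m (w, ξ)
      = ∑ q, star (fderiv ℂ e w (basisVec m) q) *
        dCbar Λ (fderiv ℂ e w ξ) (basisVec q) := by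
    intro w hw ξ hξ m
    have h1 := (HasWirt.right (hasWirt (hR.diffAt hR.smooth (x := (w, ξ)) ⟨hes hw, hξ⟩)
      (0, basisVec m))).congr (g := fun y => Λ (fderiv ℂ e w y)) (by
        filter_upwards [isOpen_ne.mem_nhds hξ] with y hy
        exact (energy_eq_of_chart hM hD hes he he' hc hz hw hy).symm)
    have h2 := HasWirt.comp_holo (hasWirt (hdΛ _ (hJ w hw ξ hξ)) _) (hfib w ξ)
      (V := basisVec m)
    have h3 := h1.unique_right h2
    rw [energyBar, h3]
    conv_lhs => rw [← sum_smul_basisVec (fderiv ℂ e w (basisVec m))]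
    simp only [dCbar_sum_right, dCbar_smul_right]
  have hx : (z, η) ∈ slit D := ⟨hes hz, hη⟩
  -- Both `g_{i m̄}` and `∂²M²/∂zʲ∂η̄ᵐ` are values of this one linear map, at `de(∂ᵢ)` and at `X`
  -- respectively.
  set H : Cn n → Fin n → ℂ := fun u m => ∑ q, star (fderiv ℂ e z (basisVec m) q) *
    dC (fun y => dCbar Λ y (basisVec q)) (fderiv ℂ e z η) u with hH
  have hg : ∀ i m, fundTensor M z η i m = H (fderiv ℂ e z (basisVec i)) m := by
    intro i m
    rw [hR.fundTensor_eq hx]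
    have h1 := (HasWirt.right (hasWirt (hR.diffAt (hR.smooth_bar m) hx) (0, basisVec i)))
    have h2 := (HasWirt.sum Finset.univ fun q _ => (HasWirt.comp_holo
      (hasWirt (hdΛ' q _ (hJ z hz η hη)) _) (hfib z η) (V := basisVec i)).const_mul
        (star (fderiv ℂ e z (basisVec m) q)))
    exact (h1.congr (by
      filter_upwards [isOpen_ne.mem_nhds hη] with y hy
      exact (hbar z hz y hy m).symm)).unique_left h2
  have hcomp : ∀ w ∈ e.source, ∀ v l, fderiv ℂ (fun x => e x l) w v = fderiv ℂ e w v l :=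
    fun w hw v l => fderiv_apply_comp (he.differentiableAt (e.open_source.mem_nhds hw)) v l
  have hhol : ∀ v l, HasFDerivAt (𝕜 := ℂ) (fun w => fderiv ℂ e w v l)
      (fderiv ℂ (fun w => fderiv ℂ (fun x => e x l) w v) z) z := by
    intro v l
    have := ((differentiableOn_fderiv_apply e.open_source (differentiableOn_apply he l)
      v).differentiableAt (e.open_source.mem_nhds hz)).hasFDerivAt
    refine this.congr_of_eventuallyEq ?_
    filter_upwards [e.open_source.mem_nhds hz] with w hw using (hcomp w hw v l).symm
  set X : Cn n := fun l => fderiv ℂ (fun w => fderiv ℂ (fun x => e x l) w η) z (basisVec j)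
    with hX
  have hd : ∀ m, dC (energyBar M m) (z, η) (basisVec j, 0) = H X m := by
    intro m
    have h1 := (HasWirt.left (hasWirt (hR.diffAt (hR.smooth_bar m) hx) (basisVec j, 0)))
    have hvec : HasFDerivAt (𝕜 := ℂ) (fun w => fderiv ℂ e w η) (ContinuousLinearMap.pi fun l =>
        fderiv ℂ (fun w => fderiv ℂ (fun x => e x l) w η) z) z :=
      hasFDerivAt_pi.2 fun l => hhol η l
    have h2 := (HasWirt.sum Finset.univ fun q _ =>
      ((HasWirt.of_holo (hhol (basisVec m) q) (basisVec j)).conj).mul (HasWirt.comp_holo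
      (hasWirt (hdΛ' q _ (hJ z hz η hη)) _) hvec (V := basisVec j)))
    have h3 := (h1.congr (by
      filter_upwards [e.open_source.mem_nhds hz] with w hw
      exact (hbar w hw η hη m).symm)).unique_left h2
    rw [h3]
    simp only [star_zero, zero_mul, zero_add]
    rfl
  have hXK : X = fderiv ℂ e z (K X) := (fderiv_comp_symm he he' hz X).symm
  have hlow : (fun i => connCoeff M z η i j) = K X := by
    refine hR.lower_injective hx fun m => ?_
    refine (hR.lower_connCoeff hx m j).trans ?_
    rw [hd, hXK]
    simp only [hg]
    conv_lhs => rw [← sum_smul_basisVec (K X)]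
    simp only [hH, map_sum, map_smul, dC_sum_right, dC_smul_right, Finset.mul_sum, Finset.sum_mul]
    rw [Finset.sum_comm]
    refine Finset.sum_congr rfl fun q _ => Finset.sum_congr rfl fun p _ => ?_
    conv_rhs => rw [← hXK]
    ring
  rw [congrFun hlow i]
  have hXs : ∀ l, X l = ∑ k, fderiv ℂ (fun w => fderiv ℂ (fun x => e x l) w (basisVec k)) z
      (basisVec j) * η k := by
    intro l
    have h1 : HasFDerivAt (𝕜 := ℂ) (fun w => fderiv ℂ (fun x => e x l) w η)
        (∑ k, η k • fderiv ℂ (fun w => fderiv ℂ (fun x => e x l) w (basisVec k)) z) z := by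
      have e1 : (fun w => fderiv ℂ (fun x => e x l) w η)
          = fun w => ∑ k, η k • fderiv ℂ (fun x => e x l) w (basisVec k) := by
        ext w
        conv_lhs => rw [← sum_smul_basisVec η]
        simp
      rw [e1]
      exact HasFDerivAt.fun_sum fun k _ => (((differentiableOn_fderiv_apply e.open_source
        (differentiableOn_apply he l) _).differentiableAt
          (e.open_source.mem_nhds hz)).hasFDerivAt).fun_const_smul _
    simp only [hX, h1.fderiv]
    simp [mul_comm]
  have hKi : ∀ v, K v i = ∑ l, fderiv ℂ (fun y => e.symm y i) (e z) (basisVec l) * v l := by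
    intro v
    conv_lhs => rw [← sum_smul_basisVec v]
    simp only [map_sum, map_smul, Finset.sum_apply, Pi.smul_apply, smul_eq_mul]
    refine Finset.sum_congr rfl fun l _ => ?_
    rw [fderiv_apply_comp (he'.differentiableAt (e.open_target.mem_nhds (e.map_source hz))),
      mul_comm]
  rw [hKi]
  simp only [hXs, flatConn, Finset.mul_sum, Finset.sum_mul]
  rw [Finset.sum_comm]
  exact Finset.sum_congr rfl fun _ _ => Finset.sum_congr rfl fun _ _ => by ring

end Minkowski

/-- Around every point, the connection of a locally Minkowski metric is linear, torsion free and
holomorphic. -/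
theorem IsLocallyMinkowski.exists_conn {D : Set (Cn n)} (hD : IsOpen D) {M : Cn n → Cn n → ℝ}
    (hM : IsFinslerMetric D M) (h : IsLocallyMinkowski D M) {p : Cn n} (hp : p ∈ D) :
    ∃ U : Set (Cn n), IsOpen U ∧ p ∈ U ∧ U ⊆ D ∧ ∃ Γ : Cn n → Fin n → Fin n → Fin n → ℂ,
      (∀ i j k, DifferentiableOn ℂ (fun z => Γ z i j k) U) ∧
      (∀ z ∈ U, ∀ i j k, Γ z i j k = Γ z i k j) ∧
      ∀ z ∈ U, ∀ η, η ≠ 0 → ∀ i j, connCoeff M z η i j = ∑ k, Γ z i k j * η k := by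
  obtain ⟨e, hpe, hes, he, he', hc⟩ := h p hp
  exact ⟨e.source, e.open_source, hpe, hes, flatConn e, differentiableOn_flatConn he he',
    fun z hz => flatConn_symm he hz, fun z hz η hη i j =>
      connCoeff_of_chart hM hD hes he he' hc hz hη i j⟩

/-! ### Polynomials on real lines and square roots of quadratic polynomials -/

/-- `f` is the restriction to `ℝ` of a complex polynomial. -/
def IsPoly (f : ℝ → ℂ) : Prop := ∃ p : Polynomial ℂ, ∀ t : ℝ, f t = p.eval (t : ℂ)

namespace IsPoly

variable {f g : ℝ → ℂ}

theorem const (c : ℂ) : IsPoly fun _ => c := ⟨Polynomial.C c, fun t => by simp⟩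

theorem ofReal : IsPoly fun t => (t : ℂ) := ⟨Polynomial.X, fun t => by simp⟩

theorem add (hf : IsPoly f) (hg : IsPoly g) : IsPoly fun t => f t + g t := by
  obtain ⟨p, hp⟩ := hf
  obtain ⟨q, hq⟩ := hg
  exact ⟨p + q, fun t => by simp [hp, hq]⟩

theorem mul (hf : IsPoly f) (hg : IsPoly g) : IsPoly fun t => f t * g t := by
  obtain ⟨p, hp⟩ := hf
  obtain ⟨q, hq⟩ := hg
  exact ⟨p * q, fun t => by simp [hp, hq]⟩

theorem sub (hf : IsPoly f) (hg : IsPoly g) : IsPoly fun t => f t - g t := by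
  obtain ⟨p, hp⟩ := hf
  obtain ⟨q, hq⟩ := hg
  exact ⟨p - q, fun t => by simp [hp, hq]⟩

theorem sum {ι : Type*} (s : Finset ι) {f : ι → ℝ → ℂ} (h : ∀ i ∈ s, IsPoly (f i)) :
    IsPoly fun t => ∑ i ∈ s, f i t := by
  classical
  induction s using Finset.induction_on with
  | empty => simpa using const 0
  | insert a s ha ih =>
    simp only [Finset.sum_insert ha]
    exact (h a (by simp)).add (ih fun i hi => h i (by simp [hi]))

theorem line (u v : Cn n) (i : Fin n) : IsPoly fun t => (u + (t : ℂ) • v) i := by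
  simpa using (const (u i)).add (ofReal.mul (const (v i)))

/-- The parameter is real, so conjugation only affects the coefficients. -/
theorem star_line (u v : Cn n) (i : Fin n) : IsPoly fun t => star ((u + (t : ℂ) • v) i) := by
  simpa using (const (star (u i))).add (ofReal.mul (const (star (v i))))

/-- A polynomial vanishing off the origin vanishes at the origin. -/
theorem zero_of_ne (hf : IsPoly f) (h : ∀ t, t ≠ 0 → f t = 0) : f 0 = 0 := by
  obtain ⟨p, hp⟩ := hf
  have : p = 0 := by
    refine Polynomial.eq_zero_of_infinite_isRoot p (Set.Infinite.mono (s :=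
      (fun t : ℝ => (t : ℂ)) '' {0}ᶜ) ?_ ?_)
    · rintro _ ⟨t, ht, rfl⟩
      simpa [Polynomial.IsRoot, ← hp] using h t ht
    · exact (Set.finite_singleton 0).infinite_compl.image Complex.ofReal_injective.injOn
  rw [hp, this]; simp

end IsPoly

/-- The square root of a positive quadratic polynomial is not a rational function. -/
theorem IsPoly.eq_zero_of_sqrt {E O : ℝ → ℂ} (hE : IsPoly E) (hO : IsPoly O) {q r s : ℝ}
    (hq : 0 < q) (hpos : ∀ t : ℝ, 0 < q * t ^ 2 + 2 * r * t + s)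
    (h : ∀ t : ℝ, E t + (√(q * t ^ 2 + 2 * r * t + s) : ℝ) * O t = 0) (t : ℝ) :
    E t = 0 ∧ O t = 0 := by
  obtain ⟨P, hP⟩ := hE
  obtain ⟨R, hR⟩ := hO
  -- Positivity is evaluated at the vertex `-r / q` of the parabola.
  have hdisc : 0 < q * s - r ^ 2 := by
    have h0 := hpos (-r / q)
    have : q * (-r / q) ^ 2 + 2 * r * (-r / q) + s = (q * s - r ^ 2) / q := by
      field_simp; ring
    rw [this] at h0
    exact (div_pos_iff_of_pos_right hq).1 h0
  set d : ℂ := ((√(q * s - r ^ 2) : ℝ) : ℂ) with hd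
  have hd2 : d ^ 2 = q * s - r ^ 2 := by
    rw [hd, ← Complex.ofReal_pow, Real.sq_sqrt hdisc.le]; push_cast; ring
  have hd0 : d ≠ 0 := by
    rw [hd]; exact_mod_cast (Real.sqrt_pos.2 hdisc).ne'
  have hqc : (q : ℂ) ≠ 0 := by exact_mod_cast hq.ne'
  set τ : ℂ := (-r + Complex.I * d) / q with hτ
  set τ' : ℂ := (-r - Complex.I * d) / q with hτ'
  have hne : τ ≠ τ' := by
    intro h
    rw [hτ, hτ', div_left_inj' hqc] at h
    have : 2 * (Complex.I * d) = 0 := by linear_combination h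
    simp [hd0] at this
  -- Multiplying `E + √· O = 0` by its conjugate `E - √· O` removes the root; the quadratic has the
  -- two distinct complex zeros `τ` and `τ'`.
  have hsq : P ^ 2 = Polynomial.C (q : ℂ) * ((Polynomial.X - Polynomial.C τ) *
      (Polynomial.X - Polynomial.C τ')) * R ^ 2 := by
    refine Polynomial.eq_of_infinite_eval_eq _ _ (Set.Infinite.mono (s :=
      Set.range (fun t : ℝ => (t : ℂ))) ?_ (Set.infinite_range_of_injective
        Complex.ofReal_injective))
    rintro _ ⟨t, rfl⟩
    have h1 := h t
    rw [hP, hR] at h1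
    have h2 : ((√(q * t ^ 2 + 2 * r * t + s) : ℝ) : ℂ) ^ 2 = q * t ^ 2 + 2 * r * t + s := by
      rw [← Complex.ofReal_pow, Real.sq_sqrt (hpos t).le]; push_cast; ring
    have h3 : (q : ℂ) * (((t : ℂ) - τ) * ((t : ℂ) - τ')) = q * t ^ 2 + 2 * r * t + s := by
      rw [hτ, hτ']
      field_simp
      linear_combination hd2 - d ^ 2 * Complex.I_sq
    simp only [Set.mem_ofPred_eq, Polynomial.eval_pow, Polynomial.eval_mul, Polynomial.eval_C,
      Polynomial.eval_sub, Polynomial.eval_X, h3]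
    rw [← h2]
    linear_combination (P.eval (t : ℂ) - (√(q * t ^ 2 + 2 * r * t + s) : ℝ) * R.eval (t : ℂ)) * h1
  have hR0 : R = 0 := by
    by_contra hR0
    have hX : (Polynomial.X - Polynomial.C τ) ≠ 0 := Polynomial.X_sub_C_ne_zero τ
    have hX' : (Polynomial.X - Polynomial.C τ') ≠ 0 := Polynomial.X_sub_C_ne_zero τ'
    have hC : Polynomial.C (q : ℂ) ≠ 0 := by simpa using hq.ne'
    have hrhs : Polynomial.C (q : ℂ) * ((Polynomial.X - Polynomial.C τ) *
      (Polynomial.X - Polynomial.C τ')) * R ^ 2 ≠ 0 :=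
      mul_ne_zero (mul_ne_zero hC (mul_ne_zero hX hX')) (pow_ne_zero 2 hR0)
    have hP0 : P ≠ 0 := by
      rintro rfl
      rw [← hsq] at hrhs
      simp at hrhs
    -- The multiplicity of `τ` is even on the left and odd on the right.
    have hm := congrArg (Polynomial.rootMultiplicity τ) hsq
    rw [Polynomial.rootMultiplicity_mul hrhs, Polynomial.rootMultiplicity_mul
      (left_ne_zero_of_mul hrhs), Polynomial.rootMultiplicity_mul (mul_ne_zero hX hX'), sq, sq,
      Polynomial.rootMultiplicity_mul (mul_ne_zero hP0 hP0),
      Polynomial.rootMultiplicity_mul (mul_ne_zero hR0 hR0), Polynomial.rootMultiplicity_C,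
      Polynomial.rootMultiplicity_X_sub_C_self, Polynomial.rootMultiplicity_X_sub_C,
      if_neg hne] at hm
    omega
  have hP0 : P = 0 := by
    rw [hR0] at hsq
    simpa using hsq
  rw [hP, hR, hP0, hR0]
  simp

/-! ### Sesquilinear forms -/

/-- The sesquilinear form with matrix `m`. -/
def sesq (m : Matrix (Fin n) (Fin n) ℂ) (u v : Cn n) : ℂ := ∑ i, ∑ j, m i j * u i * star (v j)

/-- The linear form with coefficients `b`. -/
def lin (b u : Cn n) : ℂ := ∑ i, b i * u i

section Sesq

variable (m : Matrix (Fin n) (Fin n) ℂ) (u u' v v' : Cn n) (c : ℂ)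

theorem sesq_add_left : sesq m (u + u') v = sesq m u v + sesq m u' v := by
  simp only [sesq, Pi.add_apply, mul_add, add_mul, Finset.sum_add_distrib]

theorem sesq_add_right : sesq m u (v + v') = sesq m u v + sesq m u v' := by
  simp only [sesq, Pi.add_apply, star_add, mul_add, Finset.sum_add_distrib]

theorem sesq_smul_left : sesq m (c • u) v = c * sesq m u v := by
  simp only [sesq, Pi.smul_apply, smul_eq_mul, Finset.mul_sum]
  exact Finset.sum_congr rfl fun _ _ => Finset.sum_congr rfl fun _ _ => by ring

theorem sesq_smul_right : sesq m u (c • v) = star c * sesq m u v := by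
  simp only [sesq, Pi.smul_apply, smul_eq_mul, Finset.mul_sum, star_mul']
  exact Finset.sum_congr rfl fun _ _ => Finset.sum_congr rfl fun _ _ => by ring

end Sesq

theorem lin_add_right (b u v : Cn n) : lin b (u + v) = lin b u + lin b v := by
  simp only [lin, Pi.add_apply, mul_add, Finset.sum_add_distrib]

theorem lin_smul_right (b : Cn n) (c : ℂ) (u : Cn n) : lin b (c • u) = c * lin b u := by
  simp only [lin, Pi.smul_apply, smul_eq_mul, Finset.mul_sum]
  exact Finset.sum_congr rfl fun _ _ => by ring

theorem sesq_eq_dotProduct (m : Matrix (Fin n) (Fin n) ℂ) (u : Cn n) :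
    sesq m u u = star (star u) ⬝ᵥ (m.mulVec (star u)) := by
  simp only [sesq, dotProduct, Matrix.mulVec, star_star, Finset.mul_sum, Pi.star_apply]
  exact Finset.sum_congr rfl fun _ _ => Finset.sum_congr rfl fun _ _ => by ring

theorem sesq_pos {m : Matrix (Fin n) (Fin n) ℂ} (hm : m.PosDef) {u : Cn n} (hu : u ≠ 0) :
    0 < sesq m u u := by
  rw [sesq_eq_dotProduct]
  exact hm.dotProduct_mulVec_pos (star_ne_zero.2 hu)

theorem sesq_star {m : Matrix (Fin n) (Fin n) ℂ} (hm : m.PosDef) (u v : Cn n) :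
    star (sesq m u v) = sesq m v u := by
  simp only [sesq, star_sum, star_mul', star_star]
  rw [Finset.sum_comm]
  refine Finset.sum_congr rfl fun j _ => Finset.sum_congr rfl fun i _ => ?_
  rw [← hm.isHermitian.apply j i]
  ring

theorem sesq_self_eq {m : Matrix (Fin n) (Fin n) ℂ} (hm : m.PosDef) (u : Cn n) :
    ((sesq m u u).re : ℂ) = sesq m u u :=
  Complex.conj_eq_iff_re.1 (sesq_star hm u u)

theorem sesq_re_pos {m : Matrix (Fin n) (Fin n) ℂ} (hm : m.PosDef) {u : Cn n} (hu : u ≠ 0) :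
    0 < (sesq m u u).re := (Complex.pos_iff.1 (sesq_pos hm hu)).1

/-- On a hyperplane `b ≠ 0` of dimension at least two, the norm of a Hermitian form is
irrational over functions that are polynomial along the lines in the direction of `ker b`. -/
theorem eq_zero_of_hermNorm {m : Matrix (Fin n) (Fin n) ℂ} (hm : m.PosDef) {b : Cn n}
    {E O : Cn n → ℂ} {η v : Cn n} (hη : lin b η ≠ 0) (hv : v ≠ 0) (hbv : lin b v = 0)
    (hE : IsPoly fun t => E (η + (t : ℂ) • v)) (hO : IsPoly fun t => O (η + (t : ℂ) • v))
    (h : ∀ ξ, lin b ξ = lin b η → E ξ + (√(sesq m ξ ξ).re : ℝ) * O ξ = 0) :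
    E η = 0 ∧ O η = 0 := by
  have hb : ∀ t : ℝ, lin b (η + (t : ℂ) • v) = lin b η := fun t => by
    rw [lin_add_right, lin_smul_right, hbv, mul_zero, add_zero]
  have hexp : ∀ t : ℝ, (sesq m (η + (t : ℂ) • v) (η + (t : ℂ) • v)).re
      = (sesq m v v).re * t ^ 2 + 2 * (sesq m η v).re * t + (sesq m η η).re := by
    intro t
    have e : (sesq m v η).re = (sesq m η v).re := by
      rw [← sesq_star hm]; simp
    simp only [sesq_add_left, sesq_add_right, sesq_smul_left, sesq_smul_right]
    simp [e]
    ring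
  have hne : ∀ t : ℝ, η + (t : ℂ) • v ≠ 0 := fun t h0 => hη (by
    rw [← hb t, h0]; simp [lin])
  have := hE.eq_zero_of_sqrt hO (sesq_re_pos hm hv)
    (fun t => by rw [← hexp]; exact sesq_re_pos hm (hne t))
    (fun t => by rw [← hexp]; exact h _ (hb t)) 0
  simpa using this

theorem exists_ne_zero_lin_eq_zero (hn : 2 ≤ n) (b : Cn n) : ∃ v : Cn n, v ≠ 0 ∧ lin b v = 0 := by
  let i : Fin n := ⟨0, by omega⟩
  let j : Fin n := ⟨1, by omega⟩
  have hij : i ≠ j := by simp [i, j]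
  by_cases hb : b i = 0
  · refine ⟨basisVec i, by simp, ?_⟩
    simp [lin, Pi.single_apply, hb]
  · refine ⟨b j • basisVec i - b i • basisVec j, fun h => hb ?_, ?_⟩
    · have := congrFun h j
      simpa [Pi.single_apply, hij.symm] using this
    · rw [sub_eq_add_neg, lin_add_right, ← neg_smul, lin_smul_right, lin_smul_right]
      simp [lin, Pi.single_apply]
      ring

/-- The quadratic form with coefficients `S`. -/
def quad (S : Fin n → Fin n → ℂ) (u : Cn n) : ℂ := ∑ i, ∑ j, S i j * u i * u j

/-- The form `T_{i j k} uⁱ uᵏ v̄ʲ`. -/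
def tri (T : Fin n → Fin n → Fin n → ℂ) (u v : Cn n) : ℂ :=
  ∑ i, ∑ j, ∑ k, T i j k * u i * u k * star (v j)

theorem tri_add_right (T : Fin n → Fin n → Fin n → ℂ) (u v v' : Cn n) :
    tri T u (v + v') = tri T u v + tri T u v' := by
  simp only [tri, Pi.add_apply, star_add, mul_add, Finset.sum_add_distrib]

theorem tri_smul_right (T : Fin n → Fin n → Fin n → ℂ) (u v : Cn n) (c : ℂ) :
    tri T u (c • v) = star c * tri T u v := by
  simp only [tri, Pi.smul_apply, smul_eq_mul, Finset.mul_sum, star_mul']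
  exact Finset.sum_congr rfl fun _ _ => Finset.sum_congr rfl fun _ _ =>
    Finset.sum_congr rfl fun _ _ => by ring

section PolyForms

variable {f g : ℝ → Cn n}

theorem IsPoly.sesq (m : Matrix (Fin n) (Fin n) ℂ) (hf : ∀ i, IsPoly fun t => f t i)
    (hg : ∀ i, IsPoly fun t => star (g t i)) : IsPoly fun t => sesq m (f t) (g t) :=
  IsPoly.sum _ fun i _ => IsPoly.sum _ fun j _ => ((IsPoly.const _).mul (hf i)).mul (hg j)

theorem IsPoly.lin (b : Cn n) (hf : ∀ i, IsPoly fun t => f t i) :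
    IsPoly fun t => lin b (f t) :=
  IsPoly.sum _ fun i _ => (IsPoly.const _).mul (hf i)

theorem IsPoly.star_lin (b : Cn n) (hf : ∀ i, IsPoly fun t => star (f t i)) :
    IsPoly fun t => star (ComplexFinsler.lin b (f t)) := by
  simp only [ComplexFinsler.lin, star_sum, star_mul']
  exact IsPoly.sum _ fun i _ => (IsPoly.const _).mul (hf i)

theorem IsPoly.quad (S : Fin n → Fin n → ℂ) (hf : ∀ i, IsPoly fun t => f t i) :
    IsPoly fun t => quad S (f t) :=
  IsPoly.sum _ fun i _ => IsPoly.sum _ fun j _ => ((IsPoly.const _).mul (hf i)).mul (hf j)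

theorem IsPoly.tri (T : Fin n → Fin n → Fin n → ℂ) (hf : ∀ i, IsPoly fun t => f t i)
    (hg : ∀ i, IsPoly fun t => star (g t i)) : IsPoly fun t => tri T (f t) (g t) :=
  IsPoly.sum _ fun i _ => IsPoly.sum _ fun j _ => IsPoly.sum _ fun k _ =>
    (((IsPoly.const _).mul (hf i)).mul (hf k)).mul (hg j)

end PolyForms

section WirtForms

variable {E : Type*} [NormedAddCommGroup E] [NormedSpace ℝ E] [NormedSpace ℂ E] {x V : E}

theorem HasWirt.sesq {m : E → Matrix (Fin n) (Fin n) ℂ} {u v : E → Cn n}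
    {pm qm : Matrix (Fin n) (Fin n) ℂ} {pu qu pv qv : Cn n}
    (hm : ∀ i j, HasWirt (fun y => m y i j) x V (pm i j) (qm i j))
    (hu : ∀ i, HasWirt (fun y => u y i) x V (pu i) (qu i))
    (hv : ∀ i, HasWirt (fun y => v y i) x V (pv i) (qv i)) :
    HasWirt (fun y => sesq (m y) (u y) (v y)) x V
      (sesq pm (u x) (v x) + sesq (m x) pu (v x) + sesq (m x) (u x) qv)
      (sesq qm (u x) (v x) + sesq (m x) qu (v x) + sesq (m x) (u x) pv) := by
  refine HasWirt.of_eq (HasWirt.sum _ fun i _ => HasWirt.sum _ fun j _ =>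
    ((hm i j).mul (hu i)).mul (hv j).conj) ?_ ?_
  · simp only [ComplexFinsler.sesq, ← Finset.sum_add_distrib]
    exact Finset.sum_congr rfl fun _ _ => Finset.sum_congr rfl fun _ _ => by ring
  · simp only [ComplexFinsler.sesq, ← Finset.sum_add_distrib]
    exact Finset.sum_congr rfl fun _ _ => Finset.sum_congr rfl fun _ _ => by ring

theorem HasWirt.lin {b u : E → Cn n} {pb qb pu qu : Cn n}
    (hb : ∀ i, HasWirt (fun y => b y i) x V (pb i) (qb i))
    (hu : ∀ i, HasWirt (fun y => u y i) x V (pu i) (qu i)) :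
    HasWirt (fun y => lin (b y) (u y)) x V (lin pb (u x) + lin (b x) pu)
      (lin qb (u x) + lin (b x) qu) := by
  refine HasWirt.of_eq (HasWirt.sum _ fun i _ => (hb i).mul (hu i)) ?_ ?_
  · simp only [ComplexFinsler.lin, ← Finset.sum_add_distrib]
  · simp only [ComplexFinsler.lin, ← Finset.sum_add_distrib]

end WirtForms

@[simp] theorem sesq_zero_left (m : Matrix (Fin n) (Fin n) ℂ) (v : Cn n) : sesq m 0 v = 0 := by
  simp [sesq]

@[simp] theorem sesq_zero_right (m : Matrix (Fin n) (Fin n) ℂ) (v : Cn n) : sesq m v 0 = 0 := by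
  simp [sesq]

@[simp] theorem sesq_zero_matrix (u v : Cn n) : sesq 0 u v = 0 := by simp [sesq]

@[simp] theorem lin_zero_right (b : Cn n) : lin b 0 = 0 := by simp [lin]

@[simp] theorem lin_zero_left (u : Cn n) : lin 0 u = 0 := by simp [lin]

theorem hasWirt_apply (i : Fin n) (x V : Cn n) : HasWirt (fun y : Cn n => y i) x V (V i) 0 := by
  have h : HasFDerivAt (𝕜 := ℂ) (fun y : Cn n => y i)
      (ContinuousLinearMap.proj (R := ℂ) (φ := fun _ : Fin n => ℂ) i) x :=
    (ContinuousLinearMap.proj (R := ℂ) (φ := fun _ : Fin n => ℂ) i).hasFDerivAt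
  simpa using HasWirt.of_holo h V

theorem dCbar_eq_zero_of_holo {f : Cn n → ℂ} {x : Cn n} (h : DifferentiableAt ℂ f x) (V : Cn n) :
    HasWirt f x V (dC f x V) 0 :=
  (HasWirt.of_holo h.hasFDerivAt V).of_eq (HasWirt.of_holo h.hasFDerivAt V).dC_eq.symm rfl

/-! ### Separating the rational and irrational parts of the projective equation. -/

section Algebra

variable {a : Matrix (Fin n) (Fin n) ℂ} {b : Cn n} {T : Fin n → Fin n → Fin n → ℂ}
  {S : Fin n → Fin n → ℂ} {C : Matrix (Fin n) (Fin n) ℂ}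

/-- The algebraic consequences of the holomorphic part of the projective flatness equation. -/
theorem conformal_of_projective (hn : 2 ≤ n) (ha : a.PosDef)
    (h : ∀ η v, lin b η ≠ 0 → lin b v = 0 →
      2 * sesq a η η ^ 2 * (lin b η * sesq C η v)
        + lin b η * star (lin b η) * (2 * sesq a η η * tri T η v - tri T η η * sesq a η v)
        - sesq a η η * (star (lin b η) * quad S η + lin b η * sesq C η η) * sesq a η v
      + (√(sesq a η η).re : ℝ) * (2 * (‖lin b η‖ : ℂ) * (sesq a η η * tri T η v
        - tri T η η * sesq a η v + sesq a η η * (lin b η * sesq C η v))) = 0)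
    {η : Cn n} (hη : lin b η ≠ 0) :
    (∀ v, lin b v = 0 → sesq C η v = 0) ∧
      (∀ ζ, sesq a η η * tri T η ζ = tri T η η * sesq a η ζ) ∧
      lin b η * star (lin b η) * tri T η η
        = sesq a η η * (star (lin b η) * quad S η + lin b η * sesq C η η) := by
  have hA : ∀ η, lin b η ≠ 0 → sesq a η η ≠ 0 := fun η hη => (sesq_pos ha (by
    rintro rfl; simp at hη)).ne'
  -- rational and irrational parts
  have h1 : ∀ η, lin b η ≠ 0 → ∀ v, lin b v = 0 →
      sesq a η η * tri T η v - tri T η η * sesq a η v + sesq a η η * (lin b η * sesq C η v) = 0 ∧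
      2 * sesq a η η ^ 2 * (lin b η * sesq C η v)
        + lin b η * star (lin b η) * (2 * sesq a η η * tri T η v - tri T η η * sesq a η v)
        - sesq a η η * (star (lin b η) * quad S η + lin b η * sesq C η η) * sesq a η v = 0 := by
    intro η hη v hv
    rcases eq_or_ne v 0 with rfl | hv0
    · have : tri T η 0 = 0 := by simp [tri]
      simp [this]
    have hl := fun i => IsPoly.line η v i
    have hs := fun i => IsPoly.star_line η v i
    have hc : ∀ i, IsPoly fun _ : ℝ => star (v i) := fun i => IsPoly.const _
    -- In `O` the factor `|β|` is frozen at `η`: it is not polynomial, but it is constant on the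
    -- slice `lin b ξ = lin b η`.
    have key := eq_zero_of_hermNorm ha (b := b)
      (E := fun η => 2 * sesq a η η ^ 2 * (lin b η * sesq C η v)
        + lin b η * star (lin b η) * (2 * sesq a η η * tri T η v - tri T η η * sesq a η v)
        - sesq a η η * (star (lin b η) * quad S η + lin b η * sesq C η η) * sesq a η v)
      (O := fun ξ => 2 * (‖lin b η‖ : ℂ) * (sesq a ξ ξ * tri T ξ v
        - tri T ξ ξ * sesq a ξ v + sesq a ξ ξ * (lin b ξ * sesq C ξ v))) hη hv0 hv ?_ ?_ ?_
    · refine ⟨?_, key.1⟩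
      have h2 := key.2
      simp only [mul_eq_zero, OfNat.ofNat_ne_zero, Complex.ofReal_eq_zero, norm_eq_zero, hη,
        false_or] at h2
      exact h2
    · simp only [sq]
      exact (((((IsPoly.const 2).mul ((IsPoly.sesq a hl hs).mul (IsPoly.sesq a hl hs))).mul
        ((IsPoly.lin b hl).mul (IsPoly.sesq C hl hc))).add
        (((IsPoly.lin b hl).mul (IsPoly.star_lin b hs)).mul
          ((((IsPoly.const 2).mul (IsPoly.sesq a hl hs)).mul (IsPoly.tri T hl hc)).sub
            ((IsPoly.tri T hl hs).mul (IsPoly.sesq a hl hc))))).sub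
        (((IsPoly.sesq a hl hs).mul (((IsPoly.star_lin b hs).mul (IsPoly.quad S hl)).add
          ((IsPoly.lin b hl).mul (IsPoly.sesq C hl hs)))).mul (IsPoly.sesq a hl hc)))
    · exact (IsPoly.const _).mul ((((IsPoly.sesq a hl hs).mul (IsPoly.tri T hl hc)).sub
            ((IsPoly.tri T hl hs).mul (IsPoly.sesq a hl hc))).add
            ((IsPoly.sesq a hl hs).mul ((IsPoly.lin b hl).mul (IsPoly.sesq C hl hc))))
    · intro ξ hξ
      have := h ξ v (by rwa [hξ]) hv
      simp only [hξ] at this ⊢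
      exact this
  have h2 : ∀ η, lin b η ≠ 0 → ∀ v, lin b v = 0 →
      2 * sesq a η η * (lin b η * sesq C η v)
        + lin b η * star (lin b η) * (tri T η v - lin b η * sesq C η v)
        - (star (lin b η) * quad S η + lin b η * sesq C η η) * sesq a η v = 0 := by
    intro η hη v hv
    obtain ⟨e1, e2⟩ := h1 η hη v hv
    refine mul_left_cancel₀ (hA η hη) ?_
    linear_combination e2 - lin b η * star (lin b η) * e1
  -- The identity `h2` is differentiated antiholomorphically along `v`. Holomorphic factors and `lin
  -- b` conjugated do not contribute, while `a(η, η)` becomes `a(η, v)` and `C(η, η)` becomes `C(η,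
  -- v)`. What is left is `(2 - 1) β C(η, v) a(η, v)`.
  have h3 : ∀ η, lin b η ≠ 0 → ∀ v, lin b v = 0 → sesq C η v * sesq a η v = 0 := by
    intro η hη v hv
    have hid : ∀ i, HasWirt (fun y : Cn n => y i) η v (v i) ((0 : Cn n) i) := fun i =>
      hasWirt_apply i η v
    have hconst : ∀ (w : Cn n) (i : Fin n), HasWirt (fun _ : Cn n => w i) η v ((0 : Cn n) i)
      ((0 : Cn n) i) := fun w i => HasWirt.const (w i)
    have hmat : ∀ (m : Matrix (Fin n) (Fin n) ℂ) (i j : Fin n), HasWirt (fun _ : Cn n => m i j) η v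
      ((0 : Matrix (Fin n) (Fin n) ℂ) i j) ((0 : Matrix (Fin n) (Fin n) ℂ) i j) :=
      fun m i j => HasWirt.const (m i j)
    have wA := HasWirt.sesq (hmat a) hid hid
    have wa := HasWirt.sesq (hmat a) hid (hconst v)
    have wb := HasWirt.lin (hconst b) hid
    have wC := HasWirt.sesq (hmat C) hid (hconst v)
    have wCC := HasWirt.sesq (hmat C) hid hid
    have wT : HasWirt (fun y => tri T y v) η v _ 0 :=
      dCbar_eq_zero_of_holo (by unfold tri; fun_prop) v
    have wS : HasWirt (fun y => quad S y) η v _ 0 :=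
      dCbar_eq_zero_of_holo (by unfold quad; fun_prop) v
    have w := ((((HasWirt.const 2).mul wA).mul (wb.mul wC)).add
      ((wb.mul wb.conj).mul (wT.sub (wb.mul wC)))).sub
      (((wb.conj.mul wS).add (wb.mul wCC)).mul wa)
    have hopen : IsOpen {y : Cn n | lin b y ≠ 0} := by
      refine isOpen_ne.preimage ?_
      unfold lin; fun_prop
    have w0 := (HasWirt.const (x := η) (V := v) 0).congr
      (g := fun η => 2 * sesq a η η * (lin b η * sesq C η v)
        + lin b η * star (lin b η) * (tri T η v - lin b η * sesq C η v)
        - (star (lin b η) * quad S η + lin b η * sesq C η η) * sesq a η v)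
      (by filter_upwards [hopen.mem_nhds hη] with y hy using h2 y hy v hv)
    have e := w.unique_right w0
    simp only [sesq_zero_left, sesq_zero_right, sesq_zero_matrix, lin_zero_left, lin_zero_right,
      hv, star_zero, mul_zero, zero_mul, add_zero, zero_add, sub_zero] at e
    have : lin b η * (sesq C η v * sesq a η v) = 0 := by linear_combination e
    exact (mul_eq_zero.1 this).resolve_left hη
  -- If `a(η, v) = 0`, then `a(η + tv, v) = t a(v, v)` is nonzero for `t ≠ 0`. The affine function
  -- `C(η + tv, v)` of `t` vanishes at `1` and `2`, hence at `0`.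
  have h4 : ∀ η, lin b η ≠ 0 → ∀ v, lin b v = 0 → sesq C η v = 0 := by
    intro η hη v hv
    rcases eq_or_ne v 0 with rfl | hv0
    · simp
    have hq : sesq a v v ≠ 0 := (sesq_pos ha hv0).ne'
    by_cases hz : sesq a η v = 0
    · have key : ∀ t : ℂ, t ≠ 0 → sesq C η v + t * sesq C v v = 0 := by
        intro t ht
        have := h3 (η + t • v) (by rwa [lin_add_right, lin_smul_right, hv, mul_zero, add_zero]) v hv
        simp only [sesq_add_left, sesq_smul_left, hz, zero_add] at this
        exact (mul_eq_zero.1 this).resolve_right (mul_ne_zero ht hq)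
      linear_combination 2 * key 1 one_ne_zero - key 2 two_ne_zero
    · exact (mul_eq_zero.1 (h3 η hη v hv)).resolve_right hz
  have h5 : ∀ η, lin b η ≠ 0 → ∀ v, lin b v = 0 →
      sesq a η η * tri T η v = tri T η η * sesq a η v := by
    intro η hη v hv
    have := (h1 η hη v hv).1
    rw [h4 η hη v hv] at this
    linear_combination this
  have h6 : ∀ η, lin b η ≠ 0 → ∀ v, lin b v = 0 → lin b η * star (lin b η) * tri T η v
      = (star (lin b η) * quad S η + lin b η * sesq C η η) * sesq a η v := by
    intro η hη v hv
    have := h2 η hη v hv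
    rw [h4 η hη v hv] at this
    linear_combination this
  have h7 : ∀ η, lin b η ≠ 0 → ∀ v, lin b v = 0 → sesq a η v ≠ 0 →
      lin b η * star (lin b η) * tri T η η
        - sesq a η η * (star (lin b η) * quad S η + lin b η * sesq C η η) = 0 := by
    intro η hη v hv hz
    refine (mul_eq_zero.1 (?_ : _ * sesq a η v = 0)).resolve_right hz
    linear_combination sesq a η η * h6 η hη v hv - lin b η * star (lin b η) * h5 η hη v hv
  refine ⟨h4 η hη, fun ζ => ?_, ?_⟩
  · have hv : lin b (ζ - (lin b ζ / lin b η) • η) = 0 := by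
      rw [sub_eq_add_neg, ← neg_smul, lin_add_right, lin_smul_right]
      field_simp; ring
    -- Along `η` itself the claimed proportionality is trivial, so only the component in `ker b`
    -- matters.
    have e : ζ = (ζ - (lin b ζ / lin b η) • η) + (lin b ζ / lin b η) • η := by abel
    have := h5 η hη _ hv
    rw [e, tri_add_right, sesq_add_right, tri_smul_right, sesq_smul_right, mul_add, mul_add, this]
    ring
  · obtain ⟨v, hv0, hv⟩ := exists_ne_zero_lin_eq_zero hn b
    have hq : sesq a v v ≠ 0 := (sesq_pos ha hv0).ne'
    -- When `a(η, v) = 0`, `h7` applies at `η + tv` for `t ≠ 0`, and the polynomial dependence on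
    -- `t` extends the identity to `t = 0`.
    by_cases hz : sesq a η v = 0
    · have hl := fun i => IsPoly.line η v i
      have hs := fun i => IsPoly.star_line η v i
      have hp : IsPoly fun t : ℝ => (fun η => lin b η * star (lin b η) * tri T η η
        - sesq a η η * (star (lin b η) * quad S η + lin b η * sesq C η η)) (η + (t : ℂ) • v) :=
        (((IsPoly.lin b hl).mul (IsPoly.star_lin b hs)).mul (IsPoly.tri T hl hs)).sub
        ((IsPoly.sesq a hl hs).mul (((IsPoly.star_lin b hs).mul (IsPoly.quad S hl)).add
          ((IsPoly.lin b hl).mul (IsPoly.sesq C hl hs))))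
      have := hp.zero_of_ne fun t ht => h7 _
        (by rwa [lin_add_right, lin_smul_right, hv, mul_zero, add_zero]) v hv (by
          rw [sesq_add_left, sesq_smul_left, hz, zero_add]
          exact mul_ne_zero (by exact_mod_cast ht) hq)
      simpa [sub_eq_zero] using this
    · exact sub_eq_zero.1 (h7 η hη v hv hz)

end Algebra

/-! ### Hermitian metrics and one-forms on the tangent bundle -/

/-- The tangent bundle over `D`. -/
def bundle (D : Set (Cn n)) : Set (Cn n × Cn n) := {x | x.1 ∈ D}

/-- Entrywise holomorphic derivative of a matrix valued function. -/
def dMat (a : Cn n → Matrix (Fin n) (Fin n) ℂ) (z v : Cn n) : Matrix (Fin n) (Fin n) ℂ :=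
  fun i j => dC (fun w => a w i j) z v

/-- Entrywise antiholomorphic derivative of a matrix valued function. -/
def dbarMat (a : Cn n → Matrix (Fin n) (Fin n) ℂ) (z v : Cn n) : Matrix (Fin n) (Fin n) ℂ :=
  fun i j => dCbar (fun w => a w i j) z v

/-- Entrywise holomorphic derivative of a vector valued function. -/
def dVec (b : Cn n → Cn n) (z v : Cn n) : Cn n := fun i => dC (fun w => b w i) z v

/-- Entrywise antiholomorphic derivative of a vector valued function. -/
def dbarVec (b : Cn n → Cn n) (z v : Cn n) : Cn n := fun i => dCbar (fun w => b w i) z v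

theorem isOpen_bundle {D : Set (Cn n)} (hD : IsOpen D) : IsOpen (bundle D) :=
  hD.preimage continuous_fst

theorem contDiffOn_fst_comp {D : Set (Cn n)} {f : Cn n → ℂ} (hf : ContDiffOn ℝ ∞ f D) :
    ContDiffOn ℝ ∞ (fun x : Cn n × Cn n => f x.1) (bundle D) :=
  hf.comp contDiff_fst.contDiffOn fun _ hx => hx

theorem contDiffOn_snd_apply (U : Set (Cn n × Cn n)) (i : Fin n) :
    ContDiffOn ℝ ∞ (fun x : Cn n × Cn n => x.2 i) U :=
  ContDiff.contDiffOn (by fun_prop)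

theorem contDiffOn_star {X : Type*} [NormedAddCommGroup X] [NormedSpace ℝ X] {U : Set X}
    {f : X → ℂ} (h : ContDiffOn ℝ ∞ f U) : ContDiffOn ℝ ∞ (fun x => star (f x)) U :=
  (Complex.conjCLE : ℂ →L[ℝ] ℂ).contDiff.comp_contDiffOn h

section Wirt

variable {D : Set (Cn n)} {a : Cn n → Matrix (Fin n) (Fin n) ℂ} {b : Cn n → Cn n}

theorem hasWirt_matrix (hD : IsOpen D) (ha : ∀ i j : Fin n, ContDiffOn ℝ ∞ (fun z => a z i j) D)
    {x : Cn n × Cn n} (hx : x.1 ∈ D) (V : Cn n × Cn n) (i j : Fin n) :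
    HasWirt (fun y : Cn n × Cn n => a y.1 i j) x V (dMat a x.1 V.1 i j) (dbarMat a x.1 V.1 i j) :=
  HasWirt.fst (f := fun w => a w i j) (hasWirt (((ha i j).differentiableOn
    (by simp)).differentiableAt (hD.mem_nhds hx)) V.1)

theorem hasWirt_vector (hD : IsOpen D) (hb : ContDiffOn ℝ ∞ b D)
    {x : Cn n × Cn n} (hx : x.1 ∈ D) (V : Cn n × Cn n) (i : Fin n) :
    HasWirt (fun y : Cn n × Cn n => b y.1 i) x V (dVec b x.1 V.1 i) (dbarVec b x.1 V.1 i) :=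
  HasWirt.fst (f := fun w => b w i) (hasWirt (((contDiffOn_pi.1 hb i).differentiableOn
    (by simp)).differentiableAt (hD.mem_nhds hx)) V.1)

theorem hasWirt_snd (x V : Cn n × Cn n) (i : Fin n) :
    HasWirt (fun y : Cn n × Cn n => y.2 i) x V (V.2 i) ((0 : Cn n) i) := hasWirt_snd_apply i x V

theorem hasWirt_const_vec (x V : Cn n × Cn n) (v : Cn n) (i : Fin n) :
    HasWirt (fun _ : Cn n × Cn n => v i) x V ((0 : Cn n) i) ((0 : Cn n) i) := HasWirt.const (v i)

end Wirt

/-! ### The fundamental tensor and Chern connection of a Hermitian metric. -/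

section Herm

variable {D : Set (Cn n)} {a : Cn n → Matrix (Fin n) (Fin n) ℂ}

theorem sesq_re_nonneg {m : Matrix (Fin n) (Fin n) ℂ} (hm : m.PosDef) (u : Cn n) :
    0 ≤ (sesq m u u).re := by
  rcases eq_or_ne u 0 with rfl | hu
  · simp
  · exact (sesq_re_pos hm hu).le

theorem hermNorm_eq (a : Cn n → Matrix (Fin n) (Fin n) ℂ) (z η : Cn n) :
    hermNorm a z η = √(sesq (a z) η η).re := rfl

theorem oneForm_eq (b : Cn n → Cn n) (z η : Cn n) : oneForm b z η = lin (b z) η := rfl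

theorem hermNorm_sq (hpos : ∀ z ∈ D, (a z).PosDef) {z : Cn n} (hz : z ∈ D) (η : Cn n) :
    ((hermNorm a z η : ℝ) : ℂ) ^ 2 = sesq (a z) η η := by
  rw [← Complex.ofReal_pow, hermNorm_eq, Real.sq_sqrt (sesq_re_nonneg (hpos z hz) η),
    sesq_self_eq (hpos z hz)]

theorem energy_hermNorm (hpos : ∀ z ∈ D, (a z).PosDef) {x : Cn n × Cn n} (hx : x.1 ∈ D) :
    energy (hermNorm a) x = sesq (a x.1) x.2 x.2 := by
  rw [energy, Complex.ofReal_pow, hermNorm_sq hpos hx]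

theorem contDiffOn_sesq (ha : ∀ i j : Fin n, ContDiffOn ℝ ∞ (fun z => a z i j) D) :
    ContDiffOn ℝ ∞ (fun x : Cn n × Cn n => sesq (a x.1) x.2 x.2) (bundle D) := by
  unfold sesq
  exact ContDiffOn.sum fun i _ => ContDiffOn.sum fun j _ =>
    ((contDiffOn_fst_comp (ha i j)).mul (contDiffOn_snd_apply _ i)).mul
      (contDiffOn_star (contDiffOn_snd_apply _ j))

theorem hermNorm_smul (hpos : ∀ z ∈ D, (a z).PosDef) {z : Cn n} (hz : z ∈ D) (c : ℂ) (η : Cn n) :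
    hermNorm a z (c • η) = ‖c‖ * hermNorm a z η := by
  have e : sesq (a z) (c • η) (c • η) = ((‖c‖ ^ 2 * (sesq (a z) η η).re : ℝ) : ℂ) := by
    rw [sesq_smul_left, sesq_smul_right, Complex.ofReal_mul, sesq_self_eq (hpos z hz),
      ← Complex.normSq_eq_norm_sq, ← Complex.mul_conj]
    simp only [RCLike.star_def]; ring
  rw [hermNorm_eq, hermNorm_eq, e, Complex.ofReal_re, Real.sqrt_mul (sq_nonneg _),
    Real.sqrt_sq (norm_nonneg _)]

theorem conicOn_hermNorm (hD : IsOpen D)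
    (ha : ∀ i j : Fin n, ContDiffOn ℝ ∞ (fun z => a z i j) D)
    (hpos : ∀ z ∈ D, (a z).PosDef) : ConicOn (bundle D) (hermNorm a) where
  isOpen := isOpen_bundle hD
  smul_mem := fun _ hx _ _ => hx
  smooth := (contDiffOn_sesq ha).congr fun _ hx => energy_hermNorm hpos hx
  homog := fun _ hx c _ => hermNorm_smul hpos hx c _

theorem energyBar_hermNorm (hD : IsOpen D)
    (ha : ∀ i j : Fin n, ContDiffOn ℝ ∞ (fun z => a z i j) D)
    (hpos : ∀ z ∈ D, (a z).PosDef) {x : Cn n × Cn n} (hx : x ∈ bundle D) (m : Fin n) :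
    energyBar (hermNorm a) m x = sesq (a x.1) x.2 (basisVec m) := by
  have h1 := (HasWirt.sesq (hasWirt_matrix hD ha hx (0, basisVec m)) (hasWirt_snd x _)
    (hasWirt_snd x _)).congr (g := energy (hermNorm a)) (by
      filter_upwards [(isOpen_bundle hD).mem_nhds hx] with y hy using energy_hermNorm hpos hy)
  rw [energyBar, h1.dCbar_eq]
  have : dbarMat a x.1 0 = 0 := by ext i j; simp [dbarMat]
  simp [this]

theorem sesq_basisVec (m : Matrix (Fin n) (Fin n) ℂ) (i j : Fin n) :
    sesq m (basisVec i) (basisVec j) = m i j := by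
  simp [sesq, Pi.single_apply, apply_ite]

theorem fundTensor_hermNorm (hD : IsOpen D)
    (ha : ∀ i j : Fin n, ContDiffOn ℝ ∞ (fun z => a z i j) D)
    (hpos : ∀ z ∈ D, (a z).PosDef) {z : Cn n} (hz : z ∈ D) (η : Cn n) :
    fundTensor (hermNorm a) z η = a z := by
  ext i m
  have hx : (z, η) ∈ bundle D := hz
  have h1 := (HasWirt.sesq (hasWirt_matrix hD ha hx (0, basisVec i)) (hasWirt_snd (z, η) _)
    (hasWirt_const_vec (z, η) _ (basisVec m))).congr (g := energyBar (hermNorm a) m) (by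
      filter_upwards [(isOpen_bundle hD).mem_nhds hx] with y hy
      using energyBar_hermNorm hD ha hpos hy m)
  rw [(conicOn_hermNorm hD ha hpos).fundTensor_eq hx, h1.dC_eq]
  have : dMat a z 0 = 0 := by ext i j; simp [dMat]
  simp [this, sesq_basisVec]

theorem regularOn_hermNorm (hD : IsOpen D)
    (ha : ∀ i j : Fin n, ContDiffOn ℝ ∞ (fun z => a z i j) D)
    (hpos : ∀ z ∈ D, (a z).PosDef) : RegularOn (bundle D) (hermNorm a) where
  toConicOn := conicOn_hermNorm hD ha hpos
  det_ne_zero := fun x hx => by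
    rw [fundTensor_hermNorm hD ha hpos hx]; exact (hpos x.1 hx).det_pos.ne'

/-- The connection coefficients of a Hermitian metric. -/
def chernConn (a : Cn n → Matrix (Fin n) (Fin n) ℂ) (z : Cn n) (i k j : Fin n) : ℂ :=
  ∑ m, (a z)⁻¹ m i * dC (fun w => a w k m) z (basisVec j)

theorem connCoeff_hermNorm (hD : IsOpen D)
    (ha : ∀ i j : Fin n, ContDiffOn ℝ ∞ (fun z => a z i j) D)
    (hpos : ∀ z ∈ D, (a z).PosDef) {z : Cn n} (hz : z ∈ D) (η : Cn n) (i j : Fin n) :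
    connCoeff (hermNorm a) z η i j = ∑ k, chernConn a z i k j * η k := by
  have e : ∀ l m, del j (fun w => fundTensor (hermNorm a) w η l m) z
      = dC (fun w => a w l m) z (basisVec j) := by
    intro l m
    rw [del_eq_dC]
    have h1 := hasWirt (((ha l m).differentiableOn (by simp)).differentiableAt (hD.mem_nhds hz))
      (basisVec j)
    refine (h1.congr ?_).dC_eq
    filter_upwards [hD.mem_nhds hz] with w hw
    rw [fundTensor_hermNorm hD ha hpos hw]
  simp only [connCoeff, e, fundTensor_hermNorm hD ha hpos hz, chernConn, Finset.sum_mul]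
  exact Finset.sum_comm

theorem lower_chernConn (hpos : ∀ z ∈ D, (a z).PosDef) {z : Cn n} (hz : z ∈ D) (k m j : Fin n) :
    ∑ i, chernConn a z i k j * a z i m = dC (fun w => a w k m) z (basisVec j) := by
  have h := Matrix.nonsing_inv_mul (a z) (isUnit_iff_ne_zero.2 (hpos z hz).det_pos.ne')
  simp only [chernConn, Finset.sum_mul]
  rw [Finset.sum_comm]
  have : ∀ q, ∑ i, (a z)⁻¹ q i * dC (fun w => a w k q) z (basisVec j) * a z i m
      = (if q = m then 1 else 0) * dC (fun w => a w k q) z (basisVec j) := fun q => by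
    have := congrFun (congrFun h q) m
    rw [Matrix.mul_apply, Matrix.one_apply] at this
    rw [← this, Finset.sum_mul]
    exact Finset.sum_congr rfl fun _ _ => by ring
  simp [this]

end Herm

/-! ### Torsion and spray of a connection linear in the fibre. -/

section LinearConn

variable {F : Cn n → Cn n → ℝ} {z η : Cn n} {Γ : Fin n → Fin n → Fin n → ℂ}

theorem horCoeff_of_linear (h : ∀ᶠ ξ in 𝓝 η, ∀ i j, connCoeff F z ξ i j = ∑ k, Γ i k j * ξ k)
    (i j k : Fin n) : horCoeff F z η i j k = Γ i j k := by
  rw [horCoeff, del_eq_dC]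
  have h1 := (HasWirt.sum Finset.univ fun l _ =>
    (hasWirt_apply l η (basisVec j)).const_mul (Γ i l k))
  rw [(h1.congr (by filter_upwards [h] with ξ hξ using hξ i k)).dC_eq]
  simp [Pi.single_apply]

theorem thetaStar_of_symm (h : ∀ p j m, horCoeff F z η p j m = horCoeff F z η p m j) (k : Fin n) :
    thetaStar F z η k = 0 := by
  rw [thetaStar]
  refine Finset.sum_eq_zero fun m _ => Finset.sum_eq_zero fun h' _ => Finset.sum_eq_zero fun p _ =>
    Finset.sum_eq_zero fun j _ => ?_
  rw [h p j m]; simp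

theorem spray_of_linear (h : ∀ i j, connCoeff F z η i j = ∑ k, Γ i k j * η k) (i : Fin n) :
    spray F z η i = (1 / 2 : ℂ) * quad (Γ i) η := by
  simp only [spray, h, quad, Finset.sum_mul]
  rw [Finset.sum_comm]

end LinearConn

/-! ### Complex Randers metrics -/

section Randers

variable {D : Set (Cn n)} {a : Cn n → Matrix (Fin n) (Fin n) ℂ} {b : Cn n → Cn n}

/-- `α` as a complex valued function on the tangent bundle. -/
def alphaC (a : Cn n → Matrix (Fin n) (Fin n) ℂ) (x : Cn n × Cn n) : ℂ :=
  ((hermNorm a x.1 x.2 : ℝ) : ℂ)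

/-- `|β|` as a complex valued function on the tangent bundle. -/
def absBeta (b : Cn n → Cn n) (x : Cn n × Cn n) : ℂ := ((‖oneForm b x.1 x.2‖ : ℝ) : ℂ)

theorem contDiffOn_lin (hb : ContDiffOn ℝ ∞ b D) :
    ContDiffOn ℝ ∞ (fun x : Cn n × Cn n => lin (b x.1) x.2) (bundle D) := by
  unfold lin
  exact ContDiffOn.sum fun i _ =>
    (contDiffOn_fst_comp (contDiffOn_pi.1 hb i)).mul (contDiffOn_snd_apply _ i)

theorem isOpen_randersDomain (hD : IsOpen D) (hb : ContDiffOn ℝ ∞ b D) :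
    IsOpen (randersDomain D b) :=
  (contDiffOn_lin hb).continuousOn.isOpen_inter_preimage (isOpen_bundle hD) isOpen_ne

theorem snd_ne_zero {x : Cn n × Cn n} (hx : x ∈ randersDomain D b) : x.2 ≠ 0 := by
  intro h
  apply hx.2
  rw [h, oneForm_eq, lin_zero_right]

theorem energy_randers (a : Cn n → Matrix (Fin n) (Fin n) ℂ) (b : Cn n → Cn n)
    (x : Cn n × Cn n) : energy (randers a b) x = (alphaC a x + absBeta b x) ^ 2 := by
  simp [energy, randers, alphaC, absBeta]

theorem alphaC_sq (hpos : ∀ z ∈ D, (a z).PosDef) {x : Cn n × Cn n} (hx : x.1 ∈ D) :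
    alphaC a x ^ 2 = sesq (a x.1) x.2 x.2 := hermNorm_sq hpos hx x.2

theorem absBeta_sq (b : Cn n → Cn n) (x : Cn n × Cn n) :
    absBeta b x ^ 2 = lin (b x.1) x.2 * star (lin (b x.1) x.2) := by
  rw [absBeta, oneForm_eq, ← Complex.ofReal_pow, ← Complex.normSq_eq_norm_sq, ← Complex.mul_conj]
  rfl

theorem hermNorm_pos (hpos : ∀ z ∈ D, (a z).PosDef) {x : Cn n × Cn n}
    (hx : x ∈ randersDomain D b) : 0 < hermNorm a x.1 x.2 :=
  Real.sqrt_pos.2 (sesq_re_pos (hpos _ hx.1) (snd_ne_zero hx))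

theorem alphaC_ne_zero (hpos : ∀ z ∈ D, (a z).PosDef) {x : Cn n × Cn n}
    (hx : x ∈ randersDomain D b) : alphaC a x ≠ 0 :=
  Complex.ofReal_ne_zero.2 (hermNorm_pos hpos hx).ne'

theorem absBeta_ne_zero {x : Cn n × Cn n} (hx : x ∈ randersDomain D b) : absBeta b x ≠ 0 :=
  Complex.ofReal_ne_zero.2 (norm_ne_zero_iff.2 hx.2)

theorem alphaC_add_absBeta_ne_zero (hpos : ∀ z ∈ D, (a z).PosDef) {x : Cn n × Cn n}
    (hx : x ∈ randersDomain D b) : alphaC a x + absBeta b x ≠ 0 := by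
  rw [alphaC, absBeta, ← Complex.ofReal_add, Complex.ofReal_ne_zero]
  exact (add_pos (hermNorm_pos hpos hx) (norm_pos_iff.2 hx.2)).ne'

theorem contDiffOn_alphaC (ha : ∀ i j : Fin n, ContDiffOn ℝ ∞ (fun z => a z i j) D)
    (hpos : ∀ z ∈ D, (a z).PosDef) : ContDiffOn ℝ ∞ (alphaC a) (randersDomain D b) := by
  refine Complex.ofRealCLM.contDiff.comp_contDiffOn (ContDiffOn.sqrt
    (Complex.reCLM.contDiff.comp_contDiffOn ((contDiffOn_sesq ha).mono fun x hx => hx.1)) ?_)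
  exact fun x hx => (sesq_re_pos (hpos _ hx.1) (snd_ne_zero hx)).ne'

theorem contDiffOn_absBeta (hb : ContDiffOn ℝ ∞ b D) :
    ContDiffOn ℝ ∞ (absBeta b) (randersDomain D b) :=
  Complex.ofRealCLM.contDiff.comp_contDiffOn (ContDiffOn.norm ℝ
    ((contDiffOn_lin hb).mono fun _ hx => hx.1) fun _ hx => hx.2)

theorem conicOn_randers (hD : IsOpen D)
    (ha : ∀ i j : Fin n, ContDiffOn ℝ ∞ (fun z => a z i j) D)
    (hpos : ∀ z ∈ D, (a z).PosDef) (hb : ContDiffOn ℝ ∞ b D) :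
    ConicOn (randersDomain D b) (randers a b) where
  isOpen := isOpen_randersDomain hD hb
  smul_mem := fun _ hx _ hc => ⟨hx.1, by
    rw [oneForm_eq, lin_smul_right]; exact mul_ne_zero hc hx.2⟩
  smooth := (((contDiffOn_alphaC ha hpos).add (contDiffOn_absBeta hb)).pow 2).congr
    fun x _ => energy_randers a b x
  homog := fun _ hx _ _ => by
    rw [randers, randers, hermNorm_smul hpos hx.1, oneForm_eq, oneForm_eq, lin_smul_right,
      norm_mul, mul_add]

section Wirt

variable (hD : IsOpen D) (ha : ∀ i j : Fin n, ContDiffOn ℝ ∞ (fun z => a z i j) D)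
  (hpos : ∀ z ∈ D, (a z).PosDef) (hb : ContDiffOn ℝ ∞ b D) {x : Cn n × Cn n}
  (hx : x ∈ randersDomain D b) (V : Cn n × Cn n)

/-- The derivative of `a(η, η̄)`. -/
def dHerm (a : Cn n → Matrix (Fin n) (Fin n) ℂ) (x V : Cn n × Cn n) : ℂ :=
  sesq (dMat a x.1 V.1) x.2 x.2 + sesq (a x.1) V.2 x.2

/-- The derivative of `|β|²`. -/
def dBeta (b : Cn n → Cn n) (x V : Cn n × Cn n) : ℂ :=
  (lin (dVec b x.1 V.1) x.2 + lin (b x.1) V.2) * star (lin (b x.1) x.2)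
    + lin (b x.1) x.2 * star (lin (dbarVec b x.1 V.1) x.2)

include hD ha in
theorem hasWirt_herm (hx : x.1 ∈ D) : HasWirt (fun y : Cn n × Cn n => sesq (a y.1) y.2 y.2) x V
    (dHerm a x V) (sesq (dbarMat a x.1 V.1) x.2 x.2 + sesq (a x.1) x.2 V.2) :=
  (HasWirt.sesq (hasWirt_matrix hD ha hx V) (hasWirt_snd x V) (hasWirt_snd x V)).of_eq
    (by simp [dHerm]) (by simp)

include hD ha in
theorem hasWirt_herm_right (hx : x.1 ∈ D) (v : Cn n) :
    HasWirt (fun y : Cn n × Cn n => sesq (a y.1) y.2 v) x V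
    (sesq (dMat a x.1 V.1) x.2 v + sesq (a x.1) V.2 v) (sesq (dbarMat a x.1 V.1) x.2 v) :=
  (HasWirt.sesq (hasWirt_matrix hD ha hx V) (hasWirt_snd x V) (hasWirt_const_vec x V v)).of_eq
    (by simp) (by simp)

include hD ha in
theorem hasWirt_herm_left (hx : x.1 ∈ D) (v : Cn n) :
    HasWirt (fun y : Cn n × Cn n => sesq (a y.1) v y.2) x V
    (sesq (dMat a x.1 V.1) v x.2) (sesq (dbarMat a x.1 V.1) v x.2 + sesq (a x.1) v V.2) :=
  (HasWirt.sesq (hasWirt_matrix hD ha hx V) (hasWirt_const_vec x V v) (hasWirt_snd x V)).of_eq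
    (by simp) (by simp)

include hD hb in
theorem hasWirt_oneForm (hx : x.1 ∈ D) : HasWirt (fun y : Cn n × Cn n => lin (b y.1) y.2) x V
    (lin (dVec b x.1 V.1) x.2 + lin (b x.1) V.2) (lin (dbarVec b x.1 V.1) x.2) :=
  (HasWirt.lin (hasWirt_vector hD hb hx V) (hasWirt_snd x V)).of_eq rfl (by simp)

include hD hb in
theorem hasWirt_oneForm_const (hx : x.1 ∈ D) (v : Cn n) :
    HasWirt (fun y : Cn n × Cn n => lin (b y.1) v) x V
    (lin (dVec b x.1 V.1) v) (lin (dbarVec b x.1 V.1) v) :=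
  (HasWirt.lin (hasWirt_vector hD hb hx V) (hasWirt_const_vec x V v)).of_eq (by simp) (by simp)

include hD ha hpos hb hx in
theorem hasWirt_alphaC : HasWirt (alphaC a) x V (dHerm a x V / (2 * alphaC a x))
    ((sesq (dbarMat a x.1 V.1) x.2 x.2 + sesq (a x.1) x.2 V.2) / (2 * alphaC a x)) := by
  have hΩ := (isOpen_randersDomain hD hb).mem_nhds hx
  refine HasWirt.of_sq (((contDiffOn_alphaC ha hpos).differentiableOn
    (by simp)).differentiableAt hΩ) ?_ (hasWirt_herm hD ha V hx.1) (alphaC_ne_zero hpos hx)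
  filter_upwards [hΩ] with y hy using alphaC_sq hpos hy.1

include hD hb hx in
theorem hasWirt_absBeta : HasWirt (absBeta b) x V (dBeta b x V / (2 * absBeta b x))
    ((lin (dbarVec b x.1 V.1) x.2 * star (lin (b x.1) x.2) + lin (b x.1) x.2 *
      star (lin (dVec b x.1 V.1) x.2 + lin (b x.1) V.2)) / (2 * absBeta b x)) := by
  have hΩ := (isOpen_randersDomain hD hb).mem_nhds hx
  refine HasWirt.of_sq (((contDiffOn_absBeta hb).differentiableOn
    (by simp)).differentiableAt hΩ) ?_ ((hasWirt_oneForm hD hb V hx.1).mul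
      (hasWirt_oneForm hD hb V hx.1).conj) (absBeta_ne_zero hx)
  filter_upwards [hΩ] with y hy using absBeta_sq b y

include hD ha hpos hb hx in
theorem hasWirt_energy : HasWirt (energy (randers a b)) x V
    ((alphaC a x + absBeta b x) * (dHerm a x V / alphaC a x + dBeta b x V / absBeta b x))
    ((alphaC a x + absBeta b x) *
      ((sesq (dbarMat a x.1 V.1) x.2 x.2 + sesq (a x.1) x.2 V.2) / alphaC a x +
      (lin (dbarVec b x.1 V.1) x.2 * star (lin (b x.1) x.2) + lin (b x.1) x.2 *
      star (lin (dVec b x.1 V.1) x.2 + lin (b x.1) V.2)) / absBeta b x)) := by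
  have h1 := (hasWirt_alphaC hD ha hpos hb hx V).add (hasWirt_absBeta hD hb hx V)
  have e : energy (randers a b)
      = fun y => (alphaC a y + absBeta b y) * (alphaC a y + absBeta b y) := by
    ext y; rw [energy_randers, sq]
  have hα := alphaC_ne_zero hpos hx
  have hβ := absBeta_ne_zero hx
  rw [e]
  refine (h1.mul h1).of_eq ?_ ?_ <;> field_simp <;> ring

theorem dMat_zero (a : Cn n → Matrix (Fin n) (Fin n) ℂ) (z : Cn n) : dMat a z 0 = 0 := by
  ext; simp [dMat]

theorem dbarMat_zero (a : Cn n → Matrix (Fin n) (Fin n) ℂ) (z : Cn n) : dbarMat a z 0 = 0 := by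
  ext; simp [dbarMat]

theorem dVec_zero (b : Cn n → Cn n) (z : Cn n) : dVec b z 0 = 0 := by
  ext; simp [dVec]

theorem dbarVec_zero (b : Cn n → Cn n) (z : Cn n) : dbarVec b z 0 = 0 := by
  ext; simp [dbarVec]

include hD ha hpos hb hx in
theorem dCbar_energy_snd (v : Cn n) : dCbar (energy (randers a b)) x (0, v)
    = (alphaC a x + absBeta b x) * (sesq (a x.1) x.2 v / alphaC a x
      + lin (b x.1) x.2 * star (lin (b x.1) v) / absBeta b x) := by
  rw [(hasWirt_energy hD ha hpos hb hx (0, v)).dCbar_eq]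
  simp [dbarMat_zero, dVec_zero, dbarVec_zero]

include hD ha hpos hb hx in
theorem dC_energy_snd (v : Cn n) : dC (energy (randers a b)) x (0, v)
    = (alphaC a x + absBeta b x) * (sesq (a x.1) v x.2 / alphaC a x
      + lin (b x.1) v * star (lin (b x.1) x.2) / absBeta b x) := by
  rw [(hasWirt_energy hD ha hpos hb hx (0, v)).dC_eq]
  simp [dHerm, dBeta, dMat_zero, dVec_zero, dbarVec_zero]

include hD ha hpos hb hx in
theorem dC_dCbar_energy (v : Cn n) :
    dC (fun y => dCbar (energy (randers a b)) y (0, v)) x V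
      = (dHerm a x V / (2 * alphaC a x) + dBeta b x V / (2 * absBeta b x)) *
        (sesq (a x.1) x.2 v / alphaC a x
          + lin (b x.1) x.2 * star (lin (b x.1) v) / absBeta b x)
        + (alphaC a x + absBeta b x) * (((sesq (dMat a x.1 V.1) x.2 v + sesq (a x.1) V.2 v)
            * alphaC a x - sesq (a x.1) x.2 v * (dHerm a x V / (2 * alphaC a x)))
              / alphaC a x ^ 2
          + (((lin (dVec b x.1 V.1) x.2 + lin (b x.1) V.2) * star (lin (b x.1) v)
            + lin (b x.1) x.2 * star (lin (dbarVec b x.1 V.1) v)) * absBeta b x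
            - lin (b x.1) x.2 * star (lin (b x.1) v) * (dBeta b x V / (2 * absBeta b x)))
              / absBeta b x ^ 2) := by
  have hα := alphaC_ne_zero hpos hx
  have hβ := absBeta_ne_zero hx
  have wα := hasWirt_alphaC hD ha hpos hb hx V
  have wβ := hasWirt_absBeta hD hb hx V
  have w := (wα.add wβ).mul (((hasWirt_herm_right hD ha V hx.1 v).div wα hα).add
    (((hasWirt_oneForm hD hb V hx.1).mul (hasWirt_oneForm_const hD hb V hx.1 v).conj).div wβ hβ))
  refine (w.congr ?_).dC_eq
  filter_upwards [(isOpen_randersDomain hD hb).mem_nhds hx] with y hy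
  exact dCbar_energy_snd hD ha hpos hb hy v

include hD ha hpos hb hx in
theorem dC_dC_energy (v : Cn n) :
    dC (fun y => dC (energy (randers a b)) y (0, v)) x V
      = (dHerm a x V / (2 * alphaC a x) + dBeta b x V / (2 * absBeta b x)) *
        (sesq (a x.1) v x.2 / alphaC a x
          + lin (b x.1) v * star (lin (b x.1) x.2) / absBeta b x)
        + (alphaC a x + absBeta b x) * ((sesq (dMat a x.1 V.1) v x.2
            * alphaC a x - sesq (a x.1) v x.2 * (dHerm a x V / (2 * alphaC a x)))
              / alphaC a x ^ 2
          + ((lin (dVec b x.1 V.1) v * star (lin (b x.1) x.2)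
            + lin (b x.1) v * star (lin (dbarVec b x.1 V.1) x.2)) * absBeta b x
            - lin (b x.1) v * star (lin (b x.1) x.2) * (dBeta b x V / (2 * absBeta b x)))
              / absBeta b x ^ 2) := by
  have hα := alphaC_ne_zero hpos hx
  have hβ := absBeta_ne_zero hx
  have wα := hasWirt_alphaC hD ha hpos hb hx V
  have wβ := hasWirt_absBeta hD hb hx V
  have w := (wα.add wβ).mul (((hasWirt_herm_left hD ha V hx.1 v).div wα hα).add
    (((hasWirt_oneForm_const hD hb V hx.1 v).mul (hasWirt_oneForm hD hb V hx.1).conj).div wβ hβ))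
  refine (w.congr ?_).dC_eq
  filter_upwards [(isOpen_randersDomain hD hb).mem_nhds hx] with y hy
  exact dC_energy_snd hD ha hpos hb hy v

end Wirt

/-- Cauchy–Schwarz, from nonnegativity of the form on `a(u, u) v - a(v, u) u`, which is orthogonal
to `u`. -/
theorem normSq_sesq_le {m : Matrix (Fin n) (Fin n) ℂ} (hm : m.PosDef) {u : Cn n} (hu : u ≠ 0)
    (v : Cn n) : Complex.normSq (sesq m u v) ≤ (sesq m v v).re * (sesq m u u).re := by
  have hA := sesq_re_pos hm hu
  have h := sesq_re_nonneg hm (sesq m u u • v - sesq m v u • u)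
  have e : sesq m (sesq m u u • v - sesq m v u • u) (sesq m u u • v - sesq m v u • u)
      = (((sesq m u u).re * ((sesq m v v).re * (sesq m u u).re
        - Complex.normSq (sesq m u v)) : ℝ) : ℂ) := by
    have e1 : star (sesq m v u) = sesq m u v := sesq_star hm v u
    have e2 : star (sesq m u u) = sesq m u u := sesq_star hm u u
    have e3 : star (sesq m u v) = sesq m v u := sesq_star hm u v
    push_cast
    rw [sesq_self_eq hm, sesq_self_eq hm, ← Complex.mul_conj, ← RCLike.star_def, e3,
      sub_eq_add_neg, ← neg_smul]
    simp only [sesq_add_left, sesq_add_right, sesq_smul_left, sesq_smul_right, star_neg, e1, e2]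
    ring
  rw [e, Complex.ofReal_re] at h
  have := nonneg_of_mul_nonneg_right h hA
  linarith

/-- The Levi form of `F²` at `v` equals `½|w|² + F ((q - N/(2α²))/α + K/(2|β|))` with `q = a(v, v)`,
`N = |a(η, v)|²` and `K = |b(v)|²`. Cauchy–Schwarz gives `N ≤ q α²`, so it is positive for `v ≠ 0`,
without any bound on the size of `b`. -/
theorem regularOn_randers (hD : IsOpen D)
    (ha : ∀ i j : Fin n, ContDiffOn ℝ ∞ (fun z => a z i j) D)
    (hpos : ∀ z ∈ D, (a z).PosDef) (hb : ContDiffOn ℝ ∞ b D) :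
    RegularOn (randersDomain D b) (randers a b) where
  toConicOn := conicOn_randers hD ha hpos hb
  det_ne_zero := by
    intro x hx hdet
    have hC := conicOn_randers hD ha hpos hb
    -- A vector in the left kernel of a singular `g` would be a zero of the Levi form.
    obtain ⟨v, hv, hv0⟩ := Matrix.exists_vecMul_eq_zero_iff.2 hdet
    have h0 : dC (fun y => dCbar (energy (randers a b)) y (0, v)) x (0, v) = 0 := by
      have w := (HasWirt.sum Finset.univ fun m _ => (hasWirt (hC.diffAt (hC.smooth_bar m) hx)
        (0, v)).const_mul (star (v m))).congr
        (g := fun y => dCbar (energy (randers a b)) y (0, v))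
        (Eventually.of_forall fun y => dCbar_snd_eq_sum _ _ _)
      rw [w.dC_eq]
      refine Finset.sum_eq_zero fun m _ => ?_
      have := congrFun hv0 m
      simp only [Matrix.vecMul, dotProduct, hC.fundTensor_eq hx, Pi.zero_apply] at this
      rw [dC_snd_eq_sum, this, mul_zero]
    rw [dC_dCbar_energy hD ha hpos hb hx] at h0
    have hA := hermNorm_pos hpos hx
    have hB : 0 < ‖oneForm b x.1 x.2‖ := norm_pos_iff.2 hx.2
    have hA2 := alphaC_sq hpos hx.1 (a := a)
    have hB2 := absBeta_sq b x
    have hcs := normSq_sesq_le (hpos _ hx.1) (snd_ne_zero hx) v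
    have hq := sesq_re_pos (hpos _ hx.1) hv
    have hqe := sesq_self_eq (hpos _ hx.1) v
    have hst : sesq (a x.1) v x.2 = star (sesq (a x.1) x.2 v) := (sesq_star (hpos _ hx.1) _ _).symm
    have hAr : hermNorm a x.1 x.2 ^ 2 = (sesq (a x.1) x.2 x.2).re := by
      rw [hermNorm_eq, Real.sq_sqrt (sesq_re_nonneg (hpos _ hx.1) _)]
    rw [← hAr] at hcs
    have hα := alphaC_ne_zero hpos hx
    have hβ := absBeta_ne_zero hx
    set r := hermNorm a x.1 x.2
    set s := ‖oneForm b x.1 x.2‖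
    set q := (sesq (a x.1) v v).re
    set w : ℂ := sesq (a x.1) x.2 v / alphaC a x
      + lin (b x.1) x.2 * star (lin (b x.1) v) / absBeta b x with hw
    have hrα : alphaC a x = r := rfl
    have hsβ : absBeta b x = s := rfl
    set N := Complex.normSq (sesq (a x.1) x.2 v) with hN
    have hNe : (N : ℂ) = sesq (a x.1) x.2 v * star (sesq (a x.1) x.2 v) :=
      (Complex.mul_conj _).symm
    set K := Complex.normSq (lin (b x.1) v) with hK
    have hKe : (K : ℂ) = lin (b x.1) v * star (lin (b x.1) v) := (Complex.mul_conj _).symm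
    have hwe : (Complex.normSq w : ℂ) = w * star w := (Complex.mul_conj _).symm
    have hsα : star (alphaC a x) = alphaC a x := by simp [hrα]
    have hsβ' : star (absBeta b x) = absBeta b x := by simp [hsβ]
    have key : (((1 / 2) * Complex.normSq w + (r + s) * ((q - N / (2 * r ^ 2)) / r
        + K / (2 * s)) : ℝ) : ℂ) = 0 := by
      rw [← h0]
      push_cast
      rw [hwe, hNe, hKe, hqe, ← hrα, ← hsβ]
      simp only [dMat_zero, dVec_zero, dbarVec_zero, dHerm, dBeta, hst, sesq_zero_matrix,
        lin_zero_left, zero_add, star_zero, mul_zero, add_zero]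
      rw [hw]
      simp only [star_add, star_div₀, star_mul', star_star, hsα, hsβ']
      field_simp
      linear_combination -(alphaC a x ^ 3 * absBeta b x + alphaC a x ^ 4) *
        (lin (b x.1) v * star (lin (b x.1) v)) * hB2
    have key' := Complex.ofReal_eq_zero.1 key
    have h1 : 0 < q - N / (2 * r ^ 2) := by
      rw [sub_pos, div_lt_iff₀ (by positivity)]
      nlinarith [mul_pos hq (pow_pos hA 2)]
    have h2 := Complex.normSq_nonneg w
    have h3 : 0 ≤ K / (2 * s) := by
      have := Complex.normSq_nonneg (lin (b x.1) v); positivity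
    have h4 : 0 < (r + s) * ((q - N / (2 * r ^ 2)) / r + K / (2 * s)) := by positivity
    linarith

end Randers

/-! ### Projective relations with a torsion free metric -/

namespace RegularOn

variable {Ω : Set (Cn n × Cn n)} {F : Cn n → Cn n → ℝ} {x : Cn n × Cn n}

theorem dC_energy_horLift (h : RegularOn Ω F) (hx : x ∈ Ω) :
    dC (energy F) x (horLift F x) = 0 := by
  have h1 : HasWirt (fun y : Cn n × Cn n => ∑ m, star (y.2 m) * energyBar F m y) x
      (horLift F x) _ _ := HasWirt.sum _ fun m _ =>
    (hasWirt_snd_apply m x (horLift F x)).conj.mul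
      (hasWirt (h.diffAt (h.smooth_bar m) hx) (horLift F x))
  have h2 := h1.congr (g := energy F) (by
    filter_upwards [h.isOpen.mem_nhds hx] with y hy using (h.euler_bar hy).symm)
  rw [h2.dC_eq]
  simp [h.dC_bar_horLift hx]

variable {S : Cn n → Fin n → ℂ} {P : Cn n × Cn n → ℂ}

/-- A projective relation with a torsion free quadratic spray splits according to the weight of
its terms in the fibre variable. -/
theorem split_of_projective (h : RegularOn Ω F) (hx : x ∈ Ω) (hF : energy F x ≠ 0)
    (hS : ∀ i, S (Complex.I • x.2) i = - S x.2 i)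
    (hrel : ∀ y ∈ Ω, y.1 = x.1 → ∀ i, S y.2 i = spray F y.1 y.2 i
      - (1 / 2 : ℂ) * thetaStar F y.1 y.2 i + P y * y.2 i) :
    (∀ i, thetaStar F x.1 x.2 i = 0) ∧ ∀ i, S x.2 i = spray F x.1 x.2 i + P x * x.2 i := by
  have hI := h.smul_mem x hx Complex.I Complex.I_ne_zero
  -- The relations at `η` and `iη` are added: the sprays cancel and the two halves of `θ*` add up.
  -- `P` carries no homogeneity assumption, so its value at `iη` stays as an unknown.
  have e : ∀ i, thetaStar F x.1 x.2 i
      = (P x + P (x.1, Complex.I • x.2) * Complex.I) * x.2 i := by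
    intro i
    have h1 := hrel x hx rfl i
    have h2 := hrel _ hI rfl i
    have h3 := h.spray_hom i x hx Complex.I Complex.I_ne_zero
    have h4 := h.thetaStar_hom i x hx Complex.I Complex.I_ne_zero
    simp only [Complex.I_sq, RCLike.star_def, Complex.conj_I, mul_neg, Complex.I_mul_I, neg_neg,
      one_mul] at h3 h4
    simp only [hS, h3, h4, Pi.smul_apply, smul_eq_mul] at h2
    linear_combination h1 + h2
  -- Contracting with `∂F²/∂ηⁱ` kills `θ*` and turns `η` into `F² ≠ 0`.
  have h0 : P x + P (x.1, Complex.I • x.2) * Complex.I = 0 := by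
    have h1 := h.thetaStar_orthogonal hx
    simp only [e] at h1
    have h2 : (P x + P (x.1, Complex.I • x.2) * Complex.I) * energy F x = 0 := by
      rw [← h.euler_hol hx, ← h1, Finset.mul_sum]
      exact Finset.sum_congr rfl fun _ _ => by ring
    exact (mul_eq_zero.1 h2).resolve_right hF
  have hθ : ∀ i, thetaStar F x.1 x.2 i = 0 := fun i => by rw [e, h0, zero_mul]
  exact ⟨hθ, fun i => by rw [hrel x hx rfl i, hθ]; ring⟩

variable {p : ℂ} {s : Fin n → ℂ}

/-- A projective change of spray moves the lift of `η` by a multiple of the vertical Euler field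
`(0, η)`, whose action on homogeneous functions is known. -/
theorem horLift_eq (hs : ∀ i, s i = spray F x.1 x.2 i + p * x.2 i) :
    (x.2, -((2 : ℂ) • s)) = horLift F x + (-(2 * p)) • ((0, x.2) : Cn n × Cn n) := by
  refine Prod.ext ?_ ?_
  · simp [horLift]
  · ext i
    simp [horLift, hs]
    ring

/-- The horizontal lift contributes nothing, and the Euler field acts as the identity because the
weight of `∂F²/∂η̄ᵐ` is `c`. -/
theorem dC_energyBar_of_projective (h : RegularOn Ω F) (hx : x ∈ Ω)
    (hs : ∀ i, s i = spray F x.1 x.2 i + p * x.2 i) (m : Fin n) :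
    dC (energyBar F m) x (x.2, -((2 : ℂ) • s)) = -(2 * p) * energyBar F m x := by
  rw [horLift_eq hs, dC_add_right, dC_smul_right, h.dC_bar_horLift hx]
  have := ((h.bar_hom m).euler h.isOpen ((h.smooth_bar m).differentiableOn (by simp)) hx
    hasWirt_id).1
  rw [this]; ring

theorem dC_dCbar_of_projective (h : RegularOn Ω F) (hx : x ∈ Ω)
    (hs : ∀ i, s i = spray F x.1 x.2 i + p * x.2 i) (v : Cn n) :
    dC (fun y => dCbar (energy F) y (0, v)) x (x.2, -((2 : ℂ) • s))
      = -(2 * p) * dCbar (energy F) x (0, v) := by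
  have w := (HasWirt.sum Finset.univ fun m _ => (hasWirt (h.diffAt (h.smooth_bar m) hx)
    (x.2, -((2 : ℂ) • s))).const_mul (star (v m))).congr
    (g := fun y => dCbar (energy F) y (0, v)) (Eventually.of_forall fun y => dCbar_snd_eq_sum _ _ _)
  rw [w.dC_eq, dCbar_snd_eq_sum, Finset.mul_sum]
  refine Finset.sum_congr rfl fun m _ => ?_
  rw [h.dC_energyBar_of_projective hx hs, energyBar]; ring

theorem dC_energy_of_projective (h : RegularOn Ω F) (hx : x ∈ Ω)
    (hs : ∀ i, s i = spray F x.1 x.2 i + p * x.2 i) :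
    dC (energy F) x (x.2, -((2 : ℂ) • s)) = -(2 * p) * energy F x := by
  rw [horLift_eq hs, dC_add_right, dC_smul_right, h.dC_energy_horLift hx]
  have := (h.energy_hom.euler h.isOpen (h.smooth.differentiableOn (by simp)) hx
    hasWirt_mul_star).1
  rw [this]; ring

/-- Here the weight is `c̄`, so the Euler field contributes nothing and `p` drops out; `θ* = 0`
identifies the derivative along the horizontal lift. -/
theorem dC_energyHol_of_projective (h : RegularOn Ω F) (hx : x ∈ Ω)
    (hθ : ∀ i, thetaStar F x.1 x.2 i = 0)
    (hs : ∀ i, s i = spray F x.1 x.2 i + p * x.2 i) (m : Fin n) :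
    dC (energyHol F m) x (x.2, -((2 : ℂ) • s)) = dC (energy F) x (basisVec m, 0) := by
  rw [horLift_eq hs, dC_add_right, dC_smul_right, h.dC_hol_self hx, mul_zero, add_zero]
  have := h.lower_thetaStar_eq hx m
  simp only [hθ, mul_zero, Finset.sum_const_zero] at this
  have h2 := congrArg star this
  rw [star_star, star_zero] at h2
  linear_combination h2

end RegularOn

/-! ### The holomorphic part of the projective equation for a Randers metric. -/

section Randers

variable {D : Set (Cn n)} {a : Cn n → Matrix (Fin n) (Fin n) ℂ} {b : Cn n → Cn n}

/-- The covariant derivative of `a` with respect to the linear connection `Γ`. -/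
def covA (a : Cn n → Matrix (Fin n) (Fin n) ℂ) (Γ : Fin n → Fin n → Fin n → ℂ) (z : Cn n)
    (i j k : Fin n) : ℂ := dC (fun w => a w i j) z (basisVec k) - ∑ l, Γ l i k * a z l j

/-- The covariant derivative of `b` with respect to the linear connection `Γ`. -/
def covB (b : Cn n → Cn n) (Γ : Fin n → Fin n → Fin n → ℂ) (z : Cn n) (k j : Fin n) : ℂ :=
  dC (fun w => b w k) z (basisVec j) - ∑ l, Γ l k j * b z l

/-- The derivatives `∂b̄ₘ/∂zʲ`. -/
def conjB (b : Cn n → Cn n) (z : Cn n) : Matrix (Fin n) (Fin n) ℂ :=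
  fun j m => star (dCbar (fun w => b w m) z (basisVec j))

variable {Γ : Fin n → Fin n → Fin n → ℂ} {z : Cn n}

theorem dMat_apply_eq_sum (a : Cn n → Matrix (Fin n) (Fin n) ℂ) (z v : Cn n) (i j : Fin n) :
    dMat a z v i j = ∑ k, v k * dC (fun w => a w i j) z (basisVec k) := dC_eq_sum _ _ _

/-- The right side is the derivative of `a(η, v)`, for constant `v`, along the field `(η, -Γ(η,
η))`. Only the holomorphic index of `a` is corrected by `Γ`. -/
theorem tri_covA (η v : Cn n) : tri (covA a Γ z) η v
    = sesq (dMat a z η) η v + sesq (a z) (-fun i => quad (Γ i) η) v := by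
  simp only [tri, covA, sesq, dMat_apply_eq_sum, quad, Pi.neg_apply, sub_mul, Finset.sum_mul,
    Finset.mul_sum, mul_neg, neg_mul, Finset.sum_neg_distrib, Finset.sum_sub_distrib]
  rw [← sub_eq_add_neg]
  congr 1
  · refine Finset.sum_congr rfl fun i _ => ?_
    exact Finset.sum_congr rfl fun j _ => Finset.sum_congr rfl fun k _ => by ring
  · have e : ∀ i, ∑ j, ∑ k, ∑ l, Γ l i k * a z l j * η i * η k * star (v j)
        = ∑ l, ∑ j, ∑ k, a z l j * (Γ l i k * η i * η k) * star (v j) := by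
      intro i
      have : ∀ j, ∑ k, ∑ l, Γ l i k * a z l j * η i * η k * star (v j)
          = ∑ l, ∑ k, a z l j * (Γ l i k * η i * η k) * star (v j) := fun j => by
        rw [Finset.sum_comm]
        exact Finset.sum_congr rfl fun _ _ => Finset.sum_congr rfl fun _ _ => by ring
      simp only [this]
      exact Finset.sum_comm
    simp only [e]
    rw [Finset.sum_comm]
    refine Finset.sum_congr rfl fun l _ => ?_
    exact Finset.sum_comm

theorem dVec_apply_eq_sum (b : Cn n → Cn n) (z v : Cn n) (i : Fin n) :
    dVec b z v i = ∑ k, v k * dC (fun w => b w i) z (basisVec k) := dC_eq_sum _ _ _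

theorem quad_covB (η : Cn n) : quad (covB b Γ z) η
    = lin (dVec b z η) η + lin (b z) (-fun i => quad (Γ i) η) := by
  simp only [quad, covB, lin, dVec_apply_eq_sum, Pi.neg_apply, sub_mul, Finset.sum_mul,
    Finset.mul_sum, mul_neg, Finset.sum_neg_distrib, Finset.sum_sub_distrib]
  rw [← sub_eq_add_neg]
  congr 1
  · exact Finset.sum_congr rfl fun i _ => Finset.sum_congr rfl fun j _ => by ring
  · have : ∀ k, ∑ j, ∑ l, Γ l k j * b z l * η k * η j
        = ∑ l, ∑ j, b z l * (Γ l k j * η k * η j) := fun k => by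
      rw [Finset.sum_comm]
      exact Finset.sum_congr rfl fun _ _ => Finset.sum_congr rfl fun _ _ => by ring
    simp only [this]
    exact Finset.sum_comm

theorem dbarVec_apply_eq_sum (b : Cn n → Cn n) (z v : Cn n) (i : Fin n) :
    dbarVec b z v i = ∑ k, star (v k) * dCbar (fun w => b w i) z (basisVec k) := by
  rw [dbarVec]
  conv_lhs => rw [← sum_smul_basisVec v]
  simp only [dCbar_sum_right, dCbar_smul_right]

theorem sesq_conjB (η v : Cn n) : sesq (conjB b z) η v = star (lin (dbarVec b z η) v) := by
  simp only [sesq, conjB, lin, dbarVec_apply_eq_sum, star_sum, star_mul', Finset.sum_mul, star_star]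
  rw [Finset.sum_comm]
  exact Finset.sum_congr rfl fun _ _ => Finset.sum_congr rfl fun _ _ => by ring

theorem IsPoly.sesq_dMat {f g h : ℝ → Cn n} (hf : ∀ i, IsPoly fun t => f t i)
    (hg : ∀ i, IsPoly fun t => g t i) (hh : ∀ i, IsPoly fun t => star (h t i)) :
    IsPoly fun t => ComplexFinsler.sesq (dMat a z (f t)) (g t) (h t) := by
  simp only [ComplexFinsler.sesq, dMat_apply_eq_sum]
  exact IsPoly.sum _ fun i _ => IsPoly.sum _ fun j _ => ((IsPoly.sum _ fun k _ =>
    (hf k).mul (IsPoly.const _)).mul (hg i)).mul (hh j)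

theorem IsPoly.lin_dVec {f g : ℝ → Cn n} (hf : ∀ i, IsPoly fun t => f t i)
    (hg : ∀ i, IsPoly fun t => g t i) : IsPoly fun t => ComplexFinsler.lin (dVec b z (f t)) (g t) := by
  simp only [ComplexFinsler.lin, dVec_apply_eq_sum]
  exact IsPoly.sum _ fun i _ => (IsPoly.sum _ fun k _ => (hf k).mul (IsPoly.const _)).mul (hg i)

theorem IsPoly.star_lin_dbarVec {f g : ℝ → Cn n} (hf : ∀ i, IsPoly fun t => f t i)
    (hg : ∀ i, IsPoly fun t => star (g t i)) :
    IsPoly fun t => star (ComplexFinsler.lin (dbarVec b z (f t)) (g t)) := by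
  simp only [← sesq_conjB]
  exact IsPoly.sesq _ hf hg

variable (hn : 2 ≤ n) (hD : IsOpen D) (ha : ∀ i j : Fin n, ContDiffOn ℝ ∞ (fun z => a z i j) D)
  (hpos : ∀ z ∈ D, (a z).PosDef) (hb : ContDiffOn ℝ ∞ b D) (hz : z ∈ D)

include hn hD ha hpos hb hz in
/-- Consequences of the holomorphic part of the projective equation for a Randers metric. -/
theorem randers_holomorphic_part
    (h : ∀ η, lin (b z) η ≠ 0 → ∃ p : ℂ, ∀ i, (1 / 2 : ℂ) * quad (Γ i) η
      = spray (randers a b) z η i + p * η i) {η : Cn n} (hη : lin (b z) η ≠ 0) :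
    (∀ v, lin (b z) v = 0 → sesq (conjB b z) η v = 0) ∧
      (∀ ζ, sesq (a z) η η * tri (covA a Γ z) η ζ = tri (covA a Γ z) η η * sesq (a z) η ζ) ∧
      lin (b z) η * star (lin (b z) η) * tri (covA a Γ z) η η
        = sesq (a z) η η * (star (lin (b z) η) * quad (covB b Γ z) η
          + lin (b z) η * sesq (conjB b z) η η) := by
  refine conformal_of_projective hn (hpos z hz) (fun η v hη hv => ?_) hη
  obtain ⟨p, hp⟩ := h η hη
  have hx : (z, η) ∈ randersDomain D b := ⟨hz, hη⟩
  have hR := regularOn_randers hD ha hpos hb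
  have e1 := hR.dC_dCbar_of_projective hx hp v
  have e2 := hR.dC_energy_of_projective hx hp
  have hV : -((2 : ℂ) • fun i => (1 / 2 : ℂ) * quad (Γ i) η) = -fun i => quad (Γ i) η := by
    ext i; simp
  rw [hV] at e1 e2
  rw [(hasWirt_energy hD ha hpos hb hx _).dC_eq, energy_randers] at e2
  rw [dC_dCbar_energy hD ha hpos hb hx, dCbar_energy_snd hD ha hpos hb hx] at e1
  have hα := alphaC_ne_zero hpos hx
  have hβ := absBeta_ne_zero hx
  have hF := alphaC_add_absBeta_ne_zero hpos hx
  have hα2 := alphaC_sq hpos hx.1 (a := a)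
  have hβ2 := absBeta_sq b (z, η)
  have hδA : dHerm a (z, η) (η, -fun i => quad (Γ i) η) = tri (covA a Γ z) η η := by
    rw [tri_covA]; rfl
  have hδB : dBeta b (z, η) (η, -fun i => quad (Γ i) η)
      = star (lin (b z) η) * quad (covB b Γ z) η + lin (b z) η * sesq (conjB b z) η η := by
    rw [quad_covB, sesq_conjB, dBeta]; ring
  have hαe : ((√(sesq (a z) η η).re : ℝ) : ℂ) = alphaC a (z, η) := rfl
  have hβe : (‖lin (b z) η‖ : ℂ) = absBeta b (z, η) := rfl
  rw [hαe, hβe, ← hβ2]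
  simp only [hδA, hδB, hv, star_zero, mul_zero, zero_div, add_zero, ← tri_covA, ← sesq_conjB,
    zero_mul, sub_zero, zero_add] at e1 e2
  simp only at hα2
  rw [← hα2]
  generalize star (lin (b z) η) * quad (covB b Γ z) η + lin (b z) η * sesq (conjB b z) η η = Δ
    at e1 e2 ⊢
  generalize tri (covA a Γ z) η η = D' at e1 e2 ⊢
  generalize tri (covA a Γ z) η v = X at e1 e2 ⊢
  generalize lin (b z) η * sesq (conjB b z) η v = e at e1 e2 ⊢
  generalize sesq (a z) η v = s at e1 e2 ⊢
  generalize alphaC a (z, η) = α at *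
  generalize absBeta b (z, η) = c at *
  have e3 : D' / α + Δ / c = -(2 * p) * (α + c) := by
    apply mul_left_cancel₀ hF
    linear_combination e2
  -- The unknown `p` is eliminated between the equations for `∂F²/∂η̄` and for `F²`; clearing
  -- denominators leaves an expression of the form `E + αO`.
  have e4 : (D' / (2 * α) + Δ / (2 * c)) * (s / α) + (α + c) * ((X * α - s * (D' / (2 * α))) / α ^ 2
      + e * c / c ^ 2) = (D' / α + Δ / c) * (s / α) := by
    rw [e1, e3]; ring
  field_simp at e4
  linear_combination e4

end Randers

theorem exists_lin_ne_zero {b : Cn n} (hb : b ≠ 0) : ∃ v : Cn n, lin b v ≠ 0 := by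
  obtain ⟨i, hi⟩ := Function.ne_iff.1 hb
  exact ⟨basisVec i, by simpa [lin, Pi.single_apply] using hi⟩

/-- A function that is polynomial along real lines and vanishes off a hyperplane is zero. -/
theorem eq_zero_of_off_hyperplane {b : Cn n} (hb : b ≠ 0) {f : Cn n → ℂ}
    (hf : ∀ u v : Cn n, IsPoly fun t => f (u + (t : ℂ) • v))
    (h : ∀ η, lin b η ≠ 0 → f η = 0) (η : Cn n) : f η = 0 := by
  by_cases hη : lin b η = 0
  · obtain ⟨v, hv⟩ := exists_lin_ne_zero hb
    have := (hf η v).zero_of_ne fun t ht => h _ (by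
      rw [lin_add_right, lin_smul_right, hη, zero_add]
      exact mul_ne_zero (by exact_mod_cast ht) hv)
    simpa using this
  · exact h η hη

/-- Polarization with `u + v` and `u + iv`. -/
theorem matrix_eq_zero_of_sesq {W : Matrix (Fin n) (Fin n) ℂ} (h : ∀ η, sesq W η η = 0) :
    W = 0 := by
  have key : ∀ u v, sesq W u v = 0 := by
    intro u v
    have h1 : _ = (0 : ℂ) := h (u + v)
    have h2 : _ = (0 : ℂ) := h (u + Complex.I • v)
    have hu := h u
    have hv := h v
    clear h
    simp only [sesq_add_left, sesq_add_right, sesq_smul_left, sesq_smul_right, hu, hv, zero_add,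
      add_zero, mul_zero, RCLike.star_def, Complex.conj_I] at h1 h2
    have h3 : Complex.I * (sesq W v u - sesq W u v) = 0 := by linear_combination h2
    have h4 := (mul_eq_zero.1 h3).resolve_left Complex.I_ne_zero
    linear_combination (1 / 2) * h1 - (1 / 2) * h4
  ext i j
  rw [← sesq_basisVec W i j, key]; rfl

theorem sesq_left_injective {m : Matrix (Fin n) (Fin n) ℂ} (hm : m.PosDef) {u : Cn n}
    (h : ∀ ζ, sesq m u ζ = 0) : u = 0 := by
  by_contra hu
  exact (sesq_pos hm hu).ne' (h u)

/-! ### The projective factor, the Kähler condition and the spray of `a`. -/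

section Randers

variable {D : Set (Cn n)} {a : Cn n → Matrix (Fin n) (Fin n) ℂ} {b : Cn n → Cn n}
  {Γ : Fin n → Fin n → Fin n → ℂ} {z : Cn n}

variable (hn : 2 ≤ n) (hD : IsOpen D) (ha : ∀ i j : Fin n, ContDiffOn ℝ ∞ (fun z => a z i j) D)
  (hpos : ∀ z ∈ D, (a z).PosDef) (hb : ContDiffOn ℝ ∞ b D) (hz : z ∈ D)

include hn hD ha hpos hb hz in
-- By `randers_holomorphic_part`, `α²` and `|β|²` are multiplied by a common factor along `(η, -Γ(η,
-- η))`. Since `F²` is multiplied by `-2p`, that common factor is `-2p`.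
theorem projective_factor
    (h : ∀ η, lin (b z) η ≠ 0 → ∃ p : ℂ, ∀ i, (1 / 2 : ℂ) * quad (Γ i) η
      = spray (randers a b) z η i + p * η i) {η : Cn n} (hη : lin (b z) η ≠ 0) {p : ℂ}
    (hp : ∀ i, (1 / 2 : ℂ) * quad (Γ i) η = spray (randers a b) z η i + p * η i) :
    tri (covA a Γ z) η η = -(2 * p) * sesq (a z) η η ∧
      star (lin (b z) η) * quad (covB b Γ z) η + lin (b z) η * sesq (conjB b z) η η
        = -(2 * p) * (lin (b z) η * star (lin (b z) η)) := by
  have hx : (z, η) ∈ randersDomain D b := ⟨hz, hη⟩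
  have hR := regularOn_randers hD ha hpos hb
  have e2 := hR.dC_energy_of_projective hx hp
  have hV : -((2 : ℂ) • fun i => (1 / 2 : ℂ) * quad (Γ i) η) = -fun i => quad (Γ i) η := by
    ext i; simp
  rw [hV] at e2
  rw [(hasWirt_energy hD ha hpos hb hx _).dC_eq, energy_randers] at e2
  have e3 := (randers_holomorphic_part hn hD ha hpos hb hz h hη).2.2
  have hα := alphaC_ne_zero hpos hx
  have hβ := absBeta_ne_zero hx
  have hF := alphaC_add_absBeta_ne_zero hpos hx
  have hα2 := alphaC_sq hpos hx.1 (a := a)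
  have hβ2 := absBeta_sq b (z, η)
  have hδA : dHerm a (z, η) (η, -fun i => quad (Γ i) η) = tri (covA a Γ z) η η := by
    rw [tri_covA]; rfl
  have hδB : dBeta b (z, η) (η, -fun i => quad (Γ i) η)
      = star (lin (b z) η) * quad (covB b Γ z) η + lin (b z) η * sesq (conjB b z) η η := by
    rw [quad_covB, sesq_conjB, dBeta]; ring
  simp only at hα2
  rw [← hβ2, ← hα2] at e3
  rw [← hβ2, ← hα2]
  simp only [hδA, hδB] at e2
  generalize star (lin (b z) η) * quad (covB b Γ z) η + lin (b z) η * sesq (conjB b z) η η = Δ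
    at *
  generalize tri (covA a Γ z) η η = D' at *
  generalize alphaC a (z, η) = α at *
  generalize absBeta b (z, η) = c at *
  have e4 : D' / α + Δ / c = -(2 * p) * (α + c) := by
    apply mul_left_cancel₀ hF
    linear_combination e2
  have hΔ : Δ = c ^ 2 * D' / α ^ 2 := by
    field_simp; linear_combination -e3
  have h1 : D' = -(2 * p) * α ^ 2 := by
    rw [hΔ] at e4
    field_simp at e4
    linear_combination e4
  refine ⟨h1, ?_⟩
  rw [hΔ, h1]; field_simp

include hn hD ha hpos hb hz in
/-- Consequences of the torsion part of the projective equation for a Randers metric. -/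
theorem randers_torsion_part
    (h : ∀ η, lin (b z) η ≠ 0 → ∃ p : ℂ, ∀ i, (1 / 2 : ℂ) * quad (Γ i) η
      = spray (randers a b) z η i + p * η i)
    (hθ : ∀ η, lin (b z) η ≠ 0 → ∀ i, thetaStar (randers a b) z η i = 0)
    {η : Cn n} (hη : lin (b z) η ≠ 0) (m : Fin n) :
    sesq (dMat a z (basisVec m)) η η - sesq (dMat a z η) (basisVec m) η = 0 ∧
      lin (dVec b z (basisVec m)) η * star (lin (b z) η)
        + lin (b z) η * star (lin (dbarVec b z (basisVec m)) η)
        - (lin (dVec b z η) (basisVec m) * star (lin (b z) η)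
        + lin (b z) (basisVec m) * star (lin (dbarVec b z η) η)) = 0 := by
  obtain ⟨v, hv0, hv⟩ := exists_ne_zero_lin_eq_zero hn (b z)
  have hl := fun i => IsPoly.line η v i
  have hs := fun i => IsPoly.star_line η v i
  have hc : ∀ (w : Cn n) (i : Fin n), IsPoly fun _ : ℝ => w i := fun w i => IsPoly.const _
  -- After clearing denominators the terms from `a` carry the factor `|β|`, constant on the slice,
  -- and the terms from `b` carry the irrational factor `α`.
  have key := eq_zero_of_hermNorm (hpos z hz) (b := b z)
    (E := fun ξ => absBeta b (z, η) *
      (sesq (dMat a z (basisVec m)) ξ ξ - sesq (dMat a z ξ) (basisVec m) ξ))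
    (O := fun ξ => lin (dVec b z (basisVec m)) ξ * star (lin (b z) ξ)
        + lin (b z) ξ * star (lin (dbarVec b z (basisVec m)) ξ)
        - (lin (dVec b z ξ) (basisVec m) * star (lin (b z) ξ)
        + lin (b z) (basisVec m) * star (lin (dbarVec b z ξ) ξ))) hη hv0 hv ?_ ?_ ?_
  · exact ⟨(mul_eq_zero.1 key.1).resolve_left (absBeta_ne_zero (D := D) ⟨hz, hη⟩), key.2⟩
  · exact (IsPoly.const _).mul ((IsPoly.sesq _ hl hs).sub (IsPoly.sesq_dMat hl (hc _) hs))
  · exact (((IsPoly.lin _ hl).mul (IsPoly.star_lin _ hs)).add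
      ((IsPoly.lin _ hl).mul (IsPoly.star_lin _ hs))).sub
      (((IsPoly.lin_dVec hl (hc _)).mul (IsPoly.star_lin _ hs)).add
      ((IsPoly.const _).mul (IsPoly.star_lin_dbarVec hl hs)))
  intro ξ hξη
  have hξ : lin (b z) ξ ≠ 0 := by rwa [hξη]
  have hβη : absBeta b (z, η) = absBeta b (z, ξ) := by
    simp only [absBeta, oneForm_eq, hξη]
  rw [hβη]
  obtain ⟨p, hp⟩ := h ξ hξ
  have hx : (z, ξ) ∈ randersDomain D b := ⟨hz, hξ⟩
  have hR := regularOn_randers hD ha hpos hb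
  have e1 := hR.dC_energyHol_of_projective hx (hθ ξ hξ) hp m
  have hV : -((2 : ℂ) • fun i => (1 / 2 : ℂ) * quad (Γ i) ξ) = -fun i => quad (Γ i) ξ := by
    ext i; simp
  rw [hV] at e1
  have e2 : dC (energyHol (randers a b) m) (z, ξ) (ξ, -fun i => quad (Γ i) ξ) = _ :=
    dC_dC_energy hD ha hpos hb hx (ξ, -fun i => quad (Γ i) ξ) (basisVec m)
  rw [e2, (hasWirt_energy hD ha hpos hb hx _).dC_eq] at e1
  obtain ⟨f1, f2⟩ := projective_factor hn hD ha hpos hb hz h hξ hp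
  have hα := alphaC_ne_zero hpos hx
  have hβ := absBeta_ne_zero hx
  have hF := alphaC_add_absBeta_ne_zero hpos hx
  have hα2 := alphaC_sq hpos hx.1 (a := a)
  have hβ2 := absBeta_sq b (z, ξ)
  have hδA : dHerm a (z, ξ) (ξ, -fun i => quad (Γ i) ξ) = tri (covA a Γ z) ξ ξ := by
    rw [tri_covA]; rfl
  have hδB : dBeta b (z, ξ) (ξ, -fun i => quad (Γ i) ξ)
      = star (lin (b z) ξ) * quad (covB b Γ z) ξ + lin (b z) ξ * sesq (conjB b z) ξ ξ := by
    rw [quad_covB, sesq_conjB, dBeta]; ring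
  have hmA : dHerm a (z, ξ) (basisVec m, 0) = sesq (dMat a z (basisVec m)) ξ ξ := by
    simp [dHerm]
  have hmB : dBeta b (z, ξ) (basisVec m, 0) = lin (dVec b z (basisVec m)) ξ * star (lin (b z) ξ)
        + lin (b z) ξ * star (lin (dbarVec b z (basisVec m)) ξ) := by
    simp [dBeta]
  have hαe : ((√(sesq (a z) ξ ξ).re : ℝ) : ℂ) = alphaC a (z, ξ) := rfl
  rw [hαe]
  rw [hδA, hδB, hmA, hmB, f1, f2] at e1
  simp only at hα2 e1
  rw [← hα2, ← hβ2] at e1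
  generalize sesq (dMat a z (basisVec m)) ξ ξ = X1 at *
  generalize sesq (dMat a z ξ) (basisVec m) ξ = X2 at *
  generalize lin (dVec b z (basisVec m)) ξ * star (lin (b z) ξ)
        + lin (b z) ξ * star (lin (dbarVec b z (basisVec m)) ξ) = X3 at *
  generalize lin (dVec b z ξ) (basisVec m) * star (lin (b z) ξ)
        + lin (b z) (basisVec m) * star (lin (dbarVec b z ξ) ξ) = X4 at *
  generalize lin (b z) (basisVec m) * star (lin (b z) ξ) = X5 at *
  generalize sesq (a z) (basisVec m) ξ = X6 at *
  generalize alphaC a (z, ξ) = α at *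
  generalize absBeta b (z, ξ) = c at *
  -- The terms in `p` cancel once the derivatives of `α²` and `|β|²` are replaced by their multiples
  -- from `projective_factor`.
  have e3 : (α + c) * ((X2 / α + X4 / c) - (X1 / α + X3 / c)) = 0 := by
    rw [mul_sub, ← e1]
    field_simp
    ring
  have e4 := (mul_eq_zero.1 e3).resolve_left hF
  field_simp at e4
  linear_combination -e4

include hn hD ha hpos hb hz in
-- The torsion of `a`, viewed as a sesquilinear form in `η`, vanishes off the hyperplane `ker b`,
-- hence everywhere, hence as a matrix by polarization.
theorem kaehler_of_projective (hb0 : b z ≠ 0)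
    (h : ∀ η, lin (b z) η ≠ 0 → ∃ p : ℂ, ∀ i, (1 / 2 : ℂ) * quad (Γ i) η
      = spray (randers a b) z η i + p * η i)
    (hθ : ∀ η, lin (b z) η ≠ 0 → ∀ i, thetaStar (randers a b) z η i = 0) (j k m : Fin n) :
    dC (fun w => a w j k) z (basisVec m) = dC (fun w => a w m k) z (basisVec j) := by
  have e : ∀ η, sesq (fun j k => dC (fun w => a w j k) z (basisVec m)
      - dC (fun w => a w m k) z (basisVec j)) η η
      = sesq (dMat a z (basisVec m)) η η - sesq (dMat a z η) (basisVec m) η := by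
    intro η
    have e1 : sesq (dMat a z η) (basisVec m) η
        = ∑ k, ∑ j, dC (fun w => a w m k) z (basisVec j) * η j * star (η k) := by
      simp only [sesq, Pi.single_apply, mul_ite, mul_one, mul_zero, ite_mul, zero_mul]
      rw [Finset.sum_comm]
      refine Finset.sum_congr rfl fun k _ => ?_
      rw [Finset.sum_ite_eq' Finset.univ m, if_pos (Finset.mem_univ m), dMat_apply_eq_sum,
        Finset.sum_mul]
      exact Finset.sum_congr rfl fun j _ => by ring
    rw [e1, Finset.sum_comm]
    simp only [sesq, sub_mul, Finset.sum_sub_distrib, dMat]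
  have key : (fun j k => dC (fun w => a w j k) z (basisVec m)
      - dC (fun w => a w m k) z (basisVec j) : Matrix (Fin n) (Fin n) ℂ) = 0 := by
    refine matrix_eq_zero_of_sesq fun η => eq_zero_of_off_hyperplane hb0
      (f := fun η => sesq (fun j k => dC (fun w => a w j k) z (basisVec m)
      - dC (fun w => a w m k) z (basisVec j)) η η) (fun u v => ?_) (fun η hη => ?_) η
    · exact IsPoly.sesq _ (fun i => IsPoly.line u v i) (fun i => IsPoly.star_line u v i)
    · rw [e]; exact (randers_torsion_part hn hD ha hpos hb hz h hθ hη m).1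
  exact sub_eq_zero.1 (congrFun (congrFun key j) k)

include hpos hz in
-- The Chern connection is compatible with `a`. Consequently the covariant derivative of `a` for `Γ`
-- measures the difference between the Chern connection and `Γ`.
theorem sesq_chernConn (η ζ : Cn n) :
    sesq (a z) (fun i => quad (chernConn a z i) η) ζ = sesq (dMat a z η) η ζ := by
  have e : ∀ k j, ∑ i, ∑ l, chernConn a z i k l * a z i j * η k * η l
      = dMat a z η k j * η k := by
    intro k j
    rw [Finset.sum_comm, dMat_apply_eq_sum, Finset.sum_mul]
    refine Finset.sum_congr rfl fun l _ => ?_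
    rw [← lower_chernConn hpos hz, Finset.mul_sum, Finset.sum_mul]
    exact Finset.sum_congr rfl fun _ _ => by ring
  simp only [sesq, ← e, quad, Finset.mul_sum, Finset.sum_mul]
  rw [Finset.sum_comm]
  conv_rhs => rw [Finset.sum_comm]
  refine Finset.sum_congr rfl fun j _ => ?_
  rw [Finset.sum_comm]
  exact Finset.sum_congr rfl fun _ _ => Finset.sum_congr rfl fun _ _ =>
    Finset.sum_congr rfl fun _ _ => by ring

include hn hD ha hpos hb hz in
/-- The spray of `a` is projectively equivalent to the given linear connection. -/
theorem spray_parallel_of_projective (hb0 : b z ≠ 0)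
    (h : ∀ η, lin (b z) η ≠ 0 → ∃ p : ℂ, ∀ i, (1 / 2 : ℂ) * quad (Γ i) η
      = spray (randers a b) z η i + p * η i) {η : Cn n} (hη : η ≠ 0) (i : Fin n) :
    quad (chernConn a z i) η - quad (Γ i) η
      = tri (covA a Γ z) η η / sesq (a z) η η * η i := by
  have h1 : ∀ η ζ, sesq (a z) η η * tri (covA a Γ z) η ζ
      - tri (covA a Γ z) η η * sesq (a z) η ζ = 0 := by
    intro η ζ
    refine eq_zero_of_off_hyperplane hb0 (f := fun η => sesq (a z) η η * tri (covA a Γ z) η ζ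
      - tri (covA a Γ z) η η * sesq (a z) η ζ) (fun u v => ?_) (fun η hη => ?_) η
    · have hl := fun i => IsPoly.line u v i
      have hs := fun i => IsPoly.star_line u v i
      have hc : ∀ i, IsPoly fun _ : ℝ => star (ζ i) := fun i => IsPoly.const _
      exact ((IsPoly.sesq _ hl hs).mul (IsPoly.tri _ hl hc)).sub
        ((IsPoly.tri _ hl hs).mul (IsPoly.sesq _ hl hc))
    · exact sub_eq_zero.2 ((randers_holomorphic_part hn hD ha hpos hb hz h hη).2.1 ζ)
  have hA : sesq (a z) η η ≠ 0 := (sesq_pos (hpos z hz) hη).ne'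
  have h2 : (fun i => quad (chernConn a z i) η) + (-fun i => quad (Γ i) η)
      + (-(tri (covA a Γ z) η η / sesq (a z) η η)) • η = 0 := by
    refine sesq_left_injective (hpos z hz) fun ζ => ?_
    rw [sesq_add_left, sesq_add_left, sesq_smul_left, sesq_chernConn hpos hz, ← tri_covA]
    have := h1 η ζ
    field_simp
    linear_combination this
  have := congrFun h2 i
  simp only [Pi.add_apply, Pi.neg_apply, Pi.smul_apply, smul_eq_mul, Pi.zero_apply] at this
  linear_combination this

end Randers

/-! ### Projective relations -/

namespace ProjRelated

variable {Ω Ω' : Set (Cn n × Cn n)} {F₁ F₂ F₃ : Cn n → Cn n → ℝ}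

theorem mono (h : ProjRelated Ω F₁ F₂) (hΩ : Ω' ⊆ Ω) : ProjRelated Ω' F₁ F₂ := by
  obtain ⟨P, hP, h⟩ := h
  exact ⟨P, hP.mono hΩ, fun z η hx => h z η (hΩ hx)⟩

theorem symm (h : ProjRelated Ω F₁ F₂) : ProjRelated Ω F₂ F₁ := by
  obtain ⟨P, hP, h⟩ := h
  refine ⟨fun x => -P x, hP.neg, fun z η hx i => ?_⟩
  linear_combination -h z η hx i

theorem trans (h : ProjRelated Ω F₁ F₂) (h' : ProjRelated Ω F₂ F₃) : ProjRelated Ω F₁ F₃ := by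
  obtain ⟨P, hP, h⟩ := h
  obtain ⟨Q, hQ, h'⟩ := h'
  refine ⟨fun x => P x + Q x, hP.add hQ, fun z η hx i => ?_⟩
  linear_combination h z η hx i + h' z η hx i

end ProjRelated

theorem quad_smul (S : Fin n → Fin n → ℂ) (c : ℂ) (u : Cn n) :
    quad S (c • u) = c ^ 2 * quad S u := by
  simp only [quad, Pi.smul_apply, smul_eq_mul, Finset.mul_sum]
  exact Finset.sum_congr rfl fun _ _ => Finset.sum_congr rfl fun _ _ => by ring

theorem randersDomain_subset_slit (D : Set (Cn n)) (b : Cn n → Cn n) :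
    randersDomain D b ⊆ slit D := fun _ hx => ⟨hx.1, snd_ne_zero hx⟩

/-- A holomorphic symmetric linear connection over `U` whose geodesic coefficients are those of
`M`. -/
structure IsFlatModel (U : Set (Cn n)) (Γ : Cn n → Fin n → Fin n → Fin n → ℂ)
    (M : Cn n → Cn n → ℝ) : Prop where
  holo : ∀ i j k, DifferentiableOn ℂ (fun z => Γ z i j k) U
  symm : ∀ z ∈ U, ∀ i j k, Γ z i j k = Γ z i k j
  spray_eq : ∀ z ∈ U, ∀ η, η ≠ 0 → ∀ i, spray M z η i = (1 / 2 : ℂ) * quad (Γ z i) η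
  thetaStar_eq : ∀ z ∈ U, ∀ η, η ≠ 0 → ∀ i, thetaStar M z η i = 0

theorem IsLocallyMinkowski.exists_flatModel {D : Set (Cn n)} (hD : IsOpen D)
    {M : Cn n → Cn n → ℝ} (hM : IsFinslerMetric D M) (h : IsLocallyMinkowski D M) {p : Cn n}
    (hp : p ∈ D) : ∃ U, IsOpen U ∧ p ∈ U ∧ U ⊆ D ∧ ∃ Γ, IsFlatModel U Γ M := by
  obtain ⟨U, hU, hpU, hUD, Γ, hΓ, hs, hc⟩ := h.exists_conn hD hM hp
  refine ⟨U, hU, hpU, hUD, Γ, hΓ, hs, fun z hz η hη i => spray_of_linear (hc z hz η hη) i,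
    fun z hz η hη i => thetaStar_of_symm (fun q j m => ?_) i⟩
  have : ∀ᶠ ξ in 𝓝 η, ∀ i j, connCoeff M z ξ i j = ∑ k, Γ z i k j * ξ k := by
    filter_upwards [isOpen_ne.mem_nhds hη] with ξ hξ using hc z hz ξ hξ
  rw [horCoeff_of_linear this, horCoeff_of_linear this, hs z hz]

/-! ### From a flat model of the Randers metric to one of its Hermitian part. -/

section Randers

variable {D U : Set (Cn n)} {a : Cn n → Matrix (Fin n) (Fin n) ℂ} {b : Cn n → Cn n}
  {Γ : Cn n → Fin n → Fin n → Fin n → ℂ} {z : Cn n} {M : Cn n → Cn n → ℝ}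

theorem spray_hermNorm (hD : IsOpen D) (ha : ∀ i j : Fin n, ContDiffOn ℝ ∞ (fun z => a z i j) D)
    (hpos : ∀ z ∈ D, (a z).PosDef) (hz : z ∈ D) (η : Cn n) (i : Fin n) :
    spray (hermNorm a) z η i = (1 / 2 : ℂ) * quad (chernConn a z i) η :=
  spray_of_linear (connCoeff_hermNorm hD ha hpos hz η) i

theorem thetaStar_hermNorm (hD : IsOpen D)
    (ha : ∀ i j : Fin n, ContDiffOn ℝ ∞ (fun z => a z i j) D)
    (hpos : ∀ z ∈ D, (a z).PosDef) (hz : z ∈ D)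
    (hs : ∀ i j k, chernConn a z i j k = chernConn a z i k j) (η : Cn n) (i : Fin n) :
    thetaStar (hermNorm a) z η i = 0 := by
  refine thetaStar_of_symm (fun q j m => ?_) i
  have : ∀ᶠ ξ in 𝓝 η, ∀ i j, connCoeff (hermNorm a) z ξ i j = ∑ k, chernConn a z i k j * ξ k :=
    Eventually.of_forall fun ξ => connCoeff_hermNorm hD ha hpos hz ξ
  rw [horCoeff_of_linear this, horCoeff_of_linear this, hs]

variable (hD : IsOpen D) (ha : ∀ i j : Fin n, ContDiffOn ℝ ∞ (fun z => a z i j) D)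
  (hpos : ∀ z ∈ D, (a z).PosDef) (hb : ContDiffOn ℝ ∞ b D)

include hD ha hpos hb in
-- `M` enters only through `½ Γ(η, η)` because its `θ*` vanishes; this term changes sign under `η ↦
-- iη`, as the weight splitting requires.
theorem ProjRelated.randers_split (hUD : U ⊆ D)
    (hΓ : IsFlatModel U Γ M) (hrel : ProjRelated (randersDomain D b) (randers a b) M)
    (hz : z ∈ U) {η : Cn n} (hη : lin (b z) η ≠ 0) :
    (∃ p : ℂ, ∀ i, (1 / 2 : ℂ) * quad (Γ z i) η = spray (randers a b) z η i + p * η i) ∧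
      ∀ i, thetaStar (randers a b) z η i = 0 := by
  obtain ⟨P, -, hP⟩ := hrel
  have hx : (z, η) ∈ randersDomain D b := ⟨hUD hz, hη⟩
  have hF : energy (randers a b) (z, η) ≠ 0 := by
    rw [energy_randers]
    exact pow_ne_zero 2 (alphaC_add_absBeta_ne_zero hpos hx)
  have key := (regularOn_randers hD ha hpos hb).split_of_projective hx hF
    (S := fun ξ i => (1 / 2 : ℂ) * quad (Γ z i) ξ) (P := P)
    (fun i => by simp only [quad_smul, Complex.I_sq]; ring) (fun y hy hyz i => ?_)
  · exact ⟨⟨P (z, η), key.2⟩, key.1⟩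
  · obtain ⟨w, ξ⟩ := y
    obtain rfl : w = z := hyz
    have hξ : ξ ≠ 0 := snd_ne_zero hy
    have := hP w ξ hy i
    rw [hΓ.spray_eq w hz ξ hξ, hΓ.thetaStar_eq w hz ξ hξ] at this
    linear_combination this

include hD ha hpos hb in
theorem chernConn_symm_of_projective (hb0 : b z ≠ 0) (hUD : U ⊆ D) (hΓ : IsFlatModel U Γ M)
    (hrel : ProjRelated (randersDomain D b) (randers a b) M) (hz : z ∈ U) (i j k : Fin n) :
    chernConn a z i j k = chernConn a z i k j := by
  rcases lt_or_ge n 2 with hn | hn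
  · have : Subsingleton (Fin n) := Fin.subsingleton_iff_le_one.2 (by omega)
    rw [Subsingleton.elim j k]
  · exact Finset.sum_congr rfl fun m _ => by
      rw [kaehler_of_projective hn hD ha hpos hb (hUD hz) hb0
        (fun η hη => (hrel.randers_split hD ha hpos hb hUD hΓ hz hη).1)
        (fun η hη => (hrel.randers_split hD ha hpos hb hUD hΓ hz hη).2)]

include hD ha hpos hb in
theorem exists_spray_parallel (hb0 : b z ≠ 0) (hUD : U ⊆ D) (hΓ : IsFlatModel U Γ M)
    (hrel : ProjRelated (randersDomain D b) (randers a b) M) (hz : z ∈ U) {η : Cn n}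
    (hη : η ≠ 0) :
    ∃ q : ℂ, ∀ i, quad (chernConn a z i) η - quad (Γ z i) η = q * η i := by
  rcases lt_or_ge n 2 with hn | hn
  · have : Subsingleton (Fin n) := Fin.subsingleton_iff_le_one.2 (by omega)
    obtain ⟨j, hj⟩ := Function.ne_iff.1 hη
    refine ⟨(quad (chernConn a z j) η - quad (Γ z j) η) / η j, fun i => ?_⟩
    rw [Subsingleton.elim i j, div_mul_cancel₀ _ hj]
  · exact ⟨_, fun i => spray_parallel_of_projective hn hD ha hpos hb (hUD hz) hb0
      (fun η hη => (hrel.randers_split hD ha hpos hb hUD hΓ hz hη).1) hη i⟩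

include hD ha hpos hb in
/-- A locally Minkowski metric projectively related to a Randers metric is projectively related to
the underlying Hermitian metric. -/
theorem ProjRelated.hermNorm_of_randers (hb0 : ∀ z ∈ D, b z ≠ 0) (hM : IsFinslerMetric D M)
    (hL : IsLocallyMinkowski D M)
    (hrel : ProjRelated (randersDomain D b) (randers a b) M) :
    ProjRelated (slit D) (hermNorm a) M := by
  have hsub : slit D ⊆ bundle D := fun x hx => hx.1
  have hne : ∀ x ∈ slit D, ∑ i, x.2 i * star (x.2 i) ≠ 0 := by
    intro x hx h0
    refine hx.2 (funext fun j => ?_)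
    have h1 : ∑ i, ‖x.2 i‖ ^ 2 = 0 := by
      have : ((∑ i, ‖x.2 i‖ ^ 2 : ℝ) : ℂ) = 0 := by
        rw [← h0, Complex.ofReal_sum]
        refine Finset.sum_congr rfl fun i _ => ?_
        rw [← Complex.normSq_eq_norm_sq, ← Complex.mul_conj]; rfl
      exact_mod_cast this
    simpa using (Finset.sum_eq_zero_iff_of_nonneg fun i _ => sq_nonneg ‖x.2 i‖).1 h1 j
      (Finset.mem_univ j)
  -- The coefficient of `η` in the difference of sprays is read off by projecting with the standard
  -- Hermitian product. This formula is global and smooth, whereas `Γ` and the factor `q` are only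
  -- local.
  refine ⟨fun x => (∑ i, (spray M x.1 x.2 i - spray (hermNorm a) x.1 x.2 i) * star (x.2 i))
    / ∑ i, x.2 i * star (x.2 i), ?_, fun z η hx i => ?_⟩
  · simp only [div_eq_mul_inv]
    refine (ContDiffOn.sum fun i _ => ?_).mul ((ContDiffOn.sum fun i _ => ?_).inv hne)
    · exact (((hM.regularOn hD).smooth_spray i).sub
        (((regularOn_hermNorm hD ha hpos).smooth_spray i).mono hsub)).mul
        (contDiffOn_star (contDiffOn_snd_apply _ i))
    · exact (contDiffOn_snd_apply _ i).mul (contDiffOn_star (contDiffOn_snd_apply _ i))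
  · obtain ⟨U, -, hzU, hUD, Γ, hΓ⟩ := hL.exists_flatModel hD hM hx.1
    have hη : η ≠ 0 := hx.2
    obtain ⟨q, hq⟩ := exists_spray_parallel hD ha hpos hb (hb0 z hx.1) hUD hΓ hrel hzU hη
    have e : ∀ i, spray M z η i - spray (hermNorm a) z η i = -(q / 2) * η i := fun i => by
      rw [hΓ.spray_eq z hzU η hη, spray_hermNorm hD ha hpos hx.1]
      linear_combination (-1 / 2 : ℂ) * hq i
    have e2 : (∑ i, (spray M z η i - spray (hermNorm a) z η i) * star (η i))
        / ∑ i, η i * star (η i) = -(q / 2) := by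
      rw [div_eq_iff (hne _ hx), Finset.mul_sum]
      exact Finset.sum_congr rfl fun i _ => by rw [e]; ring
    rw [hΓ.thetaStar_eq z hzU η hη, thetaStar_hermNorm hD ha hpos hx.1
      (chernConn_symm_of_projective hD ha hpos hb (hb0 z hx.1) hUD hΓ hrel hzU)]
    simp only [e2]
    linear_combination e i

end Randers

/-! ### The projective change between a Hermitian metric and its flat model -/

theorem quad_basisVec (S : Fin n → Fin n → ℂ) (j : Fin n) : quad S (basisVec j) = S j j := by
  simp [quad, Pi.single_apply]

theorem quad_add_smul_basisVec (S : Fin n → Fin n → ℂ) (j k : Fin n) (t : ℂ) :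
    quad S (basisVec j + t • basisVec k) = S j j + t * (S j k + S k j) + t ^ 2 * S k k := by
  simp [quad, Pi.single_apply, mul_add, add_mul, Finset.sum_add_distrib]
  ring

theorem eq_zero_of_quad {S : Fin n → Fin n → ℂ} (hS : ∀ j k, S j k = S k j)
    (h : ∀ η, quad S η = 0) (j k : Fin n) : S j k = 0 := by
  have h1 := h (basisVec j + (1 : ℂ) • basisVec k)
  have hj := h (basisVec j)
  have hk := h (basisVec k)
  rw [quad_basisVec] at hj hk
  rw [quad_add_smul_basisVec, hj, hk, hS k j] at h1
  linear_combination (1 / 2 : ℂ) * h1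

/-- A symmetric quadratic map whose values are multiples of the argument is a multiple of the
identity by a linear form. -/
theorem eq_of_quad_parallel {S : Fin n → Fin n → Fin n → ℂ} (hS : ∀ i j k, S i j k = S i k j)
    (h : ∀ η : Cn n, η ≠ 0 → ∃ q : ℂ, ∀ i, quad (S i) η = q * η i) (i j k : Fin n) :
    S i j k = (1 / 2 : ℂ) * S j j j * (if i = k then 1 else 0)
      + (1 / 2 : ℂ) * S k k k * (if i = j then 1 else 0) := by
  have hd : ∀ i j, i ≠ j → S i j j = 0 := by
    intro i j hij
    obtain ⟨q, hq⟩ := h (basisVec j) (by simp)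
    have := hq i
    rw [quad_basisVec] at this
    rw [this, show (basisVec j : Cn n) i = 0 from Pi.single_eq_of_ne hij _, mul_zero]
  by_cases hjk : j = k
  · subst hjk
    by_cases hij : i = j
    · subst hij; simp; ring
    · simp [hij, hd i j hij]
  have hkj : k ≠ j := fun h => hjk h.symm
  have key : ∀ t : ℂ, ∃ q : ℂ, ∀ i, S i j j + t * (2 * S i j k) + t ^ 2 * S i k k
      = q * ((basisVec j : Cn n) i + t * (basisVec k : Cn n) i) := by
    intro t
    obtain ⟨q, hq⟩ := h (basisVec j + t • basisVec k) (by
      intro h0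
      have := congrFun h0 j
      simp [hjk] at this)
    refine ⟨q, fun i => ?_⟩
    have := hq i
    rw [quad_add_smul_basisVec, hS i k j] at this
    simp only [Pi.add_apply, Pi.smul_apply, smul_eq_mul] at this
    linear_combination this
  -- Evaluating at `e_j + e_k` and `e_j - e_k`, components `j` and `k` give four equations from
  -- which `q` and `r` are eliminated.
  obtain ⟨q, hq⟩ := key 1
  obtain ⟨r, hr⟩ := key (-1)
  have q1 := hq j
  have q2 := hq k
  have r1 := hr j
  have r2 := hr k
  simp only [Pi.single_apply, hjk, hkj, if_true, if_false, hd j k hjk, hd k j hkj] at q1 q2 r1 r2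
  by_cases hij : i = j
  · subst hij
    simp only [hjk, if_true, if_false]
    linear_combination (1 / 4 : ℂ) * (q1 - r1 - q2 - r2)
  by_cases hik : i = k
  · subst hik
    simp only [hkj, if_true, if_false]
    linear_combination (1 / 4 : ℂ) * (q2 - q1 - r2 - r1)
  · have := hq i
    simp only [Pi.single_apply, hij, hik, if_false, hd i j hij, hd i k hik] at this
    simp only [hij, hik, if_false]
    linear_combination (1 / 2 : ℂ) * this

/-- The one-form of the projective change from `Γ` to the connection of `a`. -/
def projForm (a : Cn n → Matrix (Fin n) (Fin n) ℂ) (Γ : Cn n → Fin n → Fin n → Fin n → ℂ)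
    (z : Cn n) : Cn n := fun j => (1 / 2 : ℂ) * (chernConn a z j j j - Γ z j j j)

/-! ### First-order equations for `a` and `b` in terms of `Γ` and the form `c`. -/

section Randers

variable {D U : Set (Cn n)} {a : Cn n → Matrix (Fin n) (Fin n) ℂ} {b : Cn n → Cn n}
  {Γ : Cn n → Fin n → Fin n → Fin n → ℂ} {z : Cn n} {M : Cn n → Cn n → ℝ}

variable (hn : 2 ≤ n) (hD : IsOpen D) (ha : ∀ i j : Fin n, ContDiffOn ℝ ∞ (fun z => a z i j) D)
  (hpos : ∀ z ∈ D, (a z).PosDef) (hb : ContDiffOn ℝ ∞ b D) (hb0 : ∀ z ∈ D, b z ≠ 0)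
  (hUD : U ⊆ D) (hΓ : IsFlatModel U Γ M)
  (hrel : ProjRelated (randersDomain D b) (randers a b) M) (hz : z ∈ U)

include hD ha hpos hb hb0 hUD hΓ hrel hz

/-- Both connections are symmetric and their quadratic difference is pointwise parallel to `η`;
`eq_of_quad_parallel` then makes the factor linear in `η`. -/
theorem chernConn_eq (i j k : Fin n) :
    chernConn a z i j k = Γ z i j k + projForm a Γ z j * (if i = k then 1 else 0)
      + projForm a Γ z k * (if i = j then 1 else 0) := by
  have := eq_of_quad_parallel (S := fun i j k => chernConn a z i j k - Γ z i j k)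
    (fun i j k => by
      rw [chernConn_symm_of_projective hD ha hpos hb (hb0 z (hUD hz)) hUD hΓ hrel hz i j k,
        hΓ.symm z hz i j k])
    (fun η hη => by
      obtain ⟨q, hq⟩ := exists_spray_parallel hD ha hpos hb (hb0 z (hUD hz)) hUD hΓ hrel hz hη
      refine ⟨q, fun i => ?_⟩
      rw [← hq i]
      simp [quad, sub_mul, Finset.sum_sub_distrib]) i j k
  rw [projForm, projForm]
  linear_combination this

theorem quad_chernConn_eq (i : Fin n) (η : Cn n) :
    quad (chernConn a z i) η = quad (Γ z i) η + 2 * lin (projForm a Γ z) η * η i := by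
  simp only [quad, chernConn_eq hD ha hpos hb hb0 hUD hΓ hrel hz, lin, add_mul,
    Finset.sum_add_distrib, mul_ite, mul_one, mul_zero, ite_mul, zero_mul, Finset.sum_ite_eq,
    Finset.mem_univ, if_true, Finset.mul_sum, Finset.sum_mul]
  rw [add_assoc]
  congr 1
  rw [← Finset.sum_add_distrib]
  have : ∀ j, ∑ k, (if i = j then projForm a Γ z k * η j * η k else 0)
      = if i = j then ∑ k, projForm a Γ z k * η j * η k else 0 := fun j => by
    split_ifs <;> simp
  simp only [Finset.sum_add_distrib, this, Finset.sum_ite_eq, Finset.mem_univ, if_true]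
  rw [← Finset.sum_add_distrib]
  exact Finset.sum_congr rfl fun _ _ => by ring

theorem dC_matrix_eq (k l j : Fin n) :
    dC (fun w => a w k l) z (basisVec j) = ∑ i, Γ z i k j * a z i l
      + projForm a Γ z j * a z k l + projForm a Γ z k * a z j l := by
  rw [← lower_chernConn hpos (hUD hz)]
  simp only [chernConn_eq hD ha hpos hb hb0 hUD hΓ hrel hz, add_mul, Finset.sum_add_distrib,
    mul_ite, mul_one, mul_zero, ite_mul, zero_mul, Finset.sum_ite_eq', Finset.mem_univ, if_true]
  ring

include hn

/-- The vector `b_m e_k - b_k e_m` lies in `ker b`, where the form of `∂b̄/∂z` vanishes. The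
identity says that the ratios `b_k / b_m` are holomorphic. -/
theorem dCbar_vector_eq (k m h : Fin n) :
    b z m * dCbar (fun w => b w k) z (basisVec h) = b z k * dCbar (fun w => b w m) z (basisVec h) := by
  have hs := fun η hη => (hrel.randers_split hD ha hpos hb hUD hΓ hz (η := η) hη).1
  have e : ∀ η, sesq (conjB b z) η (b z m • basisVec k + (-b z k) • basisVec m) = 0 := by
    refine eq_zero_of_off_hyperplane (hb0 z (hUD hz))
      (f := fun η => sesq (conjB b z) η (b z m • basisVec k + (-b z k) • basisVec m))
      (fun u v => ?_) fun η hη => ?_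
    · exact IsPoly.sesq _ (fun i => IsPoly.line u v i) fun i => IsPoly.const _
    · refine (randers_holomorphic_part hn hD ha hpos hb (hUD hz) hs hη).1 _ ?_
      rw [lin_add_right, lin_smul_right, lin_smul_right]
      simp [lin, Pi.single_apply]; ring
  have := congrArg star (e (basisVec h))
  rw [sesq_add_right, sesq_smul_right, sesq_smul_right, sesq_basisVec, sesq_basisVec] at this
  simp only [conjB, star_add, star_mul', star_star, star_zero] at this
  linear_combination this

theorem conjB_eq {m : Fin n} (hm : b z m ≠ 0) (j k : Fin n) :
    conjB b z j k = conjB b z j m / star (b z m) * star (b z k) := by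
  have := congrArg star (dCbar_vector_eq hn hD ha hpos hb hb0 hUD hΓ hrel hz k m j)
  simp only [star_mul'] at this
  have hm' : star (b z m) ≠ 0 := star_ne_zero.2 hm
  rw [conjB, conjB]
  field_simp
  linear_combination this

theorem sesq_conjB_eq {m : Fin n} (hm : b z m ≠ 0) (η ζ : Cn n) :
    sesq (conjB b z) η ζ
      = lin (fun j => conjB b z j m / star (b z m)) η * star (lin (b z) ζ) := by
  rw [sesq, lin, lin, Finset.sum_mul]
  refine Finset.sum_congr rfl fun j _ => ?_
  rw [star_sum, Finset.mul_sum]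
  refine Finset.sum_congr rfl fun k _ => ?_
  rw [conjB_eq hn hD ha hpos hb hb0 hUD hΓ hrel hz hm j k, star_mul']
  ring

/-- The factor of `F` and the factor of `a` relative to `Γ` are both read from the derivative of
`α²`. This makes the two sprays equal. -/
theorem factor_eq {η : Cn n} (hη : lin (b z) η ≠ 0) {p : ℂ}
    (hp : ∀ i, (1 / 2 : ℂ) * quad (Γ z i) η = spray (randers a b) z η i + p * η i) :
    -p = lin (projForm a Γ z) η := by
  have hs := fun η hη => (hrel.randers_split hD ha hpos hb hUD hΓ hz (η := η) hη).1
  have h1 := (projective_factor hn hD ha hpos hb (hUD hz) hs hη hp).1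
  have hη0 : η ≠ 0 := by rintro rfl; simp at hη
  obtain ⟨i, hi⟩ := Function.ne_iff.1 hη0
  have h2 := spray_parallel_of_projective hn hD ha hpos hb (hUD hz) (hb0 z (hUD hz)) hs hη0 i
  have hA : sesq (a z) η η ≠ 0 := (sesq_pos (hpos z (hUD hz)) hη0).ne'
  rw [h1, mul_div_assoc, div_self hA, quad_chernConn_eq hD ha hpos hb hb0 hUD hΓ hrel hz] at h2
  apply mul_right_cancel₀ (show η i ≠ 0 from hi)
  linear_combination (-1 / 2 : ℂ) * h2

/-- The part of `∂b` antisymmetric in `j, k` comes from the torsion equation, the symmetric part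
from the projective factor of `|β|²`; in both a common `β̄` is divided out, since `∂b̄/∂z` has rank
one by `conjB_eq`. -/
theorem dC_vector_eq {m : Fin n} (hm : b z m ≠ 0) (k j : Fin n) :
    dC (fun w => b w k) z (basisVec j) = ∑ i, Γ z i k j * b z i
      + projForm a Γ z j * b z k + projForm a Γ z k * b z j
      - conjB b z j m / star (b z m) * b z k := by
  have hs := fun η hη => (hrel.randers_split hD ha hpos hb hUD hΓ hz (η := η) hη).1
  have hθ := fun η hη => (hrel.randers_split hD ha hpos hb hUD hΓ hz (η := η) hη).2
  set σ : Cn n := fun j => conjB b z j m / star (b z m) with hσ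
  have hconj := sesq_conjB_eq hn hD ha hpos hb hb0 hUD hΓ hrel hz hm
  rw [← hσ] at hconj
  have hsymm : ∀ j k, dC (fun w => b w k) z (basisVec j) + σ j * b z k
      = dC (fun w => b w j) z (basisVec k) + σ k * b z j := by
    intro j k
    set τ : Cn n := fun k => dC (fun w => b w k) z (basisVec j) + σ j * b z k
      - (dC (fun w => b w j) z (basisVec k) + σ k * b z j) with hτ
    have e : ∀ η, lin τ η = 0 := by
      refine eq_zero_of_off_hyperplane (hb0 z (hUD hz)) (f := fun η => lin τ η)
        (fun u v => IsPoly.lin _ fun i => IsPoly.line u v i) fun η hη => ?_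
      have h1 := (randers_torsion_part hn hD ha hpos hb (hUD hz) hs hθ hη j).2
      rw [← sesq_conjB, ← sesq_conjB, hconj, hconj] at h1
      have e1 : lin τ η = lin (dVec b z (basisVec j)) η + σ j * lin (b z) η
          - (lin (dVec b z η) (basisVec j) + b z j * lin σ η) := by
        have : lin (dVec b z η) (basisVec j) = ∑ k, η k * dC (fun w => b w j) z (basisVec k) := by
          rw [← dVec_apply_eq_sum]; simp [lin, Pi.single_apply]
        rw [this]
        simp only [lin, hτ, dVec, Finset.mul_sum, ← Finset.sum_add_distrib,
          ← Finset.sum_sub_distrib]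
        exact Finset.sum_congr rfl fun _ _ => by ring
      have e2 : lin σ (basisVec j) = σ j := by simp [lin, Pi.single_apply]
      have e3 : lin (b z) (basisVec j) = b z j := by simp [lin, Pi.single_apply]
      rw [e2, e3] at h1
      apply mul_right_cancel₀ (star_ne_zero.2 hη)
      rw [e1]
      linear_combination h1
    have := e (basisVec k)
    simp only [lin, Pi.single_apply, mul_ite, mul_one, mul_zero, Finset.sum_ite_eq',
      Finset.mem_univ, if_true, hτ] at this
    exact sub_eq_zero.1 this
  -- The tensor is symmetric by `hsymm`, so it vanishes once its quadratic form does.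
  have hzero := eq_zero_of_quad (S := fun k j => covB b (Γ z) z k j + σ j * b z k
      - (projForm a Γ z j * b z k + projForm a Γ z k * b z j)) (fun k j => by
    have : ∑ i, Γ z i k j * b z i = ∑ i, Γ z i j k * b z i :=
      Finset.sum_congr rfl fun i _ => by rw [hΓ.symm z hz]
    rw [covB, covB, this]
    linear_combination hsymm j k) (fun η => by
    refine eq_zero_of_off_hyperplane (hb0 z (hUD hz)) (f := fun η => quad (fun k j =>
        covB b (Γ z) z k j + σ j * b z k
        - (projForm a Γ z j * b z k + projForm a Γ z k * b z j)) η)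
      (fun u v => IsPoly.quad _ fun i => IsPoly.line u v i) (fun η hη => ?_) η
    obtain ⟨p, hp⟩ := hs η hη
    have h1 := (projective_factor hn hD ha hpos hb (hUD hz) hs hη hp).2
    have h2 := factor_eq hn hD ha hpos hb hb0 hUD hΓ hrel hz hη hp
    rw [hconj] at h1
    have e1 : quad (fun k j => covB b (Γ z) z k j + σ j * b z k
        - (projForm a Γ z j * b z k + projForm a Γ z k * b z j)) η
        = quad (covB b (Γ z) z) η + lin σ η * lin (b z) η
          - 2 * lin (projForm a Γ z) η * lin (b z) η := by
      have p1 : ∀ u v : Cn n, ∑ k, ∑ j, u j * v k * η k * η j = lin u η * lin v η := by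
        intro u v
        rw [lin, lin, Finset.sum_mul_sum, Finset.sum_comm]
        exact Finset.sum_congr rfl fun _ _ => Finset.sum_congr rfl fun _ _ => by ring
      have p2 : ∀ u v : Cn n, ∑ k, ∑ j, u k * v j * η k * η j = lin u η * lin v η := by
        intro u v
        rw [lin, lin, Finset.sum_mul_sum]
        exact Finset.sum_congr rfl fun _ _ => Finset.sum_congr rfl fun _ _ => by ring
      simp only [quad, add_mul, sub_mul, Finset.sum_add_distrib, Finset.sum_sub_distrib, p1, p2]
      ring
    rw [e1]
    apply mul_right_cancel₀ (star_ne_zero.2 hη)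
    rw [← h2]
    linear_combination h1) k j
  simp only [covB] at hzero
  linear_combination hzero

end Randers

/-! ### Vanishing of the holomorphic curvature -/

/-- An algebraic consequence of the commutation of mixed second derivatives. -/
theorem eq_zero_of_mixed (hn : 2 ≤ n) {m : Matrix (Fin n) (Fin n) ℂ} (hm : m.PosDef) {c φ : Cn n}
    (hc : c ≠ 0) (h : ∀ h' j k l, φ h' * (c j * m k l + c k * m j l)
      = star (φ j) * (star (c h') * m k l + star (c l) * m k h')) : φ = 0 := by
  obtain ⟨v, hv0, hv⟩ := exists_ne_zero_lin_eq_zero hn c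
  have hA : sesq m v v ≠ 0 := (sesq_pos hm hv0).ne'
  set A : Fin n → ℂ := fun l => ∑ k, m k l * v k with hAdef
  have hsum : ∑ l, A l * star (v l) = sesq m v v := by
    rw [sesq, Finset.sum_comm]
    exact Finset.sum_congr rfl fun _ _ => by rw [hAdef, Finset.sum_mul]
  -- Contraction of the index `k` with `v ∈ ker c` removes the term containing `c k`.
  have h1 : ∀ h' j l, φ h' * (c j * A l) = star (φ j) * (star (c h') * A l + star (c l) * A h') := by
    intro h' j l
    have e : ∑ k, φ h' * (c j * m k l + c k * m j l) * v k
        = ∑ k, star (φ j) * (star (c h') * m k l + star (c l) * m k h') * v k :=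
      Finset.sum_congr rfl fun k _ => by rw [h]
    have e1 : ∑ k, φ h' * (c j * m k l + c k * m j l) * v k
        = φ h' * (c j * A l) + φ h' * m j l * lin c v := by
      simp only [hAdef, lin, Finset.mul_sum, ← Finset.sum_add_distrib]
      exact Finset.sum_congr rfl fun _ _ => by ring
    have e2 : ∑ k, star (φ j) * (star (c h') * m k l + star (c l) * m k h') * v k
        = star (φ j) * (star (c h') * A l + star (c l) * A h') := by
      simp only [hAdef, Finset.mul_sum, ← Finset.sum_add_distrib]
      exact Finset.sum_congr rfl fun _ _ => by ring
    rw [e1, e2, hv] at e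
    linear_combination e
  -- A second contraction, of `l` with `v̄`, removes the term containing the conjugate of `c l`.
  have h2 : ∀ h' j, φ h' * c j = star (φ j) * star (c h') := by
    intro h' j
    have e : ∑ l, φ h' * (c j * A l) * star (v l)
        = ∑ l, star (φ j) * (star (c h') * A l + star (c l) * A h') * star (v l) :=
      Finset.sum_congr rfl fun l _ => by rw [h1]
    have hv' : ∑ l, star (c l) * star (v l) = 0 := by
      simpa [lin] using congrArg star hv
    have e1 : ∑ l, φ h' * (c j * A l) * star (v l) = φ h' * c j * sesq m v v := by
      rw [← hsum, Finset.mul_sum]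
      exact Finset.sum_congr rfl fun _ _ => by ring
    have e2 : ∑ l, star (φ j) * (star (c h') * A l + star (c l) * A h') * star (v l)
        = star (φ j) * star (c h') * sesq m v v
          + star (φ j) * A h' * ∑ l, star (c l) * star (v l) := by
      rw [← hsum, Finset.mul_sum, Finset.mul_sum, ← Finset.sum_add_distrib]
      exact Finset.sum_congr rfl fun _ _ => by ring
    rw [e1, e2, hv', mul_zero, add_zero] at e
    exact mul_right_cancel₀ hA e
  obtain ⟨l, hl⟩ := Function.ne_iff.1 hc
  obtain ⟨q, hq⟩ : ∃ q, A q ≠ 0 := by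
    by_contra! hq
    exact hA (by rw [← hsum]; simp [hq])
  funext j
  -- Substituting `h2` into `h1` cancels all but one term; `l` and `q` are chosen so that its other
  -- factors are nonzero.
  have e : star (φ j) * star (c l) * A q = 0 := by
    linear_combination (-1 : ℂ) * h1 q j l + A l * h2 q j
  have := (mul_eq_zero.1 ((mul_eq_zero.1 e).resolve_right hq)).resolve_right (star_ne_zero.2 hl)
  exact star_eq_zero.1 this

section Randers

variable {D U : Set (Cn n)} {a : Cn n → Matrix (Fin n) (Fin n) ℂ} {b : Cn n → Cn n}
  {Γ : Cn n → Fin n → Fin n → Fin n → ℂ} {z : Cn n} {M : Cn n → Cn n → ℝ}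

variable (hn : 2 ≤ n) (hD : IsOpen D) (ha : ∀ i j : Fin n, ContDiffOn ℝ ∞ (fun z => a z i j) D)
  (hpos : ∀ z ∈ D, (a z).PosDef) (hb : ContDiffOn ℝ ∞ b D) (hb0 : ∀ z ∈ D, b z ≠ 0)
  (hU : IsOpen U) (hUD : U ⊆ D) (hΓ : IsFlatModel U Γ M)
  (hrel : ProjRelated (randersDomain D b) (randers a b) M) (hz : z ∈ U)

include hD ha hpos in
theorem contDiffOn_chernConn (i j k : Fin n) : ContDiffOn ℝ ∞ (fun z => chernConn a z i j k) D :=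
  ContDiffOn.sum fun m _ =>
    (ContDiffOn.matrix_inv ha (fun z hz => (hpos z hz).det_pos.ne') m i).mul
      (contDiffOn_dC hD (ha j m) _)

include hU hΓ hz in
theorem IsFlatModel.hasWirt (i j k : Fin n) (V : Cn n) :
    HasWirt (fun w => Γ w i j k) z V (dC (fun w => Γ w i j k) z V) 0 := by
  have h := HasWirt.of_holo
    ((hΓ.holo i j k).differentiableAt (hU.mem_nhds hz)).hasFDerivAt V
  exact h.of_eq h.dC_eq.symm rfl

include hD ha hpos hU hUD hΓ hz in
theorem hasWirt_projForm (j : Fin n) (V : Cn n) :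
    HasWirt (fun w => projForm a Γ w j) z V (dC (fun w => projForm a Γ w j) z V)
      (dCbar (fun w => projForm a Γ w j) z V) := by
  refine ComplexFinsler.hasWirt ?_ V
  exact (((ComplexFinsler.hasWirt (((contDiffOn_chernConn hD ha hpos j j j).differentiableOn
    (by simp)).differentiableAt (hD.mem_nhds (hUD hz))) V).sub
    (hΓ.hasWirt hU hz j j j V)).const_mul (1 / 2)).diff

include hn hD ha hpos hb hb0 hU hUD hΓ hrel hz in
/-- The antiholomorphic derivatives of the projective change are proportional to `b`. -/
theorem dCbar_projForm_eq {m : Fin n} (hm : b z m ≠ 0) (k h : Fin n) :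
    dCbar (fun w => projForm a Γ w k) z (basisVec h)
      = b z k / b z m * dCbar (fun w => projForm a Γ w m) z (basisVec h) := by
  have hbk := fun k => contDiffOn_pi.1 hb k
  have hcont : ContinuousOn (fun w => b w m) U := ((hbk m).continuousOn).mono hUD
  have hW : IsOpen (U ∩ (fun w => b w m) ⁻¹' {0}ᶜ) :=
    hcont.isOpen_inter_preimage hU isOpen_compl_singleton
  set W := U ∩ (fun w => b w m) ⁻¹' {0}ᶜ
  have hzW : z ∈ W := ⟨hz, hm⟩
  have hd : ∀ w ∈ W, ∀ k V, HasWirt (fun y => b y k) w V (dC (fun y => b y k) w V)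
      (dCbar (fun y => b y k) w V) := fun w hw k V =>
    hasWirt (((hbk k).differentiableOn (by simp)).differentiableAt (hD.mem_nhds (hUD hw.1))) V
  have hcs : ∀ k, ContDiffOn ℝ ∞ (fun w => b w k / b w m) W := fun k => by
    simp only [div_eq_mul_inv]
    exact ((hbk k).mono fun w hw => hUD hw.1).mul
      (((hbk m).mono fun w hw => hUD hw.1).inv fun w hw => hw.2)
  have hcbar : ∀ w ∈ W, ∀ k h, dCbar (fun y => b y k / b y m) w (basisVec h) = 0 := by
    intro w hw k h
    rw [((hd w hw k _).div (hd w hw m _) hw.2).dCbar_eq]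
    rw [div_eq_zero_iff]; left
    linear_combination dCbar_vector_eq hn hD ha hpos hb hb0 hUD hΓ hrel hw.1 k m h
  have hc : ∀ k V, HasWirt (fun w => b w k / b w m) z V (dC (fun w => b w k / b w m) z V)
      (dCbar (fun w => b w k / b w m) z V) := fun k V => hasWirt
    (((hcs k).differentiableOn (by simp)).differentiableAt (hW.mem_nhds hzW)) V
  -- Differentiating the ratio `b_k / b_m` along `zᵐ` with `dC_vector_eq`, the terms in `∂b̄` cancel
  -- and `c_k - (b_k/b_m) c_m` is left, up to terms built from `Γ` and the ratios.
  have hder : ∀ w ∈ W, projForm a Γ w k = b w k / b w m * projForm a Γ w m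
      + (dC (fun y => b y k / b y m) w (basisVec m) - ∑ i, Γ w i k m * (b w i / b w m)
        + b w k / b w m * ∑ i, Γ w i m m * (b w i / b w m)) := by
    intro w hw
    have hw2 : b w m ≠ 0 := hw.2
    rw [((hd w hw k (basisVec m)).div (hd w hw m _) hw2).dC_eq,
      dC_vector_eq hn hD ha hpos hb hb0 hUD hΓ hrel hw.1 hw2 k m,
      dC_vector_eq hn hD ha hpos hb hb0 hUD hΓ hrel hw.1 hw2 m m]
    simp only [← mul_div_assoc, ← Finset.sum_div]
    generalize conjB b w m m / star (b w m) = σ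
    field_simp
    ring
  have hdd : HasWirt (fun w => dC (fun y => b y k / b y m) w (basisVec m)) z (basisVec h)
      (dC (fun w => dC (fun y => b y k / b y m) w (basisVec m)) z (basisVec h)) 0 := by
    have hsm := contDiffOn_dC hW (hcs k) (basisVec m)
    refine (hasWirt ((hsm.differentiableOn (by simp)).differentiableAt (hW.mem_nhds hzW))
      (basisVec h)).of_eq rfl ?_
    -- The `z`-derivative of a holomorphic ratio is again holomorphic, as `∂` and `∂̄` commute.
    rw [← dC_dCbar_comm (((hcs k).contDiffAt (hW.mem_nhds hzW)).of_le (by norm_cast))]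
    refine ((HasWirt.const 0).congr ?_).dC_eq
    filter_upwards [hW.mem_nhds hzW] with w hw using hcbar w hw k h
  have hΓw := fun i j k => hΓ.hasWirt hU hz i j k (basisVec h)
  have htot := ((((hc k (basisVec h)).mul
    (hasWirt_projForm hD ha hpos hU hUD hΓ hz m (basisVec h))).add
    ((hdd.sub (HasWirt.sum Finset.univ fun i _ => (hΓw i k m).mul (hc i (basisVec h)))).add
    ((hc k (basisVec h)).mul (HasWirt.sum Finset.univ fun i _ =>
      (hΓw i m m).mul (hc i (basisVec h)))))).congr (g := fun w => projForm a Γ w k) (by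
        filter_upwards [hW.mem_nhds hzW] with w hw using hder w hw))
  rw [htot.dCbar_eq]
  simp [hcbar z hzW]

include hn hD ha hpos hb hb0 hU hUD hΓ hrel hz in
-- `∂ⱼ a` and its conjugate are known in terms of `Γ` and `c`. Equating the two mixed derivatives of
-- `a`, the terms with derivatives of `Γ` vanish and the products of first-order terms match; the
-- remaining terms in `∂̄c` form the hypothesis of `eq_zero_of_mixed`.
theorem dCbar_projForm_eq_zero (k h : Fin n) :
    dCbar (fun w => projForm a Γ w k) z (basisVec h) = 0 := by
  have hbz := hb0 z (hUD hz)
  obtain ⟨m, hm⟩ := Function.ne_iff.1 hbz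
  have hm : b z m ≠ 0 := hm
  have hp := dCbar_projForm_eq hn hD ha hpos hb hb0 hU hUD hΓ hrel hz hm
  suffices hφ : (fun h => dCbar (fun w => projForm a Γ w m) z (basisVec h)) = 0 by
    rw [hp, congrFun hφ h]; simp
  refine eq_zero_of_mixed hn (hpos z (hUD hz)) (c := fun k => b z k / b z m) (fun h0 => ?_)
    fun h j k l => ?_
  · have := congrFun h0 m
    simp [hm] at this
  have hdC := fun w (hw : w ∈ U) => dC_matrix_eq hD ha hpos hb hb0 hUD hΓ hrel hw
  have had : ∀ w ∈ U, ∀ k l V, HasWirt (fun y => a y k l) w V (dC (fun y => a y k l) w V)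
      (dCbar (fun y => a y k l) w V) := fun w hw k l V =>
    hasWirt (((ha k l).differentiableOn (by simp)).differentiableAt (hD.mem_nhds (hUD hw))) V
  have hherm : ∀ w ∈ U, ∀ k l, star (a w k l) = a w l k := fun w hw k l =>
    (hpos w (hUD hw)).isHermitian.apply l k
  have hdbar : ∀ w ∈ U, ∀ k l h, dCbar (fun y => a y k l) w (basisVec h)
      = ∑ i, star (Γ w i l h) * a w k i + star (projForm a Γ w h) * a w k l
        + star (projForm a Γ w l) * a w k h := by
    intro w hw k l h
    have e := (had w hw l k (basisVec h)).conj.congr (g := fun y => a y k l) (by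
      filter_upwards [hU.mem_nhds hw] with y hy using (hherm y hy l k).symm)
    rw [e.dCbar_eq, hdC w hw]
    simp only [star_add, star_sum, star_mul', hherm w hw]
  have hΓw := fun i j k V => hΓ.hasWirt hU hz i j k V
  have hpw := fun k V => hasWirt_projForm hD ha hpos hU hUD hΓ hz k V
  have h1 := (((HasWirt.sum Finset.univ fun i _ => (hΓw i k j (basisVec h)).mul
    (had z hz i l (basisVec h))).add ((hpw j (basisVec h)).mul (had z hz k l _))).add
    ((hpw k (basisVec h)).mul (had z hz j l _))).congr
    (g := fun w => dC (fun y => a y k l) w (basisVec j)) (by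
      filter_upwards [hU.mem_nhds hz] with w hw using hdC w hw k l j)
  have h2 := (((HasWirt.sum Finset.univ fun i _ => (hΓw i l h (basisVec j)).conj.mul
    (had z hz k i (basisVec j))).add ((hpw h (basisVec j)).conj.mul (had z hz k l _))).add
    ((hpw l (basisVec j)).conj.mul (had z hz k h _))).congr
    (g := fun w => dCbar (fun y => a y k l) w (basisVec h)) (by
      filter_upwards [hU.mem_nhds hz] with w hw using hdbar w hw k l h)
  have hcomm := dC_dCbar_comm (((ha k l).contDiffAt (hD.mem_nhds (hUD hz))).of_le
    (by norm_cast)) (basisVec j) (basisVec h)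
  rw [h1.dCbar_eq, h2.dC_eq, hp j h, hp k h, hp h j, hp l j] at hcomm
  simp only [hdC z hz, hdbar z hz, star_zero, zero_mul, zero_add, star_mul', mul_add,
    Finset.sum_add_distrib] at hcomm
  have s1 : ∑ i, Γ z i k j * ∑ q, star (Γ z q l h) * a z i q
      = ∑ q, star (Γ z q l h) * ∑ i, Γ z i k j * a z i q := by
    simp only [Finset.mul_sum]
    rw [Finset.sum_comm]
    exact Finset.sum_congr rfl fun _ _ => Finset.sum_congr rfl fun _ _ => by ring
  have s2 : ∀ (c : ℂ) (f g : Fin n → ℂ), ∑ i, f i * (c * g i) = c * ∑ i, f i * g i :=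
    fun c f g => by
      rw [Finset.mul_sum]; exact Finset.sum_congr rfl fun _ _ => by ring
  simp only [s1, s2] at hcomm
  linear_combination -hcomm

include hn hD ha hpos hb hb0 hU hUD hΓ hrel hz in
-- The spray is `½ Γ(η, η) + c(η) η`, and both `Γ` and `c` are holomorphic in `z`.
theorem delbar_spray_hermNorm (η : Cn n) (i h : Fin n) :
    delbar h (fun w => spray (hermNorm a) w η i) z = 0 := by
  rw [delbar_eq_dCbar]
  have hΓw := fun i j k => hΓ.hasWirt hU hz i j k (basisVec h)
  have hpw := fun k => (hasWirt_projForm hD ha hpos hU hUD hΓ hz k (basisVec h)).of_eq rfl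
    (dCbar_projForm_eq_zero hn hD ha hpos hb hb0 hU hUD hΓ hrel hz k h)
  have h1 := (((HasWirt.sum Finset.univ fun j _ => HasWirt.sum Finset.univ fun k _ =>
      ((hΓw i j k).mul (HasWirt.const (η j))).mul (HasWirt.const (η k))).const_mul (1 / 2)).add
    ((HasWirt.sum Finset.univ fun j _ => (hpw j).mul (HasWirt.const (η j))).mul
      (HasWirt.const (η i)))).congr (g := fun w => spray (hermNorm a) w η i) (by
      filter_upwards [hU.mem_nhds hz] with w hw
      rw [spray_hermNorm hD ha hpos (hUD hw),
        quad_chernConn_eq hD ha hpos hb hb0 hUD hΓ hrel hw, quad, lin]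
      ring)
  rw [h1.dCbar_eq]
  simp

include hn hD ha hpos hb hb0 hUD hΓ hrel hz in
/-- A locally projectively flat Randers metric has the spray of its Hermitian part. -/
theorem spray_randers_eq {η : Cn n} (hη : lin (b z) η ≠ 0) (i : Fin n) :
    spray (randers a b) z η i = spray (hermNorm a) z η i := by
  obtain ⟨p, hp⟩ := (hrel.randers_split hD ha hpos hb hUD hΓ hz hη).1
  rw [spray_hermNorm hD ha hpos (hUD hz),
    quad_chernConn_eq hD ha hpos hb hb0 hUD hΓ hrel hz,
    ← factor_eq hn hD ha hpos hb hb0 hUD hΓ hrel hz hη hp]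
  linear_combination -hp i

theorem holCurv_eq_zero {F : Cn n → Cn n → ℝ} {η : Cn n}
    (h : ∀ i h', delbar h' (fun w => spray F w η i) z = 0) : holCurv F z η = 0 := by
  simp [holCurv, h]

include hn hD ha hpos hb hb0 hU hUD hΓ hrel hz in
theorem holCurv_hermNorm_eq_zero (η : Cn n) : holCurv (hermNorm a) z η = 0 :=
  holCurv_eq_zero fun i h =>
    delbar_spray_hermNorm hn hD ha hpos hb hb0 hU hUD hΓ hrel hz η i h

include hn hD ha hpos hb hb0 hU hUD hΓ hrel hz in
theorem holCurv_randers_eq_zero {η : Cn n} (hη : lin (b z) η ≠ 0) :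
    holCurv (randers a b) z η = 0 := by
  refine holCurv_eq_zero fun i h => ?_
  rw [← delbar_spray_hermNorm hn hD ha hpos hb hb0 hU hUD hΓ hrel hz η i h, delbar_eq_dCbar,
    delbar_eq_dCbar]
  have hx : (z, η) ∈ randersDomain D b := ⟨hUD hz, hη⟩
  -- The sprays agree at all nearby base points, not only at `z`, because `β(w, η) ≠ 0` is an open
  -- condition on `w`.
  have he : (fun w => spray (randers a b) w η i) =ᶠ[𝓝 z] fun w => spray (hermNorm a) w η i := by
    filter_upwards [hU.mem_nhds hz, (conicOn_randers hD ha hpos hb).eventually_left hx]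
      with w hw hw' using spray_randers_eq hn hD ha hpos hb hb0 hUD hΓ hrel hw hw'.2 i
  rw [dCbar, dCbar, he.fderiv_eq]

end Randers

end ComplexFinsler

end

theorem proposition4p2 (n : ℕ) (D : Set (ComplexFinsler.Cn n))
    (hD : IsOpen D) (hDc : IsConnected D)
    (a : ComplexFinsler.Cn n → Matrix (Fin n) (Fin n) ℂ)
    (ha : ∀ i j : Fin n, ContDiffOn ℝ ∞ (fun z => a z i j) D)
    (hpos : ∀ z ∈ D, (a z).PosDef)
    (b : ComplexFinsler.Cn n → ComplexFinsler.Cn n)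
    (hb : ContDiffOn ℝ ∞ b D)
    (hb0 : ∀ z ∈ D, b z ≠ 0) :
    (ComplexFinsler.IsLocProjFlat D (ComplexFinsler.randersDomain D b)
        (ComplexFinsler.randers a b) ↔
      ComplexFinsler.ProjRelated (ComplexFinsler.randersDomain D b)
          (ComplexFinsler.hermNorm a) (ComplexFinsler.randers a b) ∧
        ComplexFinsler.IsLocProjFlat D (ComplexFinsler.slit D)
          (ComplexFinsler.hermNorm a)) ∧
    (2 ≤ n →
      (ComplexFinsler.IsLocProjFlat D (ComplexFinsler.randersDomain D b)
          (ComplexFinsler.randers a b) ∨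
        (ComplexFinsler.ProjRelated (ComplexFinsler.randersDomain D b)
            (ComplexFinsler.hermNorm a) (ComplexFinsler.randers a b) ∧
          ComplexFinsler.IsLocProjFlat D (ComplexFinsler.slit D)
            (ComplexFinsler.hermNorm a))) →
      (∀ z η : ComplexFinsler.Cn n, (z, η) ∈ ComplexFinsler.randersDomain D b →
        ComplexFinsler.holCurv (ComplexFinsler.randers a b) z η = 0) ∧
      (∀ z η : ComplexFinsler.Cn n, (z, η) ∈ ComplexFinsler.slit D →
        ComplexFinsler.holCurv (ComplexFinsler.hermNorm a) z η = 0)) := by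
  have hsub := ComplexFinsler.randersDomain_subset_slit D b
  have hiff : ComplexFinsler.ProjRelated (ComplexFinsler.randersDomain D b)
          (ComplexFinsler.hermNorm a) (ComplexFinsler.randers a b) ∧
        ComplexFinsler.IsLocProjFlat D (ComplexFinsler.slit D) (ComplexFinsler.hermNorm a) →
      ComplexFinsler.IsLocProjFlat D (ComplexFinsler.randersDomain D b)
        (ComplexFinsler.randers a b) := by
    rintro ⟨hF, M, hM, hL, hrel⟩
    exact ⟨M, hM, hL, hF.symm.trans (hrel.mono hsub)⟩
  refine ⟨⟨?_, hiff⟩, fun hn h => ?_⟩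
  · rintro ⟨M, hM, hL, hrel⟩
    have key := hrel.hermNorm_of_randers hD ha hpos hb hb0 hM hL
    -- `M` serves as the common flat model: `a` is related to `M` on the larger slit bundle, and the
    -- relation between `a` and `F` passes through `M`.
    exact ⟨(key.mono hsub).trans hrel.symm, M, hM, hL, key⟩
  · obtain ⟨M, hM, hL, hrel⟩ := h.elim id hiff
    refine ⟨fun z η hx => ?_, fun z η hx => ?_⟩
    · obtain ⟨U, hU, hzU, hUD, Γ, hΓ⟩ := hL.exists_flatModel hD hM hx.1
      exact ComplexFinsler.holCurv_randers_eq_zero hn hD ha hpos hb hb0 hU hUD hΓ hrel hzU hx.2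
    · obtain ⟨U, hU, hzU, hUD, Γ, hΓ⟩ := hL.exists_flatModel hD hM hx.1
      exact ComplexFinsler.holCurv_hermNorm_eq_zero hn hD ha hpos hb hb0 hU hUD hΓ hrel hzU η
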